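/- Let $\ell\ge 2$, and let $X_{i,j}$ ($1\le i,j\le\ell$) and $E_{m,n}$ ($m,n\in\mathbb Z+\frac12$) be matrix units. **Notation.** $\widehat{\mathfrak{sl}}_\ell=(\mathfrak{sl}_\ell\otimes\mathbb C[t,t^{-1}])\oplus\mathbb Cc\oplus\mathbb Cd$ is the affine Lie algebra with $c$ central, $[d,X\otimes t^n]=nX\otimes t^n$ and $[X\otimes t^n,Y\otimes t^m]=(XY-YX)\otimes t^{n+m}+n\,\delta_{n,-m}\operatorname{tr}(XY)\,c$; its derived algebra is $\widehat{\mathfrak{sl}}_\ell'=(\mathfrak{sl}_\ell\otimes\mathbb C[t,t^{-1}])\oplus\mathbb Cc$. It has Chevalley generators $E_i=X_{i,i+1}\otimes1$, $F_i=X_{i+1,i}\otimes1$ ($1\le i\le\ell-1$), $E_0=X_{\ell,1}\otimes t$, $F_0=X_{1,\ell}\otimes t^{-1}$; put $H_i=[E_i,F_i]$. For $r\in\mathbb Z/\ell\mathbb Z$, $V_{\Lambda_r}$ is the irreducible highest weight representation of $\widehat{\mathfrak{sl}}_\ell$ whose highest weight $\Lambda_r$ satisfies $\Lambda_r(H_i)=1$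 if $i\equiv r$ mod $\ell$, $\Lambda_r(H_i)=0$ otherwise, and $\Lambda_r(d)=0$. $a_\infty$ is the central extension by $\mathbb Cc$ of the Lie algebra of complex matrices $(a_{m,n})_{m,n\in\mathbb Z+\frac12}$ of finite bandwidth (for some $k$, $a_{m,n}=0$ whenever $|m-n|>k$). A matrix $X$, regarded as an element of $a_\infty$, is written $\overline X$. The bracket is determined by $[\overline E_{m,n},\overline E_{p,q}]=\overline{[E_{m,n},E_{p,q}]}+\epsilon_{m,n}\delta_{m,q}\delta_{n,p}\,c$, where $\epsilon_{m,n}=1$ if $m<0<n$, $\epsilon_{m,n}=-1$ if $n<0<m$, and $\epsilon_{m,n}=0$ otherwise (extended to infinite sums; the coefficient of $c$ in a bracket is always a finite sum). Fermionic Fock space ${\bf F}$ has as basis the Maya diagrams (sets of black positions in $\mathbb Z+\frac12$ containing all but finitely many negative and only finitely many positive positions), equivalently the normally ordered semi-infinite wedges of the $e_m$ over the black positions $m$. The charge of a diagram is the number of black positive positions minus the number of non-black negative positions, and ${\bf F}^{(h)}$ is the span of the diagrams of charge $h$. Let $\psi_m v=e_m\wedge v$, and let $\psi_m^*$ be the adjoint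 operator (the diagrams being orthonormal). The action of $a_\infty$ on ${\bf F}$ is given by $c\mapsto1$ and $\sum a_{m,n}\overline E_{m,n}\mapsto\sum a_{m,n}\,{:}\psi_m\psi_n^*{:}$, where ${:}\psi_m\psi_n^*{:}=\psi_m\psi_n^*$ if $m\ne n$ or $m>0$, and ${:}\psi_n\psi_n^*{:}=-\psi_n^*\psi_n$ if $n<0$. On each basis vector only finitely many terms are non-zero. **Proposition.** 1. There is an injective Lie algebra homomorphism $\varphi:\widehat{\mathfrak{sl}}_\ell'\to a_\infty$ with $\varphi(c)=c$ which is given, linearly in $X=\sum x_{i,j}X_{i,j}\in\mathfrak{sl}_\ell$, by $$X_{i,j}\otimes t^m\mapsto\sum_{k\in\mathbb Z}\overline E_{\,i-\frac12+k\ell,\;j-\frac12+k\ell+m\ell}.$$ The action of $a_\infty$ on ${\bf F}$ described above is a faithful representation. Hence ${\bf F}$ carries a faithful action of $\widehat{\mathfrak{sl}}_\ell'$, in which $c$ acts as $1$. 2. Each ${\bf F}^{(h)}$, $h\in\mathbb Z$, is preserved by the action of $\widehat{\mathfrak{sl}}_\ell'$. 3. Each ${\bf F}^{(h)}$ is the sum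 of its irreducible $\widehat{\mathfrak{sl}}_\ell'$-subrepresentations, and each of these subrepresentations is isomorphic, as a representation of $\widehat{\mathfrak{sl}}_\ell'$, to the restriction of $V_{\Lambda_{\bar h}}$, where $\bar h$ is the class of $h$ mod $\ell$. -/

import Mathlib

open scoped LaurentPolynomial

attribute [local instance] LieRing.ofAssociativeRing

noncomputable section

/-! ### Conventions

Half-integers are coded by integers: `p : ℤ` stands for `p - 1/2 ∈ ℤ + 1/2`.  Thus `0 < p` says that
the half-integer is positive and `p ≤ 0` that it is negative, and differences are preserved.
Rows and columns of `ℓ × ℓ` matrices are numbered `0, …, ℓ - 1` by `Fin ℓ`; the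
row or column `i : Fin ℓ` is the one usually numbered `i + 1`.
-/

/-! ### Affine Lie algebras -/

/-- The derivation `t d/dt` of `ℂ[t, t⁻¹]`: it multiplies `tⁿ` by `n`. -/
def laurentEuler : ℂ[T;T⁻¹] →ₗ[ℂ] ℂ[T;T⁻¹] where
  toFun f := .ofCoeff (Finsupp.onFinset f.coeff.support (fun n => (n : ℂ) * f.coeff n)
    (fun n hn => Finsupp.mem_support_iff.2 (right_ne_zero_of_mul hn)))
  map_add' f g := by ext n; simp [mul_add]
  map_smul' r f := by ext n; simp; ring

lemma laurentEuler_coeff (f : ℂ[T;T⁻¹]) (n : ℤ) :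
    (laurentEuler f).coeff n = n * f.coeff n := rfl

lemma laurentEuler_single (n : ℤ) (a : ℂ) :
    laurentEuler (.single n a) = .single n (n * a) := by
  ext k
  rw [laurentEuler_coeff, AddMonoidAlgebra.coeff_single, AddMonoidAlgebra.coeff_single]
  by_cases h : n = k
  · subst h; simp
  · simp [h]

lemma laurentEuler_mul (f g : ℂ[T;T⁻¹]) :
    laurentEuler (f * g) = laurentEuler f * g + f * laurentEuler g := by
  induction f using AddMonoidAlgebra.induction_linear with
  | zero => simp
  | add f f' hf hf' => simp only [add_mul, map_add, hf, hf']; ring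
  | single m a =>
    induction g using AddMonoidAlgebra.induction_linear with
    | zero => simp
    | add f f' hf hf' => simp only [mul_add, map_add, hf, hf']; ring
    | single n b =>
      simp only [AddMonoidAlgebra.single_mul_single, laurentEuler_single]
      rw [← AddMonoidAlgebra.single_add]
      congr 1
      push_cast; ring

/-- The affine Lie algebra `(gl_ℓ ⊗ ℂ[t, t⁻¹]) ⊕ ℂ c ⊕ ℂ d`. An element of `gl_ℓ ⊗ ℂ[t, t⁻¹]` is
written as a matrix of Laurent polynomials; `X ⊗ tⁿ` is the matrix with entries `X_{ij} tⁿ`. -/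
@[ext] structure AffineGl (ℓ : ℕ) where
  mat : Matrix (Fin ℓ) (Fin ℓ) ℂ[T;T⁻¹]
  c : ℂ
  d : ℂ

namespace AffineGl

variable {ℓ : ℕ}

def equivProd (ℓ : ℕ) : AffineGl ℓ ≃ Matrix (Fin ℓ) (Fin ℓ) ℂ[T;T⁻¹] × ℂ × ℂ where
  toFun x := (x.mat, x.c, x.d)
  invFun x := ⟨x.1, x.2.1, x.2.2⟩

instance : AddCommGroup (AffineGl ℓ) := (equivProd ℓ).addCommGroup

instance : Module ℂ (AffineGl ℓ) := (equivProd ℓ).module ℂ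

@[simp] lemma mat_zero : (0 : AffineGl ℓ).mat = 0 := rfl
@[simp] lemma c_zero : (0 : AffineGl ℓ).c = 0 := rfl
@[simp] lemma d_zero : (0 : AffineGl ℓ).d = 0 := rfl
@[simp] lemma mat_add (x y : AffineGl ℓ) : (x + y).mat = x.mat + y.mat := rfl
@[simp] lemma c_add (x y : AffineGl ℓ) : (x + y).c = x.c + y.c := rfl
@[simp] lemma d_add (x y : AffineGl ℓ) : (x + y).d = x.d + y.d := rfl
@[simp] lemma mat_smul (r : ℂ) (x : AffineGl ℓ) : (r • x).mat = r • x.mat := rfl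
@[simp] lemma c_smul (r : ℂ) (x : AffineGl ℓ) : (r • x).c = r * x.c := rfl
@[simp] lemma d_smul (r : ℂ) (x : AffineGl ℓ) : (r • x).d = r * x.d := rfl

/-- `t d/dt`, applied to each entry of a matrix of Laurent polynomials. -/
def euler :
    Matrix (Fin ℓ) (Fin ℓ) ℂ[T;T⁻¹] →ₗ[ℂ] Matrix (Fin ℓ) (Fin ℓ) ℂ[T;T⁻¹] :=
  laurentEuler.mapMatrix

lemma euler_mul (X Y : Matrix (Fin ℓ) (Fin ℓ) ℂ[T;T⁻¹]) :
    euler (X * Y) = euler X * Y + X * euler Y := by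
  ext1 i j
  simp [euler, Matrix.mul_apply, laurentEuler_mul, Finset.sum_add_distrib]

/-- The form `(X ⊗ tⁿ, Y ⊗ tᵐ) ↦ δ_{n,-m} tr(XY)`: the constant term of the trace of the product. -/
def form (X Y : Matrix (Fin ℓ) (Fin ℓ) ℂ[T;T⁻¹]) : ℂ := (X * Y).trace.coeff 0

lemma form_comm (X Y : Matrix (Fin ℓ) (Fin ℓ) ℂ[T;T⁻¹]) : form X Y = form Y X := by
  rw [form, form, Matrix.trace_mul_comm]

lemma trace_euler (X : Matrix (Fin ℓ) (Fin ℓ) ℂ[T;T⁻¹]) :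
    (euler X).trace = laurentEuler X.trace := by
  simp [euler, Matrix.trace]

lemma form_euler (X Y : Matrix (Fin ℓ) (Fin ℓ) ℂ[T;T⁻¹]) :
    form (euler X) Y = - form X (euler Y) := by
  have h : (euler (X * Y)).trace.coeff 0 = 0 := by
    rw [trace_euler, laurentEuler_coeff]; simp
  rw [euler_mul, Matrix.trace_add] at h
  simp only [AddMonoidAlgebra.coeff_add, Finsupp.add_apply] at h
  exact eq_neg_of_add_eq_zero_left h

lemma form_mul (X Y Z : Matrix (Fin ℓ) (Fin ℓ) ℂ[T;T⁻¹]) : form (X * Y) Z = form X (Y * Z) := by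
  rw [form, form, Matrix.mul_assoc]

lemma form_mul' (X Y Z : Matrix (Fin ℓ) (Fin ℓ) ℂ[T;T⁻¹]) : form (X * Y) Z = form Y (Z * X) := by
  rw [form, form, Matrix.mul_assoc, Matrix.trace_mul_comm, Matrix.mul_assoc]

lemma form_add_left (X Y Z : Matrix (Fin ℓ) (Fin ℓ) ℂ[T;T⁻¹]) :
    form (X + Y) Z = form X Z + form Y Z := by simp [form, add_mul]
lemma form_add_right (X Y Z : Matrix (Fin ℓ) (Fin ℓ) ℂ[T;T⁻¹]) :
    form X (Y + Z) = form X Y + form X Z := by simp [form, mul_add]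
lemma form_sub_left (X Y Z : Matrix (Fin ℓ) (Fin ℓ) ℂ[T;T⁻¹]) :
    form (X - Y) Z = form X Z - form Y Z := by simp [form, sub_mul]
lemma form_sub_right (X Y Z : Matrix (Fin ℓ) (Fin ℓ) ℂ[T;T⁻¹]) :
    form X (Y - Z) = form X Y - form X Z := by simp [form, mul_sub]
lemma form_smul_left (r : ℂ) (X Y : Matrix (Fin ℓ) (Fin ℓ) ℂ[T;T⁻¹]) :
    form (r • X) Y = r * form X Y := by simp [form]
lemma form_smul_right (r : ℂ) (X Y : Matrix (Fin ℓ) (Fin ℓ) ℂ[T;T⁻¹]) :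
    form X (r • Y) = r * form X Y := by simp [form]

/-- `c` is central, `[d, X ⊗ tⁿ] = n X ⊗ tⁿ` and
`[X ⊗ tⁿ, Y ⊗ tᵐ] = (XY - YX) ⊗ t^{n+m} + n δ_{n,-m} tr(XY) c`. -/
instance : Bracket (AffineGl ℓ) (AffineGl ℓ) where
  bracket x y :=
    { mat := (x.mat * y.mat - y.mat * x.mat) + x.d • euler y.mat - y.d • euler x.mat
      c := form (euler x.mat) y.mat
      d := 0 }

@[simp] lemma mat_lie (x y : AffineGl ℓ) : ⁅x, y⁆.mat =
    (x.mat * y.mat - y.mat * x.mat) + x.d • euler y.mat - y.d • euler x.mat := rfl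
@[simp] lemma c_lie (x y : AffineGl ℓ) : ⁅x, y⁆.c = form (euler x.mat) y.mat := rfl
@[simp] lemma d_lie (x y : AffineGl ℓ) : ⁅x, y⁆.d = 0 := rfl

instance : LieRing (AffineGl ℓ) where
  add_lie x y z := by
    ext1
    · simp [add_mul, mul_add, add_smul, smul_add]; abel
    · simp [form_add_left]
    · simp
  lie_add x y z := by
    ext1
    · simp [add_mul, mul_add, add_smul, smul_add]; abel
    · simp [form_add_right]
    · simp
  lie_self x := by
    ext1
    · simp
    · have h := form_euler x.mat x.mat
      rw [form_comm x.mat] at h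
      simpa using self_eq_neg.1 h
    · simp
  leibniz_lie x y z := by
    ext1
    · simp only [mat_lie, d_lie, mat_add, map_add, map_sub, map_smul, euler_mul, mul_add, add_mul,
        mul_sub, sub_mul, smul_mul_assoc, mul_smul_comm, mul_assoc]
      module
    · simp only [mat_lie, c_lie, c_add, map_add, map_sub, map_smul, euler_mul,
        form_add_left, form_sub_left, form_add_right, form_sub_right, form_smul_left,
        form_smul_right]
      have h1 := form_euler (euler x.mat) z.mat
      have h2 := form_euler (euler y.mat) z.mat
      have h3 := form_comm (euler x.mat) (euler y.mat)
      rw [h1, h2, h3, form_mul (euler x.mat), form_mul' x.mat, form_mul (euler y.mat),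
        form_mul' y.mat]
      ring
    · simp

instance : LieAlgebra ℂ (AffineGl ℓ) where
  lie_smul r x y := by
    ext1
    · simp [smul_sub, smul_smul, mul_comm]
    · simp [form_smul_right]
    · simp

end AffineGl

/-- The affine Lie algebra `(sl_ℓ ⊗ ℂ[t, t⁻¹]) ⊕ ℂ c ⊕ ℂ d`. -/
def affineSl (ℓ : ℕ) : LieSubalgebra ℂ (AffineGl ℓ) where
  carrier := {x | x.mat.trace = 0}
  zero_mem' := by simp
  add_mem' {x y} hx hy := by
    change x.mat.trace = 0 at hx
    change y.mat.trace = 0 at hy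
    change (x.mat + y.mat).trace = 0
    rw [Matrix.trace_add, hx, hy, add_zero]
  smul_mem' r x hx := by
    change x.mat.trace = 0 at hx
    change (r • x.mat).trace = 0
    rw [Matrix.trace_smul, hx, smul_zero]
  lie_mem' {x y} hx hy := by
    change x.mat.trace = 0 at hx
    change y.mat.trace = 0 at hy
    change (AffineGl.mat ⁅x, y⁆).trace = 0
    rw [AffineGl.mat_lie, Matrix.trace_sub, Matrix.trace_add, Matrix.trace_sub,
      Matrix.trace_smul, Matrix.trace_smul, AffineGl.trace_euler, AffineGl.trace_euler, hx, hy,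
      Matrix.trace_mul_comm]
    simp

/-- The derived algebra `(sl_ℓ ⊗ ℂ[t, t⁻¹]) ⊕ ℂ c` of `affineSl ℓ`. -/
def affineSl' (ℓ : ℕ) : LieSubalgebra ℂ (affineSl ℓ) where
  carrier := {x | x.1.d = 0}
  zero_mem' := rfl
  add_mem' {x y} hx hy := by
    change x.1.d = 0 at hx
    change y.1.d = 0 at hy
    change x.1.d + y.1.d = 0
    rw [hx, hy, add_zero]
  smul_mem' r x hx := by
    change x.1.d = 0 at hx
    change r * x.1.d = 0
    rw [hx, mul_zero]
  lie_mem' _ _ := rfl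

/-- The element `X ⊗ tᵐ`. -/
def affineLoop {ℓ : ℕ} (X : LieAlgebra.SpecialLinear.sl (Fin ℓ) ℂ) (m : ℤ) : affineSl' ℓ :=
  ⟨⟨⟨X.1.map fun a => LaurentPolynomial.C a * LaurentPolynomial.T m, 0, 0⟩, by
    have h : X.1.trace = 0 := X.2
    change Matrix.trace _ = 0
    simp only [Matrix.trace, Matrix.diag_apply, Matrix.map_apply] at h ⊢
    rw [← Finset.sum_mul, ← map_sum, h, map_zero, zero_mul]⟩, rfl⟩

/-- The central element `c`. -/
def affineC (ℓ : ℕ) : affineSl' ℓ := ⟨⟨⟨0, 1, 0⟩, Matrix.trace_zero _ _⟩, rfl⟩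

/-- The element `d`. -/
def affineD (ℓ : ℕ) : affineSl ℓ := ⟨⟨0, 0, 1⟩, Matrix.trace_zero _ _⟩

section Chevalley

variable {ℓ : ℕ} [ℓ.AtLeastTwo]

lemma fin_sub_one_ne (i : Fin ℓ) : i - 1 ≠ i := by
  have h2 : 2 ≤ ℓ := Nat.AtLeastTwo.prop
  obtain ⟨n, rfl⟩ := Nat.exists_eq_add_of_le' h2
  intro h
  have h1 : (1 : Fin (n + 2)) = 0 := sub_eq_self.1 h
  exact one_ne_zero h1

/-- The Chevalley generators `E_i`: with rows and columns numbered from `1` to `ℓ`, these are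
`X_{i,i+1} ⊗ 1` for `1 ≤ i ≤ ℓ - 1`, and `X_{ℓ,1} ⊗ t` for `i = 0`. -/
def chevalleyE (i : Fin ℓ) : affineSl' ℓ :=
  affineLoop (LieAlgebra.SpecialLinear.single (i - 1) i (fin_sub_one_ne i) 1) (if i = 0 then 1 else 0)

/-- The Chevalley generators `F_i`: with rows and columns numbered from `1` to `ℓ`, these are
`X_{i+1,i} ⊗ 1` for `1 ≤ i ≤ ℓ - 1`, and `X_{1,ℓ} ⊗ t⁻¹` for `i = 0`. -/
def chevalleyF (i : Fin ℓ) : affineSl' ℓ :=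
  affineLoop (LieAlgebra.SpecialLinear.single i (i - 1) (fin_sub_one_ne i).symm 1)
    (if i = 0 then -1 else 0)

/-- The simple coroots `H_i = [E_i, F_i]`. -/
def chevalleyH (i : Fin ℓ) : affineSl' ℓ := ⁅chevalleyE i, chevalleyF i⁆

/-! ### Irreducible highest weight representations -/

/-- The universal enveloping algebra of `affineSl ℓ`. -/
abbrev UAffine (ℓ : ℕ) : Type := UniversalEnvelopingAlgebra ℂ (affineSl ℓ)

/-- The inclusion of `affineSl ℓ` in its enveloping algebra. -/
def toU (x : affineSl ℓ) : UAffine ℓ := UniversalEnvelopingAlgebra.ι ℂ x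

/-- The left ideal generated by the `E_i`, the `H_i - Λ(H_i)` and `d - Λ(d)`, where the weight `Λ` is
given by the numbers `Λ(H_i) = lam i` and `Λ(d) = lamD`. -/
def vermaIdeal (lam : Fin ℓ → ℂ) (lamD : ℂ) : Submodule (UAffine ℓ) (UAffine ℓ) :=
  Submodule.span (UAffine ℓ)
    ({u | ∃ i : Fin ℓ, u = toU (chevalleyE i : affineSl ℓ)} ∪
      {u | ∃ i : Fin ℓ, u = toU (chevalleyH i : affineSl ℓ) - algebraMap ℂ (UAffine ℓ) (lam i)} ∪
      {toU (affineD ℓ) - algebraMap ℂ (UAffine ℓ) lamD})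

/-- The Verma module of highest weight `Λ`. -/
abbrev Verma (lam : Fin ℓ → ℂ) (lamD : ℂ) : Type := UAffine ℓ ⧸ vermaIdeal lam lamD

/-- The sum of all proper submodules of the Verma module. -/
def vermaMaximal (lam : Fin ℓ → ℂ) (lamD : ℂ) : Submodule (UAffine ℓ) (Verma lam lamD) :=
  sSup {N | N ≠ ⊤}

/-- The irreducible highest weight representation `V_Λ` of `affineSl ℓ`. -/
abbrev HighestWeightModule (lam : Fin ℓ → ℂ) (lamD : ℂ) : Type :=
  Verma lam lamD ⧸ vermaMaximal lam lamD

/-- The fundamental weight `Λ_r`, for a residue `r` mod `ℓ`: `Λ_r(H_i)` is `1` if `i` is in the class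
`r`, and `0` otherwise. -/
def fundamentalWeight (ℓ : ℕ) (r : ZMod ℓ) (i : Fin ℓ) : ℂ := if ((i : ℕ) : ZMod ℓ) = r then 1 else 0

/-- The representation `V_{Λ_r}`, with the normalisation `Λ_r(d) = 0`. -/
abbrev FundamentalModule (ℓ : ℕ) [ℓ.AtLeastTwo] (r : ZMod ℓ) : Type :=
  HighestWeightModule (fundamentalWeight ℓ r) 0

end Chevalley

/-! ### The Lie algebra `a_∞` -/

/-- The vector space `V_{ℤ+1/2}` with basis `e_m`, `m ∈ ℤ + 1/2`. -/
def VHalf : Type := ℤ →₀ ℂ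

instance : AddCommGroup VHalf := inferInstanceAs (AddCommGroup (ℤ →₀ ℂ))

instance : Module ℂ VHalf := inferInstanceAs (Module ℂ (ℤ →₀ ℂ))

/-- The standard basis of `V_{ℤ+1/2}`; the member with index `p` is `e_{p-1/2}`. -/
def VHalf.basis : Module.Basis ℤ ℂ VHalf := .ofRepr (LinearEquiv.refl ℂ (ℤ →₀ ℂ))

/-- The endomorphism `A` is identified with the matrix `(a_{p,q})` such that `A e_q = ∑ a_{p,q} e_p`;
this is its entry in row `p` and column `q`. -/
def matEntry (A : Module.End ℂ VHalf) (p q : ℤ) : ℂ :=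
  VHalf.basis.repr (A (VHalf.basis q)) p

lemma matEntry_mul (A B : Module.End ℂ VHalf) (p q : ℤ) (J : Finset ℤ)
    (hJ : ∀ r, r ∉ J → matEntry A p r * matEntry B r q = 0) :
    matEntry (A * B) p q = ∑ r ∈ J, matEntry A p r * matEntry B r q := by
  have h1 : matEntry (A * B) p q =
      (VHalf.basis.repr (B (VHalf.basis q))).sum fun r b => b * matEntry A p r := by
    have h := VHalf.basis.linearCombination_repr (B (VHalf.basis q))
    rw [matEntry, Module.End.mul_apply]
    nth_rewrite 1 [← h]
    simp [Finsupp.linearCombination_apply, Finsupp.sum, matEntry]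
  rw [h1, Finsupp.sum_of_support_subset _ (Finset.subset_union_left (s₂ := J)) _ (by simp)]
  refine (Finset.sum_congr rfl fun r _ => mul_comm _ _).trans ?_
  exact (Finset.sum_subset Finset.subset_union_right fun r _ hr => hJ r hr).symm

lemma matEntry_mul_bound {A B : Module.End ℂ VHalf} {k l : ℤ}
    (hA : ∀ p q, k < |p - q| → matEntry A p q = 0) (hB : ∀ p q, l < |p - q| → matEntry B p q = 0)
    (p q : ℤ) (h : k + l < |p - q|) : matEntry (A * B) p q = 0 := by
  rw [matEntry_mul A B p q ∅]
  · simp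
  · intro r _
    by_cases h1 : k < |p - r|
    · rw [hA p r h1, zero_mul]
    · rw [hB r q, mul_zero]
      have := abs_sub_le p r q
      omega

/-- `A` has finite bandwidth: for some `k`, `a_{p,q} = 0` whenever `|p - q| > k`. -/
def IsBand (A : Module.End ℂ VHalf) : Prop :=
  ∃ k : ℤ, ∀ p q, k < |p - q| → matEntry A p q = 0

lemma IsBand.exists_bound {A : Module.End ℂ VHalf} (hA : IsBand A) :
    ∃ k : ℤ, 0 ≤ k ∧ ∀ p q, k < |p - q| → matEntry A p q = 0 := by
  obtain ⟨k, hk⟩ := hA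
  exact ⟨max k 0, le_max_right _ _, fun p q h => hk p q (lt_of_le_of_lt (le_max_left _ _) h)⟩

lemma IsBand.mul {A B : Module.End ℂ VHalf} (hA : IsBand A) (hB : IsBand B) :
    IsBand (A * B) := by
  obtain ⟨k, hk⟩ := hA
  obtain ⟨l, hl⟩ := hB
  exact ⟨k + l, matEntry_mul_bound hk hl⟩

lemma IsBand.add {A B : Module.End ℂ VHalf} (hA : IsBand A) (hB : IsBand B) :
    IsBand (A + B) := by
  obtain ⟨k, hk⟩ := hA
  obtain ⟨l, hl⟩ := hB
  refine ⟨max k l, fun p q h => ?_⟩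
  have h1 := hk p q (lt_of_le_of_lt (le_max_left _ _) h)
  have h2 := hl p q (lt_of_le_of_lt (le_max_right _ _) h)
  simp only [matEntry] at h1 h2 ⊢
  simp [h1, h2]

lemma IsBand.smul (r : ℂ) {A : Module.End ℂ VHalf} (hA : IsBand A) : IsBand (r • A) := by
  obtain ⟨k, hk⟩ := hA
  refine ⟨k, fun p q h => ?_⟩
  have h1 := hk p q h
  simp only [matEntry] at h1 ⊢
  simp [h1]

lemma IsBand.sub {A B : Module.End ℂ VHalf} (hA : IsBand A) (hB : IsBand B) :
    IsBand (A - B) := by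
  rw [sub_eq_add_neg, ← neg_one_smul ℂ B]
  exact hA.add (hB.smul _)

/-- The Lie algebra of matrices of finite bandwidth, with rows and columns indexed by `ℤ + 1/2` and
with the bracket `[X, Y] = XY - YX`. -/
def bandMatrix : LieSubalgebra ℂ (Module.End ℂ VHalf) where
  carrier := {A | IsBand A}
  zero_mem' := ⟨0, fun _ _ _ => by simp [matEntry]⟩
  add_mem' := IsBand.add
  smul_mem' r _ := IsBand.smul r
  lie_mem' hA hB := (hA.mul hB).sub (hB.mul hA)

/-- The coefficient of `δ_{m,q} δ_{n,p} c` in the bracket of `Ē_{m,n}` and `Ē_{p,q}`: it is `1` for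
`m < 0 < n`, `-1` for `n < 0 < m`, and `0` if `m` and `n` have the same sign. -/
def cocycleSign (p q : ℤ) : ℂ :=
  if p ≤ 0 ∧ 0 < q then 1 else if 0 < p ∧ q ≤ 0 then -1 else 0

lemma cocycleSign_eq (p q : ℤ) :
    cocycleSign p q = (if p ≤ 0 then 1 else 0) - (if q ≤ 0 then 1 else 0) := by
  unfold cocycleSign
  split_ifs <;> first | omega | norm_num

lemma cocycleSign_eq_zero {p q k : ℤ} (h : |p - q| ≤ k) (h' : k < |p| ∨ k < |q|) :
    cocycleSign p q = 0 := by
  rw [cocycleSign, if_neg, if_neg]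
  · rintro ⟨h1, h2⟩
    rw [abs_le] at h
    rw [abs_of_pos h1, abs_of_nonpos h2] at h'
    omega
  · rintro ⟨h1, h2⟩
    rw [abs_le] at h
    rw [abs_of_pos h2, abs_of_nonpos h1] at h'
    omega

/-- The coefficient of `c` in the bracket of `∑ a_{p,q} Ē_{p,q}` and `∑ b_{p,q} Ē_{p,q}`. All but
finitely many terms of the sum vanish for matrices of finite bandwidth. -/
def bandCocycle (A B : Module.End ℂ VHalf) : ℂ :=
  ∑ᶠ pq : ℤ × ℤ, cocycleSign pq.1 pq.2 * (matEntry A pq.1 pq.2 * matEntry B pq.2 pq.1)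

lemma bandCocycle_eq_sum {A : Module.End ℂ VHalf} {k : ℤ}
    (hA : ∀ p q, k < |p - q| → matEntry A p q = 0) (B : Module.End ℂ VHalf) {n : ℤ}
    (hn : k ≤ n) :
    bandCocycle A B = ∑ p ∈ Finset.Icc (-n) n, ∑ q ∈ Finset.Icc (-n) n,
      cocycleSign p q * (matEntry A p q * matEntry B q p) := by
  rw [bandCocycle, finsum_eq_sum_of_support_subset (s := Finset.Icc (-n) n ×ˢ Finset.Icc (-n) n),
    Finset.sum_product]
  rintro ⟨p, q⟩ h
  simp only [Function.mem_support] at h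
  have h1 : |p - q| ≤ k := by
    by_contra h1
    exact h (by rw [hA p q (not_le.1 h1)]; ring)
  have h2 := mt (cocycleSign_eq_zero h1) (left_ne_zero_of_mul h)
  simp only [not_or, not_lt] at h2
  simp only [Finset.coe_product, Finset.coe_Icc, Set.mem_prod, Set.mem_Icc]
  rw [← abs_le, ← abs_le]
  omega

lemma bandCocycle_mul_eq_sum {A B : Module.End ℂ VHalf} {k : ℤ} (hk : 0 ≤ k)
    (hA : ∀ p q, k < |p - q| → matEntry A p q = 0)
    (hB : ∀ p q, k < |p - q| → matEntry B p q = 0) (C : Module.End ℂ VHalf) :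
    bandCocycle (A * B) C = ∑ p ∈ Finset.Icc (-(3 * k)) (3 * k),
      ∑ r ∈ Finset.Icc (-(3 * k)) (3 * k), ∑ q ∈ Finset.Icc (-(3 * k)) (3 * k),
        cocycleSign p q * (matEntry A p r * matEntry B r q * matEntry C q p) := by
  rw [bandCocycle_eq_sum (matEntry_mul_bound hA hB) C (n := 3 * k) (by omega)]
  refine Finset.sum_congr rfl fun p _ => ?_
  rw [Finset.sum_comm]
  refine Finset.sum_congr rfl fun q _ => ?_
  rw [← Finset.mul_sum, ← Finset.sum_mul]
  by_cases h : cocycleSign p q = 0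
  · simp [h]
  by_cases h' : k + k < |p - q|
  · have h0 : ∀ r, matEntry A p r * matEntry B r q = 0 := by
      intro r
      by_cases h1 : k < |p - r|
      · rw [hA p r h1, zero_mul]
      · rw [hB r q, mul_zero]
        have := abs_sub_le p r q
        omega
    rw [matEntry_mul_bound hA hB p q h']
    simp [h0]
  have h2 := mt (cocycleSign_eq_zero (not_lt.1 h')) h
  simp only [not_or, not_lt] at h2
  rw [matEntry_mul A B p q (Finset.Icc (-(3 * k)) (3 * k))]
  intro r hr
  rw [hA p r, zero_mul]
  rw [Finset.mem_Icc, ← abs_le] at hr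
  have := abs_sub_abs_le_abs_sub r p
  rw [abs_sub_comm] at this
  omega

lemma bandCocycle_cyclic {A B C : Module.End ℂ VHalf} (hA : IsBand A) (hB : IsBand B)
    (hC : IsBand C) :
    bandCocycle (A * B) C + bandCocycle (B * C) A + bandCocycle (C * A) B = 0 := by
  obtain ⟨k, hk0, hk⟩ := hA.exists_bound
  obtain ⟨l, hl0, hl⟩ := hB.exists_bound
  obtain ⟨m, hm0, hm⟩ := hC.exists_bound
  have hk' : ∀ p q, k + l + m < |p - q| → matEntry A p q = 0 :=
    fun p q h => hk p q (by omega)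
  have hl' : ∀ p q, k + l + m < |p - q| → matEntry B p q = 0 :=
    fun p q h => hl p q (by omega)
  have hm' : ∀ p q, k + l + m < |p - q| → matEntry C p q = 0 :=
    fun p q h => hm p q (by omega)
  have h0 : 0 ≤ k + l + m := by omega
  rw [bandCocycle_mul_eq_sum h0 hk' hl', bandCocycle_mul_eq_sum h0 hl' hm',
    bandCocycle_mul_eq_sum h0 hm' hk']
  generalize Finset.Icc (-(3 * (k + l + m))) (3 * (k + l + m)) = J
  have h1 : ∑ p ∈ J, ∑ r ∈ J, ∑ q ∈ J,
        cocycleSign p q * (matEntry B p r * matEntry C r q * matEntry A q p) =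
      ∑ p ∈ J, ∑ r ∈ J, ∑ q ∈ J,
        cocycleSign r p * (matEntry B r q * matEntry C q p * matEntry A p r) := by
    rw [Finset.sum_congr rfl fun p _ => Finset.sum_comm, Finset.sum_comm]
  have h2 : ∑ p ∈ J, ∑ r ∈ J, ∑ q ∈ J,
        cocycleSign p q * (matEntry C p r * matEntry A r q * matEntry B q p) =
      ∑ p ∈ J, ∑ r ∈ J, ∑ q ∈ J,
        cocycleSign q r * (matEntry C q p * matEntry A p r * matEntry B r q) := by
    rw [Finset.sum_comm]
    exact Finset.sum_congr rfl fun p _ => Finset.sum_comm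
  rw [h1, h2]
  simp only [← Finset.sum_add_distrib]
  refine Finset.sum_eq_zero fun p _ => Finset.sum_eq_zero fun r _ => Finset.sum_eq_zero fun q _ => ?_
  simp only [cocycleSign_eq]
  ring

lemma bandCocycle_add_right {A : Module.End ℂ VHalf} (hA : IsBand A)
    (B B' : Module.End ℂ VHalf) :
    bandCocycle A (B + B') = bandCocycle A B + bandCocycle A B' := by
  obtain ⟨k, hk0, hk⟩ := hA.exists_bound
  rw [bandCocycle_eq_sum hk _ le_rfl, bandCocycle_eq_sum hk _ le_rfl,
    bandCocycle_eq_sum hk _ le_rfl]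
  simp only [← Finset.sum_add_distrib]
  refine Finset.sum_congr rfl fun p _ => Finset.sum_congr rfl fun q _ => ?_
  simp only [matEntry, LinearMap.add_apply, map_add, Finsupp.add_apply]
  ring

lemma bandCocycle_smul_right (r : ℂ) {A : Module.End ℂ VHalf} (hA : IsBand A)
    (B : Module.End ℂ VHalf) : bandCocycle A (r • B) = r * bandCocycle A B := by
  obtain ⟨k, hk0, hk⟩ := hA.exists_bound
  rw [bandCocycle_eq_sum hk _ le_rfl, bandCocycle_eq_sum hk _ le_rfl]
  simp only [Finset.mul_sum]
  refine Finset.sum_congr rfl fun p _ => Finset.sum_congr rfl fun q _ => ?_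
  simp only [matEntry, LinearMap.smul_apply, map_smul, Finsupp.smul_apply, smul_eq_mul]
  ring

lemma bandCocycle_sub_right {A : Module.End ℂ VHalf} (hA : IsBand A)
    (B B' : Module.End ℂ VHalf) :
    bandCocycle A (B - B') = bandCocycle A B - bandCocycle A B' := by
  rw [sub_eq_add_neg, ← neg_one_smul ℂ B', bandCocycle_add_right hA, bandCocycle_smul_right _ hA]
  ring

lemma bandCocycle_comm {A B : Module.End ℂ VHalf} (hA : IsBand A) (hB : IsBand B) :
    bandCocycle A B = - bandCocycle B A := by
  obtain ⟨k, hk0, hk⟩ := hA.exists_bound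
  obtain ⟨l, hl0, hl⟩ := hB.exists_bound
  rw [bandCocycle_eq_sum hk B (n := k + l) (by omega),
    bandCocycle_eq_sum hl A (n := k + l) (by omega), Finset.sum_comm, ← Finset.sum_neg_distrib]
  refine Finset.sum_congr rfl fun p _ => ?_
  rw [← Finset.sum_neg_distrib]
  refine Finset.sum_congr rfl fun q _ => ?_
  simp only [cocycleSign_eq]
  ring

/-- The Lie algebra `a_∞`, a central extension of the Lie algebra of matrices of finite bandwidth by
`ℂ c`. The pair `(a, z)` is the element `∑ a_{p,q} Ē_{p,q} + z c`. -/
@[ext] structure AInfty where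
  mat : bandMatrix
  c : ℂ

namespace AInfty

def equivProd : AInfty ≃ bandMatrix × ℂ where
  toFun x := (x.mat, x.c)
  invFun x := ⟨x.1, x.2⟩

instance : AddCommGroup AInfty := equivProd.addCommGroup

instance : Module ℂ AInfty := equivProd.module ℂ

@[simp] lemma mat_zero : (0 : AInfty).mat = 0 := rfl
@[simp] lemma c_zero : (0 : AInfty).c = 0 := rfl
@[simp] lemma mat_add (x y : AInfty) : (x + y).mat = x.mat + y.mat := rfl
@[simp] lemma c_add (x y : AInfty) : (x + y).c = x.c + y.c := rfl
@[simp] lemma mat_smul (r : ℂ) (x : AInfty) : (r • x).mat = r • x.mat := rfl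
@[simp] lemma c_smul (r : ℂ) (x : AInfty) : (r • x).c = r * x.c := rfl

instance : Bracket AInfty AInfty where
  bracket x y := ⟨⁅x.mat, y.mat⁆, bandCocycle x.mat y.mat⟩

@[simp] lemma mat_lie (x y : AInfty) : ⁅x, y⁆.mat = ⁅x.mat, y.mat⁆ := rfl
@[simp] lemma c_lie (x y : AInfty) : ⁅x, y⁆.c = bandCocycle x.mat y.mat := rfl

instance : LieRing AInfty where
  add_lie x y z := by
    ext1
    · simp
    · change bandCocycle ((x.mat : Module.End ℂ VHalf) + y.mat) z.mat =
        bandCocycle x.mat z.mat + bandCocycle y.mat z.mat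
      rw [bandCocycle_comm (x.mat.2.add y.mat.2) z.mat.2, bandCocycle_add_right z.mat.2,
        bandCocycle_comm x.mat.2 z.mat.2, bandCocycle_comm y.mat.2 z.mat.2]
      ring
  lie_add x y z := by
    ext1
    · simp
    · exact bandCocycle_add_right x.mat.2 _ _
  lie_self x := by
    ext1
    · simp
    · exact self_eq_neg.1 (bandCocycle_comm x.mat.2 x.mat.2)
  leibniz_lie x y z := by
    ext1
    · simp
    · have hx := x.mat.2
      have hy := y.mat.2
      have hz := z.mat.2
      simp only [mat_lie, c_lie, c_add, LieSubalgebra.coe_bracket,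
        LieRing.of_associative_ring_bracket]
      rw [bandCocycle_comm ((hx.mul hy).sub (hy.mul hx)) hz, bandCocycle_sub_right hx,
        bandCocycle_sub_right hy, bandCocycle_sub_right hz,
        bandCocycle_comm hx (hy.mul hz), bandCocycle_comm hx (hz.mul hy),
        bandCocycle_comm hy (hx.mul hz), bandCocycle_comm hy (hz.mul hx),
        bandCocycle_comm hz (hx.mul hy), bandCocycle_comm hz (hy.mul hx)]
      linear_combination (-1 : ℂ) * bandCocycle_cyclic hx hy hz + bandCocycle_cyclic hx hz hy

instance : LieAlgebra ℂ AInfty where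
  lie_smul r x y := by
    ext1
    · simp
    · exact bandCocycle_smul_right r x.mat.2 y.mat

end AInfty

/-! ### Fock space -/

/-- A Maya diagram, given by the set of positions of its black beads: all but finitely many positive
positions are white and all but finitely many negative positions are black. -/
@[ext] structure MayaDiagram where
  black : Set ℤ
  finite_pos : {p | 0 < p ∧ p ∈ black}.Finite
  finite_neg : {p | p ≤ 0 ∧ p ∉ black}.Finite

namespace MayaDiagram

/-- The charge: the number of black beads in positive positions minus the number of white beads in
negative positions. -/
def charge (v : MayaDiagram) : ℤ :=
  ({p | 0 < p ∧ p ∈ v.black}.ncard : ℤ) - {p | p ≤ 0 ∧ p ∉ v.black}.ncard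

/-- Put a black bead in position `p`. -/
def insertBead (v : MayaDiagram) (p : ℤ) : MayaDiagram where
  black := insert p v.black
  finite_pos := (v.finite_pos.insert p).subset fun q hq => by
    rcases hq.2 with h | h
    · exact Or.inl h
    · exact Or.inr ⟨hq.1, h⟩
  finite_neg := v.finite_neg.subset fun _ hq => ⟨hq.1, fun h => hq.2 (Or.inr h)⟩

/-- Put a white bead in position `p`. -/
def eraseBead (v : MayaDiagram) (p : ℤ) : MayaDiagram where
  black := v.black \ {p}
  finite_pos := v.finite_pos.subset fun _ hq => ⟨hq.1, hq.2.1⟩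
  finite_neg := (v.finite_neg.insert p).subset fun q hq => by
    by_cases h : q = p
    · exact Or.inl h
    · exact Or.inr ⟨hq.1, fun h' => hq.2 ⟨h', h⟩⟩

/-- The sign picked up when `e_p` is moved from the left end of the normally ordered wedge `v` to its
place: `(-1)^k`, where `k` is the number of black beads at positions greater than `p`. -/
def sign (v : MayaDiagram) (p : ℤ) : ℂ := (-1) ^ {q | p < q ∧ q ∈ v.black}.ncard

end MayaDiagram

/-- Fermionic Fock space: the vector space with basis the set of Maya diagrams, the diagram `v` being
identified with the normally ordered wedge of the `e_p` over the positions `p` of its black beads. -/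
def Fock : Type := MayaDiagram →₀ ℂ

instance : AddCommGroup Fock := inferInstanceAs (AddCommGroup (MayaDiagram →₀ ℂ))

instance : Module ℂ Fock := inferInstanceAs (Module ℂ (MayaDiagram →₀ ℂ))

/-- The standard basis of Fock space. -/
def Fock.basis : Module.Basis MayaDiagram ℂ Fock := .ofRepr (LinearEquiv.refl ℂ (MayaDiagram →₀ ℂ))

/-- The charge `h` part of Fock space. -/
def fockCharge (h : ℤ) : Submodule ℂ Fock := Submodule.span ℂ (Fock.basis '' {v | v.charge = h})

open Classical in
/-- The operator `ψ_p`, which sends a wedge `v` to `e_p ∧ v`. -/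
def psi (p : ℤ) : Module.End ℂ Fock :=
  Fock.basis.constr ℂ fun v => if p ∈ v.black then 0 else v.sign p • Fock.basis (v.insertBead p)

open Classical in
/-- The operator `ψ*_p`, which sends `e_p ∧ v` to `v`, and wedges without the factor `e_p` to `0`. -/
def psiStar (p : ℤ) : Module.End ℂ Fock :=
  Fock.basis.constr ℂ fun v => if p ∈ v.black then v.sign p • Fock.basis (v.eraseBead p) else 0

/-- The operator by which `Ē_{p,q}` acts on Fock space: `ψ_p ψ*_q` if `p ≠ q` or `p > 0`, and
`- ψ*_p ψ_p` if `p = q < 0`. -/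
def normalOrdered (p q : ℤ) : Module.End ℂ Fock :=
  if p ≠ q ∨ 0 < p then psi p * psiStar q else -(psiStar q * psi p)

/-- The operator by which `∑ a_{p,q} Ē_{p,q} + z c` acts on Fock space: `c` acts as `1`, and
`∑ a_{p,q} Ē_{p,q}` sends a Maya diagram `v` to `∑ a_{p,q} Ē_{p,q} v`, a sum in which all but finitely
many terms vanish. -/
def fockOp (a : AInfty) : Module.End ℂ Fock :=
  Fock.basis.constr ℂ fun v => a.c • Fock.basis v +
    ∑ᶠ pq : ℤ × ℤ, matEntry a.mat pq.1 pq.2 • normalOrdered pq.1 pq.2 (Fock.basis v)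

/-- The entry in row `p` and column `q` of the matrix
`∑_{k ∈ ℤ} E_{i - 1/2 + kℓ, j - 1/2 + kℓ + mℓ}`, where `1 ≤ i, j ≤ ℓ` are the row and the column given
by `i j : Fin ℓ`. -/
def loopEntry {ℓ : ℕ} (i j : Fin ℓ) (m p q : ℤ) : ℂ :=
  ∑ᶠ k : ℤ, if p = (i : ℤ) + 1 + k * ℓ ∧ q = (j : ℤ) + 1 + k * ℓ + m * ℓ then 1 else 0

/-! ### Subrepresentations -/

section Subrep

variable {L V : Type*} [LieRing L] [LieAlgebra ℂ L] [AddCommGroup V] [Module ℂ V]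

/-- `N` is preserved by the action `π` of the Lie algebra `L` on `V`. -/
def IsSubrep (π : L →ₗ⁅ℂ⁆ Module.End ℂ V) (N : Submodule ℂ V) : Prop :=
  ∀ x : L, ∀ v ∈ N, π x v ∈ N

/-- `N` is an irreducible subrepresentation of `V`. -/
def IsIrreducibleSubrep (π : L →ₗ⁅ℂ⁆ Module.End ℂ V) (N : Submodule ℂ V) : Prop :=
  IsSubrep π N ∧ N ≠ ⊥ ∧ ∀ N' : Submodule ℂ V, IsSubrep π N' → N' ≤ N → N' = ⊥ ∨ N' = N

end Subrep

end

/-!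
The homomorphism to `a_∞` comes from the action of the affine Lie algebra on `ℂ^ℓ ⊗ ℂ[t, t⁻¹]`. The
vectors `e_i ⊗ t⁻ᵏ`, numbered by the positions `i + 1 + k ℓ`, identify this space with `V_{ℤ+1/2}`
(`loopBasis`), and the matrices of the elements of the affine Lie algebra have finite bandwidth. The
cocycle of `a_∞` restricts to that of the affine Lie algebra because the number of `k` with
`k < 0 ≤ k + m`, minus the number of `k` with `k + m < 0 ≤ k`, is `m` (`bandCocycle_loopEnd`).

That `a_∞` acts on Fock space (`fockOp_lie`) is seen as follows. The operator of `a` satisfies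
`[a, ψ_s] = ∑ a_{p,s} ψ_p` and `[a, ψ*_s] = -∑ a_{s,q} ψ*_q`. Hence
`X = [fockOp a, fockOp b] - fockOp [a, b]` commutes with all `ψ_s` and `ψ*_s`, and is determined by its
value on the vacuum. It also commutes with all `:ψ_p ψ*_p:`, so it sends the vacuum to a multiple of
itself, and the coefficient vanishes as both sides have the same vacuum expectation value, which is
the cocycle (`vacCoeff_commutator`). Faithfulness can be read off from `[a, ψ_s]`.

The decomposition of Fock space rests on the Hermitian form for which the Maya diagrams are
orthonormal. It is positive definite, and `E_i` is adjoint to `F_i` (`fockInner_chevalleyF`). A vector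
is called singular if all `E_i` kill it.
* The energy is bounded below and the `E_i` lower it, so every non-zero subrepresentation contains a
  non-zero singular vector (`exists_singular`).
* A singular vector `w` is orthogonal to every `F_i u`. It follows that the singular vectors in the
  span of the `F_{i₁} F_{i₂} ⋯ w` are the multiples of `w`, so that for a homogeneous singular `w` this
  span is an irreducible subrepresentation (`isIrreducibleSubrep_wordSpan`).
* The orthogonal complement, in a finite-dimensional weight space, of the sum of all irreducible
  subrepresentations consists of singular vectors, by induction on the energy. Hence it is zero
  (`fockWeight_le_sSup`).
* For a homogeneous singular vector `w` the numbers `⟨w, H_i w⟩ = ‖F_i w‖²` are not negative. As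
  `c = ∑ H_i` acts by `1`, exactly one `H_i` acts on `w` by `1` and all others act by `0`; which one it
  is depends only on the charge (`isHighestWeight_of_singular`). So the subrepresentation generated by
  `w` is the fundamental representation (`exists_embedding_of_homogeneous`).

An irreducible subrepresentation for the derived algebra need not be stable under `d`, and its singular
vector need not be homogeneous. But its components are singular, and the corresponding embeddings of
the fundamental representation can be added up (`exists_hom_of_singular`).
-/

noncomputable section

open MayaDiagram Filter

/-! ### Maya diagrams, fermions and the canonical anticommutation relations -/

namespace MayaDiagram

lemma finite_above (v : MayaDiagram) (p : ℤ) : {q | p < q ∧ q ∈ v.black}.Finite := by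
  refine (v.finite_pos.union (Set.finite_Ioc p 0)).subset fun q hq => ?_
  rcases lt_or_ge 0 q with h | h
  · exact Or.inl ⟨h, hq.2⟩
  · exact Or.inr ⟨hq.1, h⟩

lemma sign_mul_self (v : MayaDiagram) (p : ℤ) : v.sign p * v.sign p = 1 := by
  rw [sign, ← mul_pow]; simp

lemma sign_ne_zero (v : MayaDiagram) (p : ℤ) : v.sign p ≠ 0 :=
  left_ne_zero_of_mul (b := v.sign p) (by rw [sign_mul_self]; exact one_ne_zero)

lemma conj_sign (v : MayaDiagram) (p : ℤ) : (starRingEnd ℂ) (v.sign p) = v.sign p := by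
  simp [sign]

@[simp] lemma mem_insertBead {v : MayaDiagram} {p q : ℤ} :
    q ∈ (v.insertBead p).black ↔ q = p ∨ q ∈ v.black := Iff.rfl

@[simp] lemma mem_eraseBead {v : MayaDiagram} {p q : ℤ} :
    q ∈ (v.eraseBead p).black ↔ q ∈ v.black ∧ q ≠ p := Iff.rfl

lemma eraseBead_insertBead {v : MayaDiagram} {p : ℤ} (h : p ∉ v.black) :
    (v.insertBead p).eraseBead p = v := by
  ext q; simp only [mem_eraseBead, mem_insertBead]; grind

lemma insertBead_eraseBead {v : MayaDiagram} {p : ℤ} (h : p ∈ v.black) :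
    (v.eraseBead p).insertBead p = v := by
  ext q; simp only [mem_eraseBead, mem_insertBead]; grind

lemma insertBead_comm (v : MayaDiagram) (p q : ℤ) :
    (v.insertBead p).insertBead q = (v.insertBead q).insertBead p := by
  ext r; simp only [mem_insertBead]; grind

lemma eraseBead_comm (v : MayaDiagram) (p q : ℤ) :
    (v.eraseBead p).eraseBead q = (v.eraseBead q).eraseBead p := by
  ext r; simp only [mem_eraseBead]; grind

lemma insertBead_eraseBead_comm (v : MayaDiagram) {p q : ℤ} (h : p ≠ q) :
    (v.insertBead p).eraseBead q = (v.eraseBead q).insertBead p := by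
  ext r; simp only [mem_eraseBead, mem_insertBead]; grind

lemma sign_insertBead {v : MayaDiagram} {p : ℤ} (h : p ∉ v.black) (q : ℤ) :
    (v.insertBead p).sign q = if q < p then -v.sign q else v.sign q := by
  split_ifs with hq
  · have : {r | q < r ∧ r ∈ (v.insertBead p).black} = insert p {r | q < r ∧ r ∈ v.black} := by
      ext r; simp only [mem_insertBead, Set.mem_ofPred_eq, Set.mem_insert_iff]; grind
    rw [sign, this, Set.ncard_insert_of_notMem (fun hp => h hp.2) (v.finite_above q), pow_succ,
      sign, mul_neg_one]
  · have : {r | q < r ∧ r ∈ (v.insertBead p).black} = {r | q < r ∧ r ∈ v.black} := by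
      ext r; simp only [mem_insertBead, Set.mem_ofPred_eq]; grind
    rw [sign, this, sign]

lemma sign_eraseBead {v : MayaDiagram} {p : ℤ} (h : p ∈ v.black) (q : ℤ) :
    (v.eraseBead p).sign q = if q < p then -v.sign q else v.sign q := by
  have := sign_insertBead (v := v.eraseBead p) (p := p) (fun hp => hp.2 rfl) q
  rw [insertBead_eraseBead h] at this
  split_ifs at this ⊢ <;> rw [this]
  rw [neg_neg]

lemma sign_insertBead_self {v : MayaDiagram} {p : ℤ} (h : p ∉ v.black) :
    (v.insertBead p).sign p = v.sign p := by simp [sign_insertBead h]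

lemma sign_eraseBead_self {v : MayaDiagram} {p : ℤ} (h : p ∈ v.black) :
    (v.eraseBead p).sign p = v.sign p := by simp [sign_eraseBead h]

end MayaDiagram

open MayaDiagram

section Fermions

lemma psi_basis_of_mem {v : MayaDiagram} {p : ℤ} (h : p ∈ v.black) :
    psi p (Fock.basis v) = 0 := by
  rw [psi, Module.Basis.constr_basis, if_pos h]

lemma psi_basis_of_notMem {v : MayaDiagram} {p : ℤ} (h : p ∉ v.black) :
    psi p (Fock.basis v) = v.sign p • Fock.basis (v.insertBead p) := by
  rw [psi, Module.Basis.constr_basis, if_neg h]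

lemma psiStar_basis_of_mem {v : MayaDiagram} {p : ℤ} (h : p ∈ v.black) :
    psiStar p (Fock.basis v) = v.sign p • Fock.basis (v.eraseBead p) := by
  rw [psiStar, Module.Basis.constr_basis, if_pos h]

lemma psiStar_basis_of_notMem {v : MayaDiagram} {p : ℤ} (h : p ∉ v.black) :
    psiStar p (Fock.basis v) = 0 := by
  rw [psiStar, Module.Basis.constr_basis, if_neg h]

lemma psi_anticomm (p q : ℤ) : psi p * psi q = -(psi q * psi p) := by
  refine Fock.basis.ext fun v => ?_
  simp only [Module.End.mul_apply, LinearMap.neg_apply]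
  by_cases hp : p ∈ v.black
  · rw [psi_basis_of_mem hp, map_zero, neg_zero]
    by_cases hq : q ∈ v.black
    · rw [psi_basis_of_mem hq, map_zero]
    · rw [psi_basis_of_notMem hq, map_smul, psi_basis_of_mem (Or.inr hp), smul_zero]
  · rw [psi_basis_of_notMem hp, map_smul]
    by_cases hq : q ∈ v.black
    · rw [psi_basis_of_mem hq, map_zero, psi_basis_of_mem (Or.inr hq), smul_zero, neg_zero]
    · rw [psi_basis_of_notMem hq, map_smul]
      rcases eq_or_ne p q with rfl | hpq
      · rw [psi_basis_of_mem (Or.inl rfl), smul_zero, neg_zero]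
      · rw [psi_basis_of_notMem (v := v.insertBead q) (fun h => h.elim hpq hp),
          psi_basis_of_notMem (v := v.insertBead p) (fun h => h.elim hpq.symm hq),
          insertBead_comm, smul_smul, smul_smul, sign_insertBead hp, sign_insertBead hq, ← neg_smul]
        congr 1
        rcases lt_or_gt_of_ne hpq with h | h
        · rw [if_pos h, if_neg h.le.not_gt]; ring
        · rw [if_neg h.le.not_gt, if_pos h]; ring

lemma psiStar_anticomm (p q : ℤ) : psiStar p * psiStar q = -(psiStar q * psiStar p) := by
  refine Fock.basis.ext fun v => ?_
  simp only [Module.End.mul_apply, LinearMap.neg_apply]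
  by_cases hp : p ∈ v.black
  · rw [psiStar_basis_of_mem hp, map_smul]
    by_cases hq : q ∈ v.black
    · rw [psiStar_basis_of_mem hq, map_smul]
      rcases eq_or_ne p q with rfl | hpq
      · rw [psiStar_basis_of_notMem (v := v.eraseBead p) (fun h => h.2 rfl), smul_zero, neg_zero]
      · rw [psiStar_basis_of_mem (v := v.eraseBead q) ⟨hp, hpq⟩,
          psiStar_basis_of_mem (v := v.eraseBead p) ⟨hq, hpq.symm⟩,
          eraseBead_comm, smul_smul, smul_smul, sign_eraseBead hp, sign_eraseBead hq, ← neg_smul]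
        congr 1
        rcases lt_or_gt_of_ne hpq with h | h
        · rw [if_pos h, if_neg h.le.not_gt]; ring
        · rw [if_neg h.le.not_gt, if_pos h]; ring
    · rw [psiStar_basis_of_notMem hq, map_zero,
        psiStar_basis_of_notMem (v := v.eraseBead p) (fun h => hq h.1), smul_zero, neg_zero]
  · rw [psiStar_basis_of_notMem hp, map_zero, neg_zero]
    by_cases hq : q ∈ v.black
    · rw [psiStar_basis_of_mem hq, map_smul,
        psiStar_basis_of_notMem (v := v.eraseBead q) (fun h => hp h.1), smul_zero]
    · rw [psiStar_basis_of_notMem hq, map_zero]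

lemma psi_psiStar_anticomm_of_ne {p q : ℤ} (hpq : p ≠ q) :
    psi p * psiStar q = -(psiStar q * psi p) := by
  refine Fock.basis.ext fun v => ?_
  simp only [Module.End.mul_apply, LinearMap.neg_apply]
  by_cases hp : p ∈ v.black
  · rw [psi_basis_of_mem hp, map_zero, neg_zero]
    by_cases hq : q ∈ v.black
    · rw [psiStar_basis_of_mem hq, map_smul, psi_basis_of_mem (v := v.eraseBead q) ⟨hp, hpq⟩,
        smul_zero]
    · rw [psiStar_basis_of_notMem hq, map_zero]
  · rw [psi_basis_of_notMem hp, map_smul]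
    by_cases hq : q ∈ v.black
    · rw [psiStar_basis_of_mem hq, map_smul,
        psi_basis_of_notMem (v := v.eraseBead q) (fun h => hp h.1),
        psiStar_basis_of_mem (v := v.insertBead p) (Or.inr hq), insertBead_eraseBead_comm v hpq,
        smul_smul, smul_smul, sign_insertBead hp, sign_eraseBead hq, ← neg_smul]
      congr 1
      rcases lt_or_gt_of_ne hpq with h | h
      · rw [if_pos h, if_neg h.le.not_gt]; ring
      · rw [if_neg h.le.not_gt, if_pos h]; ring
    · rw [psiStar_basis_of_notMem hq, map_zero,
        psiStar_basis_of_notMem (v := v.insertBead p) (fun h => h.elim hpq.symm hq),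
        smul_zero, neg_zero]

lemma psi_psiStar_self_of_mem {v : MayaDiagram} {p : ℤ} (h : p ∈ v.black) :
    psi p (psiStar p (Fock.basis v)) = Fock.basis v := by
  rw [psiStar_basis_of_mem h, map_smul,
    psi_basis_of_notMem (v := v.eraseBead p) (fun h => h.2 rfl), insertBead_eraseBead h, smul_smul,
    sign_eraseBead_self h, sign_mul_self, one_smul]

lemma psiStar_psi_self_of_notMem {v : MayaDiagram} {p : ℤ} (h : p ∉ v.black) :
    psiStar p (psi p (Fock.basis v)) = Fock.basis v := by
  rw [psi_basis_of_notMem h, map_smul,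
    psiStar_basis_of_mem (v := v.insertBead p) (Or.inl rfl), eraseBead_insertBead h, smul_smul,
    sign_insertBead_self h, sign_mul_self, one_smul]

/-- The canonical anticommutation relation `ψ_p ψ*_q + ψ*_q ψ_p = δ_{p,q}`. -/
lemma psi_psiStar_anticomm (p q : ℤ) :
    psi p * psiStar q = (if p = q then 1 else 0) - psiStar q * psi p := by
  split_ifs with h
  · subst h
    refine Fock.basis.ext fun v => ?_
    simp only [Module.End.mul_apply, LinearMap.sub_apply, Module.End.one_apply]
    by_cases hp : p ∈ v.black
    · rw [psi_psiStar_self_of_mem hp, psi_basis_of_mem hp, map_zero, sub_zero]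
    · rw [psiStar_psi_self_of_notMem hp, psiStar_basis_of_notMem hp, map_zero, sub_self]
  · rw [psi_psiStar_anticomm_of_ne h, zero_sub]

/-- Normal ordering subtracts the vacuum expectation value. -/
lemma normalOrdered_eq (p q : ℤ) :
    normalOrdered p q = psi p * psiStar q - (if p = q ∧ p ≤ 0 then 1 else 0) := by
  rw [normalOrdered]
  split_ifs with h1 h2 h2
  · omega
  · rw [sub_zero]
  · obtain ⟨rfl, -⟩ := h2
    rw [psi_psiStar_anticomm, if_pos rfl]; abel
  · omega

/-- `[:ψ_p ψ*_q:, ψ_s] = δ_{q,s} ψ_p`. -/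
lemma normalOrdered_lie_psi (p q s : ℤ) :
    normalOrdered p q * psi s - psi s * normalOrdered p q = if q = s then psi p else 0 := by
  have h1 : psi s * psi p = -(psi p * psi s) := psi_anticomm s p
  have h2 := psi_psiStar_anticomm s q
  have h3 : psiStar q * psi s = (if s = q then 1 else 0) - psi s * psiStar q := by rw [h2]; abel
  rw [normalOrdered_eq, sub_mul, mul_sub, mul_assoc, h3, ← mul_assoc (psi s), h1, mul_sub]
  split_ifs <;> first | omega | (noncomm_ring)

/-- `[:ψ_p ψ*_q:, ψ*_s] = -δ_{p,s} ψ*_q`. -/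
lemma normalOrdered_lie_psiStar (p q s : ℤ) :
    normalOrdered p q * psiStar s - psiStar s * normalOrdered p q =
      if p = s then -psiStar q else 0 := by
  have h1 : psiStar q * psiStar s = -(psiStar s * psiStar q) := psiStar_anticomm q s
  have h2 := psi_psiStar_anticomm p s
  have h3 : psiStar s * psi p = (if p = s then 1 else 0) - psi p * psiStar s := by rw [h2]; abel
  rw [normalOrdered_eq, sub_mul, mul_sub, mul_assoc, h1, ← mul_assoc (psiStar s), h3]
  split_ifs <;> first | omega | (noncomm_ring)

end Fermions

/-! ### Additive weights of Maya diagrams -/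

namespace MayaDiagram

variable {A : Type*} [AddCommGroup A]

/-- The normally ordered sum of `g` over the black beads: the sum of `g` over the positive black
positions minus the sum of `g` over the negative white positions. The charge, the energy, and the
eigenvalues of the diagonal elements of `a_∞` all are of this form. -/
def weight (g : ℤ → A) (v : MayaDiagram) : A :=
  ∑ p ∈ v.finite_pos.toFinset, g p - ∑ p ∈ v.finite_neg.toFinset, g p

lemma weight_insertBead (g : ℤ → A) {v : MayaDiagram} {p : ℤ} (h : p ∉ v.black) :
    (v.insertBead p).weight g = v.weight g + g p := by
  unfold weight
  rcases lt_or_ge 0 p with hp | hp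
  · have h1 : (v.insertBead p).finite_pos.toFinset = insert p v.finite_pos.toFinset := by
      ext q; simp; grind
    have h2 : (v.insertBead p).finite_neg.toFinset = v.finite_neg.toFinset := by
      ext q; simp; grind
    rw [h1, h2, Finset.sum_insert (by simp [h])]; abel
  · have h1 : (v.insertBead p).finite_pos.toFinset = v.finite_pos.toFinset := by
      ext q; simp; grind
    have h2 : v.finite_neg.toFinset = insert p (v.insertBead p).finite_neg.toFinset := by
      ext q; simp; grind
    rw [h1, h2, Finset.sum_insert (by simp)]; abel

lemma weight_eraseBead (g : ℤ → A) {v : MayaDiagram} {p : ℤ} (h : p ∈ v.black) :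
    (v.eraseBead p).weight g = v.weight g - g p := by
  have := weight_insertBead g (v := v.eraseBead p) (p := p) (fun h => h.2 rfl)
  rw [insertBead_eraseBead h] at this
  rw [this]; abel

lemma weight_map {B : Type*} [AddCommGroup B] (f : A →+ B) (g : ℤ → A) (v : MayaDiagram) :
    v.weight (fun p => f (g p)) = f (v.weight g) := by
  simp [weight]

lemma charge_eq_weight (v : MayaDiagram) : v.charge = v.weight fun _ => (1 : ℤ) := by
  simp [charge, weight, Set.ncard_eq_toFinset_card _ v.finite_pos,
    Set.ncard_eq_toFinset_card _ v.finite_neg]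

end MayaDiagram

/-- The span of the Maya diagrams in the set `s`. -/
def fockSpan (s : Set MayaDiagram) : Submodule ℂ Fock := Submodule.span ℂ (Fock.basis '' s)

lemma basis_mem_fockSpan {s : Set MayaDiagram} {v : MayaDiagram} (h : v ∈ s) :
    Fock.basis v ∈ fockSpan s := Submodule.subset_span ⟨v, h, rfl⟩

lemma fockSpan_mono {s t : Set MayaDiagram} (h : s ⊆ t) : fockSpan s ≤ fockSpan t :=
  Submodule.span_mono (Set.image_mono h)

/-- To check that `f` maps the span of a set of Maya diagrams to `N`, it suffices to look at the
diagrams. -/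
lemma fockSpan_induction {s : Set MayaDiagram} {N : Submodule ℂ Fock} (f : Module.End ℂ Fock)
    (h : ∀ v ∈ s, f (Fock.basis v) ∈ N) {x : Fock} (hx : x ∈ fockSpan s) : f x ∈ N := by
  have : fockSpan s ≤ N.comap f := by
    refine Submodule.span_le.2 ?_
    rintro _ ⟨v, hv, rfl⟩
    exact h v hv
  exact this hx

lemma psi_psiStar_basis_mem {A : Type*} [AddCommGroup A] (g : ℤ → A) (p q : ℤ)
    (v : MayaDiagram) : psi p (psiStar q (Fock.basis v)) ∈
      fockSpan {v' | v'.weight g = v.weight g + (g p - g q)} := by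
  by_cases hq : q ∈ v.black
  · rw [psiStar_basis_of_mem hq, map_smul]
    by_cases hp : p ∈ (v.eraseBead q).black
    · rw [psi_basis_of_mem hp, smul_zero]; exact zero_mem _
    · rw [psi_basis_of_notMem hp]
      refine Submodule.smul_mem _ _ (Submodule.smul_mem _ _ (basis_mem_fockSpan ?_))
      rw [Set.mem_ofPred_eq, weight_insertBead g hp, weight_eraseBead g hq]; abel
  · rw [psiStar_basis_of_notMem hq, map_zero]; exact zero_mem _

lemma normalOrdered_basis_mem {A : Type*} [AddCommGroup A] (g : ℤ → A) (p q : ℤ)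
    (v : MayaDiagram) : normalOrdered p q (Fock.basis v) ∈
      fockSpan {v' | v'.weight g = v.weight g + (g p - g q)} := by
  rw [normalOrdered_eq, LinearMap.sub_apply]
  refine sub_mem (psi_psiStar_basis_mem g p q v) ?_
  split_ifs with h
  · exact basis_mem_fockSpan (by simp [h.1])
  · exact zero_mem _

open Classical in
lemma normalOrdered_self_basis (p : ℤ) (v : MayaDiagram) : normalOrdered p p (Fock.basis v) =
    ((if 0 < p ∧ p ∈ v.black then 1 else 0) - (if p ≤ 0 ∧ p ∉ v.black then 1 else 0) : ℂ) •
      Fock.basis v := by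
  rw [normalOrdered_eq]
  simp only [LinearMap.sub_apply, Module.End.mul_apply]
  by_cases hp : p ∈ v.black
  · rw [psi_psiStar_self_of_mem hp]
    rcases lt_or_ge 0 p with h | h
    · simp [hp, h, h.not_ge]
    · simp [hp, h, h.not_gt]
  · rw [psiStar_basis_of_notMem hp]
    rcases lt_or_ge 0 p with h | h
    · simp [hp, h, h.not_ge]
    · simp [hp, h, h.not_gt]

/-! ### The representation of `a_∞` on Fock space -/

lemma exists_normalOrdered_bound (v : MayaDiagram) :
    ∃ n : ℤ, 0 ≤ n ∧ ∀ p q, normalOrdered p q (Fock.basis v) ≠ 0 → -n ≤ p ∧ q ≤ n := by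
  obtain ⟨a, ha⟩ := v.finite_pos.bddAbove
  obtain ⟨b, hb⟩ := v.finite_neg.bddBelow
  refine ⟨max 0 (max a (-b)), le_max_left _ _, fun p q h => ?_⟩
  by_cases hpq : p = q
  · subst hpq
    rw [normalOrdered_self_basis] at h
    rcases lt_or_ge 0 p with hp | hp
    · by_cases hv : p ∈ v.black
      · have := ha ⟨hp, hv⟩; omega
      · simp [hv, hp.not_ge] at h
    · by_cases hv : p ∈ v.black
      · simp [hv, hp.not_gt] at h
      · have := hb ⟨hp, hv⟩; omega
  · rw [normalOrdered_eq, if_neg (fun h => hpq h.1), sub_zero, Module.End.mul_apply] at h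
    have hq : q ∈ v.black := by
      by_contra hq
      rw [psiStar_basis_of_notMem hq, map_zero] at h
      exact h rfl
    have hp : p ∉ v.black := by
      intro hp
      rw [psiStar_basis_of_mem hq, map_smul,
        psi_basis_of_mem (v := v.eraseBead q) ⟨hp, hpq⟩, smul_zero] at h
      exact h rfl
    constructor
    · rcases lt_or_ge 0 p with hp0 | hp0
      · omega
      · have := hb ⟨hp0, hp⟩; omega
    · rcases lt_or_ge 0 q with hq0 | hq0
      · have := ha ⟨hq0, hq⟩; omega
      · omega

/-- The part of `∑ a_{p,q} Ē_{p,q} + z c` with `|p|, |q| ≤ m`, acting on Fock space. -/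
def boxOp (a : AInfty) (m : ℤ) : Module.End ℂ Fock :=
  a.c • 1 + ∑ p ∈ Finset.Icc (-m) m, ∑ q ∈ Finset.Icc (-m) m,
    matEntry a.mat p q • normalOrdered p q

lemma boxOp_apply (a : AInfty) (m : ℤ) (x : Fock) : boxOp a m x = a.c • x +
    ∑ p ∈ Finset.Icc (-m) m, ∑ q ∈ Finset.Icc (-m) m,
      matEntry a.mat p q • normalOrdered p q x := by
  simp [boxOp, LinearMap.sum_apply]

lemma eventually_fockOp_basis (a : AInfty) (v : MayaDiagram) :
    ∀ᶠ m in atTop, fockOp a (Fock.basis v) = boxOp a m (Fock.basis v) := by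
  obtain ⟨n, hn0, hn⟩ := exists_normalOrdered_bound v
  obtain ⟨k, hk0, hk⟩ := a.mat.2.exists_bound
  filter_upwards [eventually_ge_atTop (n + k)] with m hm
  rw [fockOp, Module.Basis.constr_basis, boxOp_apply, finsum_eq_sum_of_support_subset
    (s := Finset.Icc (-m) m ×ˢ Finset.Icc (-m) m), Finset.sum_product]
  rintro ⟨p, q⟩ h
  simp only [Function.mem_support] at h
  have h1 : |p - q| ≤ k := by
    by_contra h1
    exact h (by rw [hk p q (not_le.1 h1), zero_smul])
  have h2 := hn p q (right_ne_zero_of_smul h)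
  rw [abs_le] at h1
  simp only [Finset.coe_product, Finset.coe_Icc, Set.mem_prod, Set.mem_Icc]
  omega

lemma fock_induction {P : Fock → Prop} (h0 : P 0) (hb : ∀ v, P (Fock.basis v))
    (hadd : ∀ x y, P x → P y → P (x + y)) (hsmul : ∀ (r : ℂ) x, P x → P (r • x)) (x : Fock) :
    P x := by
  have hx : x ∈ Submodule.span ℂ (Set.range Fock.basis) := by
    rw [Fock.basis.span_eq]; trivial
  induction hx using Submodule.span_induction with
  | mem x hx => obtain ⟨v, rfl⟩ := hx; exact hb v
  | zero => exact h0
  | add x y _ _ hx hy => exact hadd x y hx hy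
  | smul r x _ hx => exact hsmul r x hx

/-- On a given vector, the infinite sum that defines `fockOp a` may be replaced by any large enough
finite part of it. -/
lemma eventually_fockOp (a : AInfty) (x : Fock) :
    ∀ᶠ m in atTop, fockOp a x = boxOp a m x := by
  induction x using fock_induction with
  | h0 => simp
  | hb v => exact eventually_fockOp_basis a v
  | hadd x y hx hy => filter_upwards [hx, hy] with m h1 h2; rw [map_add, map_add, h1, h2]
  | hsmul r x hx => filter_upwards [hx] with m h1; rw [map_smul, map_smul, h1]

lemma matEntry_add (A B : Module.End ℂ VHalf) (p q : ℤ) :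
    matEntry (A + B) p q = matEntry A p q + matEntry B p q := by simp [matEntry]

lemma matEntry_sub (A B : Module.End ℂ VHalf) (p q : ℤ) :
    matEntry (A - B) p q = matEntry A p q - matEntry B p q := by simp [matEntry]

lemma matEntry_smul (r : ℂ) (A : Module.End ℂ VHalf) (p q : ℤ) :
    matEntry (r • A) p q = r * matEntry A p q := by simp [matEntry]

lemma matEntry_ext {A B : Module.End ℂ VHalf} (h : ∀ p q, matEntry A p q = matEntry B p q) :
    A = B :=
  VHalf.basis.ext fun q => VHalf.basis.repr.injective (Finsupp.ext fun p => h p q)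

lemma AInfty.coe_mat_add (a b : AInfty) : ((a + b).mat : Module.End ℂ VHalf) = a.mat + b.mat := rfl

lemma AInfty.coe_mat_smul (r : ℂ) (a : AInfty) :
    ((r • a).mat : Module.End ℂ VHalf) = r • (a.mat : Module.End ℂ VHalf) := rfl

lemma fockOp_add (a b : AInfty) : fockOp (a + b) = fockOp a + fockOp b := by
  ext x
  obtain ⟨m, h1, h2, h3⟩ :=
    ((eventually_fockOp (a + b) x).and ((eventually_fockOp a x).and (eventually_fockOp b x))).exists
  rw [h1, LinearMap.add_apply, h2, h3]
  simp only [boxOp_apply, AInfty.c_add, AInfty.coe_mat_add, matEntry_add,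
    add_smul, Finset.sum_add_distrib]
  abel

lemma fockOp_smul (r : ℂ) (a : AInfty) : fockOp (r • a) = r • fockOp a := by
  ext x
  obtain ⟨m, h1, h2⟩ := ((eventually_fockOp (r • a) x).and (eventually_fockOp a x)).exists
  rw [h1, LinearMap.smul_apply, h2]
  simp only [boxOp_apply, AInfty.c_smul, AInfty.coe_mat_smul, matEntry_smul,
    mul_smul, smul_add, Finset.smul_sum]

/-- The operator `∑ u_p ψ_p` attached to a vector `u = ∑ u_p e_p`. -/
def psiVec : VHalf →ₗ[ℂ] Module.End ℂ Fock := VHalf.basis.constr ℂ psi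

@[simp] lemma psiVec_basis (p : ℤ) : psiVec (VHalf.basis p) = psi p :=
  VHalf.basis.constr_basis ℂ psi p

lemma eventually_psiVec (u : VHalf) : ∀ᶠ m : ℤ in atTop,
    psiVec u = ∑ p ∈ Finset.Icc (-m) m, VHalf.basis.repr u p • psi p := by
  have hfin := (VHalf.basis.repr u).hasFiniteSupport
  obtain ⟨a, ha⟩ := hfin.bddAbove
  obtain ⟨b, hb⟩ := hfin.bddBelow
  filter_upwards [eventually_ge_atTop (max a (-b))] with m hm
  rw [psiVec, Module.Basis.constr_apply]
  refine Finsupp.sum_of_support_subset _ (fun p hp => ?_) _ (by simp)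
  rw [← Finset.mem_coe, ← Finsupp.fun_support_eq] at hp
  have h1 := ha hp
  have h2 := hb hp
  rw [Finset.mem_Icc]
  omega

/-- `[a, ψ_s] = ∑ a_{p,s} ψ_p`. -/
lemma fockOp_mul_psi (a : AInfty) (s : ℤ) :
    fockOp a * psi s = psi s * fockOp a + psiVec ((a.mat : Module.End ℂ VHalf) (VHalf.basis s)) := by
  ext x
  obtain ⟨m, h1, h2, h3, hs⟩ := ((eventually_fockOp a (psi s x)).and
    ((eventually_fockOp a x).and ((eventually_psiVec
      ((a.mat : Module.End ℂ VHalf) (VHalf.basis s))).and (eventually_ge_atTop |s|)))).exists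
  have hs' : s ∈ Finset.Icc (-m) m := by rw [Finset.mem_Icc, ← abs_le]; exact hs
  have key : ∀ p q, normalOrdered p q (psi s x) = psi s (normalOrdered p q x) +
      (if q = s then psi p x else 0) := by
    intro p q
    have := LinearMap.congr_fun (normalOrdered_lie_psi p q s) x
    simp only [LinearMap.sub_apply, Module.End.mul_apply] at this
    rw [sub_eq_iff_eq_add'.1 this]
    split_ifs <;> rfl
  simp only [Module.End.mul_apply, LinearMap.add_apply, h1, h2, h3, boxOp_apply, map_add, map_smul,
    map_sum, key, smul_add, Finset.sum_add_distrib, LinearMap.sum_apply, LinearMap.smul_apply]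
  rw [add_assoc]
  congr 2
  refine Finset.sum_congr rfl fun p _ => ?_
  simp only [smul_ite, smul_zero]
  rw [Finset.sum_ite_eq' _ _ _, if_pos hs']
  rfl

lemma fockOp_mul_psiVec (a : AInfty) (u : VHalf) :
    fockOp a * psiVec u = psiVec u * fockOp a + psiVec ((a.mat : Module.End ℂ VHalf) u) := by
  have hu : u ∈ Submodule.span ℂ (Set.range VHalf.basis) := by
    rw [VHalf.basis.span_eq]; trivial
  induction hu using Submodule.span_induction with
  | mem x hx => obtain ⟨p, rfl⟩ := hx; rw [psiVec_basis]; exact fockOp_mul_psi a p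
  | zero => simp
  | add x y _ _ hx hy => simp only [map_add, mul_add, add_mul, hx, hy]; abel
  | smul r x _ hx => simp only [map_smul, mul_smul_comm, smul_mul_assoc, hx, smul_add]

/-- `[a, ψ*_s] = -∑ a_{s,q} ψ*_q`. The row `s` of a matrix of bandwidth `k` is supported in
`[s - k, s + k]`. -/
lemma fockOp_mul_psiStar (a : AInfty) {k : ℤ}
    (hk : ∀ p q, k < |p - q| → matEntry a.mat p q = 0) {s m : ℤ} (hm : |s| + k ≤ m) :
    fockOp a * psiStar s = psiStar s * fockOp a -
      ∑ q ∈ Finset.Icc (-m) m, matEntry a.mat s q • psiStar q := by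
  ext x
  obtain ⟨n, h1, h2, hs, hmn⟩ := ((eventually_fockOp a (psiStar s x)).and
    ((eventually_fockOp a x).and ((eventually_ge_atTop |s|).and (eventually_ge_atTop m)))).exists
  have hs' : s ∈ Finset.Icc (-n) n := by rw [Finset.mem_Icc, ← abs_le]; exact hs
  have key : ∀ p q, normalOrdered p q (psiStar s x) = psiStar s (normalOrdered p q x) +
      (if p = s then - psiStar q x else 0) := by
    intro p q
    have := LinearMap.congr_fun (normalOrdered_lie_psiStar p q s) x
    simp only [LinearMap.sub_apply, Module.End.mul_apply] at this
    rw [sub_eq_iff_eq_add'.1 this]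
    split_ifs <;> rfl
  have h3 : ∑ q ∈ Finset.Icc (-m) m, matEntry a.mat s q • psiStar q x =
      ∑ q ∈ Finset.Icc (-n) n, matEntry a.mat s q • psiStar q x := by
    refine Finset.sum_subset (Finset.Icc_subset_Icc (neg_le_neg hmn) hmn) fun q _ hq => ?_
    rw [hk s q, zero_smul]
    rw [Finset.mem_Icc, ← abs_le] at hq
    have := abs_sub_abs_le_abs_sub q s
    rw [abs_sub_comm] at this
    omega
  simp only [Module.End.mul_apply, LinearMap.sub_apply, h1, h2, boxOp_apply, map_add, map_smul,
    map_sum, key, smul_add, Finset.sum_add_distrib, LinearMap.sum_apply, LinearMap.smul_apply, h3]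
  rw [sub_eq_add_neg, add_assoc]
  congr 2
  rw [Finset.sum_eq_single s]
  · simp
  · intro p _ hp; simp [hp]
  · intro h; exact absurd hs' h

/-! ### The vacuum and the commutation relations -/

/-- The vacuum: all negative positions are black and all positive positions are white. -/
def vacuum : MayaDiagram where
  black := {p | p ≤ 0}
  finite_pos := by
    convert Set.finite_empty using 1
    ext p; simp
  finite_neg := by
    convert Set.finite_empty using 1
    ext p; simp

lemma mem_vacuum {p : ℤ} : p ∈ vacuum.black ↔ p ≤ 0 := Iff.rfl

/-- The coefficient of the vacuum in a vector of Fock space. -/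
def vacCoeff : Fock →ₗ[ℂ] ℂ := Fock.basis.coord vacuum

lemma vacCoeff_vacuum : vacCoeff (Fock.basis vacuum) = 1 := by simp [vacCoeff]

lemma vacCoeff_basis_of_ne {v : MayaDiagram} (h : v ≠ vacuum) : vacCoeff (Fock.basis v) = 0 := by
  simp [vacCoeff, h]

lemma normalOrdered_vacuum {p q : ℤ} (h : ¬ (0 < p ∧ q ≤ 0)) :
    normalOrdered p q (Fock.basis vacuum) = 0 := by
  by_cases hpq : p = q
  · subst hpq
    rw [normalOrdered_self_basis]
    simp [mem_vacuum]
    grind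
  · rw [normalOrdered_eq, if_neg (fun h => hpq h.1), sub_zero, Module.End.mul_apply]
    by_cases hq : q ≤ 0
    · rw [psiStar_basis_of_mem (mem_vacuum.2 hq), map_smul,
        psi_basis_of_mem (v := vacuum.eraseBead q)
          ⟨mem_vacuum.2 (not_lt.1 fun hp => h ⟨hp, hq⟩), hpq⟩, smul_zero]
    · rw [psiStar_basis_of_notMem (mt mem_vacuum.1 hq), map_zero]

lemma vacCoeff_psi {p : ℤ} (hp : 0 < p) (x : Fock) : vacCoeff (psi p x) = 0 := by
  have : vacCoeff ∘ₗ psi p = 0 := by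
    refine Fock.basis.ext fun v => ?_
    rw [LinearMap.comp_apply, LinearMap.zero_apply]
    by_cases h : p ∈ v.black
    · rw [psi_basis_of_mem h, map_zero]
    · rw [psi_basis_of_notMem h, map_smul, vacCoeff_basis_of_ne, smul_zero]
      intro h'
      have h2 : p ∈ (v.insertBead p).black := Or.inl rfl
      rw [h', mem_vacuum] at h2
      omega
  exact LinearMap.congr_fun this x

lemma vacCoeff_psiVec_psiStar (u : VHalf) {q : ℤ} (hq : q ≤ 0) :
    vacCoeff (psiVec u (psiStar q (Fock.basis vacuum))) = VHalf.basis.repr u q := by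
  have : vacCoeff ∘ₗ LinearMap.applyₗ (psiStar q (Fock.basis vacuum)) ∘ₗ psiVec =
      VHalf.basis.coord q := by
    refine VHalf.basis.ext fun r => ?_
    simp only [LinearMap.comp_apply, LinearMap.applyₗ_apply_apply, psiVec_basis,
      Module.Basis.coord_apply, Module.Basis.repr_self]
    by_cases h : r = q
    · subst h
      rw [psi_psiStar_self_of_mem (mem_vacuum.2 hq), vacCoeff_vacuum, Finsupp.single_eq_same]
    · rw [psiStar_basis_of_mem (mem_vacuum.2 hq), map_smul, Finsupp.single_eq_of_ne' h]
      by_cases hr : r ∈ (vacuum.eraseBead q).black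
      · rw [psi_basis_of_mem hr, smul_zero, map_zero]
      · rw [psi_basis_of_notMem hr, map_smul, map_smul, vacCoeff_basis_of_ne, smul_zero, smul_zero]
        intro h'
        have h2 : q ∈ vacuum.black := mem_vacuum.2 hq
        rw [← h'] at h2
        exact h2.elim (fun h3 => h h3.symm) (fun h3 => h3.2 rfl)
  exact LinearMap.congr_fun this u

lemma eventually_fockOp_vacuum (a : AInfty) : ∀ᶠ m in atTop, fockOp a (Fock.basis vacuum) =
    a.c • Fock.basis vacuum + ∑ p ∈ Finset.Icc (-m) m, ∑ q ∈ Finset.Icc (-m) m,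
      (if 0 < p ∧ q ≤ 0 then matEntry a.mat p q else 0) •
        psi p (psiStar q (Fock.basis vacuum)) := by
  filter_upwards [eventually_fockOp a (Fock.basis vacuum)] with m hm
  rw [hm, boxOp_apply]
  congr 1
  refine Finset.sum_congr rfl fun p _ => Finset.sum_congr rfl fun q _ => ?_
  split_ifs with h
  · rw [normalOrdered_eq, if_neg (by omega), sub_zero, Module.End.mul_apply]
  · rw [normalOrdered_vacuum h, smul_zero, zero_smul]

lemma vacCoeff_fockOp_vacuum (a : AInfty) : vacCoeff (fockOp a (Fock.basis vacuum)) = a.c := by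
  obtain ⟨m, hm⟩ := (eventually_fockOp_vacuum a).exists
  rw [hm]
  simp only [map_add, map_smul, map_sum, vacCoeff_vacuum, smul_eq_mul, mul_one]
  rw [add_eq_left]
  refine Finset.sum_eq_zero fun p _ => Finset.sum_eq_zero fun q _ => ?_
  split_ifs with h
  · rw [vacCoeff_psi h.1, mul_zero]
  · rw [zero_mul]

lemma vacCoeff_fockOp_psi_psiStar (a : AInfty) {p q : ℤ} (hp : 0 < p) (hq : q ≤ 0) :
    vacCoeff (fockOp a (psi p (psiStar q (Fock.basis vacuum)))) = matEntry a.mat q p := by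
  have := LinearMap.congr_fun (fockOp_mul_psi a p) (psiStar q (Fock.basis vacuum))
  simp only [Module.End.mul_apply, LinearMap.add_apply] at this
  rw [this, map_add, vacCoeff_psi hp, zero_add, vacCoeff_psiVec_psiStar _ hq]
  rfl

lemma eventually_vacCoeff_fockOp_fockOp (a b : AInfty) : ∀ᶠ m in atTop,
    vacCoeff (fockOp a (fockOp b (Fock.basis vacuum))) = b.c * a.c +
      ∑ p ∈ Finset.Icc (-m) m, ∑ q ∈ Finset.Icc (-m) m,
        (if 0 < p ∧ q ≤ 0 then matEntry b.mat p q * matEntry a.mat q p else 0) := by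
  filter_upwards [eventually_fockOp_vacuum b] with m hm
  rw [hm]
  simp only [map_add, map_smul, map_sum, vacCoeff_fockOp_vacuum, smul_eq_mul]
  congr 1
  refine Finset.sum_congr rfl fun p _ => Finset.sum_congr rfl fun q _ => ?_
  split_ifs with h
  · rw [vacCoeff_fockOp_psi_psiStar a h.1 h.2]
  · rw [zero_mul]

/-- The vacuum expectation value of `[a, b]` is the cocycle. -/
lemma vacCoeff_commutator (a b : AInfty) :
    vacCoeff (fockOp a (fockOp b (Fock.basis vacuum))) -
      vacCoeff (fockOp b (fockOp a (Fock.basis vacuum))) = bandCocycle a.mat b.mat := by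
  obtain ⟨k, hk0, hk⟩ := a.mat.2.exists_bound
  obtain ⟨m, h1, h2, h3⟩ := ((eventually_vacCoeff_fockOp_fockOp a b).and
    ((eventually_vacCoeff_fockOp_fockOp b a).and (eventually_ge_atTop k))).exists
  rw [h1, h2, bandCocycle_eq_sum hk _ h3, Finset.sum_comm (s := Finset.Icc (-m) m), mul_comm b.c,
    add_sub_add_left_eq_sub, ← Finset.sum_sub_distrib]
  refine Finset.sum_congr rfl fun p _ => ?_
  rw [← Finset.sum_sub_distrib]
  refine Finset.sum_congr rfl fun q _ => ?_
  rw [cocycleSign]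
  split_ifs <;> first | omega | ring

/-- The vacuum line is cut out by the equations `:ψ_p ψ*_p: x = 0`. -/
lemma eq_vacCoeff_smul {x : Fock} (h : ∀ p, normalOrdered p p x = 0) :
    x = vacCoeff x • Fock.basis vacuum := by
  classical
  refine Fock.basis.repr.injective (Finsupp.ext fun v => ?_)
  by_cases hv : v = vacuum
  · subst hv; simp [vacCoeff]
  · rw [map_smul, Module.Basis.repr_self, Finsupp.smul_apply, Finsupp.single_eq_of_ne hv,
      smul_zero]
    obtain ⟨p, hp⟩ : ∃ p, ¬ (p ∈ v.black ↔ p ≤ 0) := by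
      by_contra! h'
      exact hv (MayaDiagram.ext (Set.ext h'))
    set e : MayaDiagram → ℂ := fun v => (if 0 < p ∧ p ∈ v.black then 1 else 0) -
      (if p ≤ 0 ∧ p ∉ v.black then 1 else 0) with he
    have key : ∀ y : Fock, Fock.basis.repr (normalOrdered p p y) v = e v * Fock.basis.repr y v := by
      intro y
      induction y using fock_induction with
      | h0 => simp
      | hb w =>
        rw [normalOrdered_self_basis, map_smul, Finsupp.smul_apply, Module.Basis.repr_self,
          smul_eq_mul]
        by_cases hw : w = v
        · subst hw; rfl
        · rw [Finsupp.single_eq_of_ne' hw, mul_zero, mul_zero]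
      | hadd x y hx hy => simp only [map_add, Finsupp.add_apply, hx, hy, mul_add]
      | hsmul r x hx => simp only [map_smul, Finsupp.smul_apply, hx, smul_eq_mul]; ring
    have hx := key x
    rw [h p, map_zero, Finsupp.zero_apply] at hx
    refine (mul_eq_zero.1 hx.symm).resolve_left ?_
    rw [he]
    simp only
    split_ifs <;> first | (exfalso; grind) | norm_num

/-- Since the `ψ_p` and `ψ*_p` generate Fock space from the vacuum, an operator that commutes with them
and kills the vacuum is zero. The induction is on the number of beads in which a diagram differs from
the vacuum. -/
lemma eq_zero_of_commute {X : Module.End ℂ Fock} (h1 : ∀ p, X * psi p = psi p * X)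
    (h2 : ∀ p, X * psiStar p = psiStar p * X) (h0 : X (Fock.basis vacuum) = 0) : X = 0 := by
  refine Fock.basis.ext fun v => ?_
  rw [LinearMap.zero_apply]
  obtain ⟨n, hn⟩ : ∃ n, n = v.finite_pos.toFinset.card + v.finite_neg.toFinset.card := ⟨_, rfl⟩
  induction n using Nat.strong_induction_on generalizing v with
  | _ n ih =>
  by_cases hv : v = vacuum
  · rw [hv, h0]
  obtain ⟨p, hp⟩ : ∃ p, ¬ (p ∈ v.black ↔ p ≤ 0) := by
    by_contra! h'
    exact hv (MayaDiagram.ext (Set.ext h'))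
  by_cases hb : p ∈ v.black
  · have hp0 : 0 < p := by grind
    have e1 : (v.eraseBead p).finite_neg.toFinset = v.finite_neg.toFinset := by
      ext q; simp; grind
    have e2 : v.finite_pos.toFinset = insert p (v.eraseBead p).finite_pos.toFinset := by
      ext q; simp; grind
    rw [e2, Finset.card_insert_of_notMem (by simp), ← e1] at hn
    have := ih _ (by omega) (v.eraseBead p) rfl
    rw [← psi_psiStar_self_of_mem hb, psiStar_basis_of_mem hb, map_smul, map_smul]
    have h3 := LinearMap.congr_fun (h1 p) (Fock.basis (v.eraseBead p))
    simp only [Module.End.mul_apply] at h3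
    rw [h3, this, map_zero, smul_zero]
  · have hp0 : p ≤ 0 := by grind
    have e1 : (v.insertBead p).finite_pos.toFinset = v.finite_pos.toFinset := by
      ext q; simp; grind
    have e2 : v.finite_neg.toFinset = insert p (v.insertBead p).finite_neg.toFinset := by
      ext q; simp; grind
    rw [e2, Finset.card_insert_of_notMem (by simp), ← e1] at hn
    have := ih _ (by omega) (v.insertBead p) rfl
    rw [← psiStar_psi_self_of_notMem hb, psi_basis_of_notMem hb, map_smul, map_smul]
    have h3 := LinearMap.congr_fun (h2 p) (Fock.basis (v.insertBead p))
    simp only [Module.End.mul_apply] at h3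
    rw [h3, this, map_zero, smul_zero]

/-- `[a, b] - ⁅a, b⁆` commutes with `ψ_s`. -/
lemma commutator_mul_psi (a b : AInfty) (s : ℤ) :
    (fockOp a * fockOp b - fockOp b * fockOp a - fockOp ⁅a, b⁆) * psi s =
      psi s * (fockOp a * fockOp b - fockOp b * fockOp a - fockOp ⁅a, b⁆) := by
  rw [← psiVec_basis]
  set u := VHalf.basis s
  have h : ((⁅a, b⁆ : AInfty).mat : Module.End ℂ VHalf) u =
      (a.mat : Module.End ℂ VHalf) ((b.mat : Module.End ℂ VHalf) u) -
        (b.mat : Module.End ℂ VHalf) ((a.mat : Module.End ℂ VHalf) u) := rfl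
  simp only [sub_mul, mul_sub, mul_assoc, fockOp_mul_psiVec, h, map_sub, mul_add]
  simp only [← mul_assoc, fockOp_mul_psiVec, add_mul]
  abel

/-- `[a, b] - ⁅a, b⁆` commutes with `ψ*_s`. -/
lemma commutator_mul_psiStar (a b : AInfty) (s : ℤ) :
    (fockOp a * fockOp b - fockOp b * fockOp a - fockOp ⁅a, b⁆) * psiStar s =
      psiStar s * (fockOp a * fockOp b - fockOp b * fockOp a - fockOp ⁅a, b⁆) := by
  obtain ⟨k, hk0, hk⟩ := a.mat.2.exists_bound
  obtain ⟨l, hl0, hl⟩ := b.mat.2.exists_bound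
  obtain ⟨n, hn0, hn⟩ := (⁅a, b⁆ : AInfty).mat.2.exists_bound
  set j := k + l + n with hj
  have hk' : ∀ p q, j < |p - q| → matEntry a.mat p q = 0 := fun p q h => hk p q (by omega)
  have hl' : ∀ p q, j < |p - q| → matEntry b.mat p q = 0 := fun p q h => hl p q (by omega)
  have hn' : ∀ p q, j < |p - q| → matEntry (⁅a, b⁆ : AInfty).mat p q = 0 :=
    fun p q h => hn p q (by omega)
  -- `J` holds the support of row `s` of each matrix, and `J'` that of all rows in `J`
  set J := Finset.Icc (-(|s| + j)) (|s| + j) with hJ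
  set J' := Finset.Icc (-(|s| + 2 * j)) (|s| + 2 * j) with hJ'
  have ea : fockOp a * psiStar s = psiStar s * fockOp a - ∑ q ∈ J, matEntry a.mat s q • psiStar q :=
    fockOp_mul_psiStar a hk' le_rfl
  have eb : fockOp b * psiStar s = psiStar s * fockOp b - ∑ q ∈ J, matEntry b.mat s q • psiStar q :=
    fockOp_mul_psiStar b hl' le_rfl
  have ec : fockOp ⁅a, b⁆ * psiStar s = psiStar s * fockOp ⁅a, b⁆ -
      ∑ q ∈ J', matEntry (⁅a, b⁆ : AInfty).mat s q • psiStar q :=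
    fockOp_mul_psiStar _ hn' (by omega)
  have ea' : ∀ r ∈ J, fockOp a * psiStar r = psiStar r * fockOp a -
      ∑ q ∈ J', matEntry a.mat r q • psiStar q := fun r hr => by
    rw [hJ, Finset.mem_Icc, ← abs_le] at hr
    exact fockOp_mul_psiStar a hk' (by omega)
  have eb' : ∀ r ∈ J, fockOp b * psiStar r = psiStar r * fockOp b -
      ∑ q ∈ J', matEntry b.mat r q • psiStar q := fun r hr => by
    rw [hJ, Finset.mem_Icc, ← abs_le] at hr
    exact fockOp_mul_psiStar b hl' (by omega)
  have hout : ∀ (A : Module.End ℂ VHalf), (∀ p q, j < |p - q| → matEntry A p q = 0) →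
      ∀ r, r ∉ J → matEntry A s r = 0 := fun A hA r hr => by
    apply hA
    rw [hJ, Finset.mem_Icc, ← abs_le] at hr
    have := abs_sub_abs_le_abs_sub r s
    rw [abs_sub_comm] at this
    omega
  have hmul : ∀ q, matEntry (⁅a, b⁆ : AInfty).mat s q =
      ∑ r ∈ J, matEntry a.mat s r * matEntry b.mat r q -
        ∑ r ∈ J, matEntry b.mat s r * matEntry a.mat r q := fun q => by
    have : ((⁅a, b⁆ : AInfty).mat : Module.End ℂ VHalf) = (a.mat : Module.End ℂ VHalf) * b.mat -
      (b.mat : Module.End ℂ VHalf) * a.mat := rfl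
    rw [this, matEntry_sub, matEntry_mul _ _ _ _ J, matEntry_mul _ _ _ _ J]
    · exact fun r hr => by rw [hout _ hl' r hr, zero_mul]
    · exact fun r hr => by rw [hout _ hk' r hr, zero_mul]
  have sa : fockOp a * ∑ q ∈ J, matEntry b.mat s q • psiStar q =
      (∑ q ∈ J, matEntry b.mat s q • psiStar q) * fockOp a -
        ∑ q ∈ J', (∑ r ∈ J, matEntry b.mat s r * matEntry a.mat r q) • psiStar q := by
    simp only [Finset.mul_sum, Finset.sum_mul, mul_smul_comm, smul_mul_assoc, Finset.sum_smul]
    rw [Finset.sum_comm, ← Finset.sum_sub_distrib]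
    refine Finset.sum_congr rfl fun r hr => ?_
    rw [ea' r hr, smul_sub, Finset.smul_sum]
    simp only [smul_smul]
  have sb : fockOp b * ∑ q ∈ J, matEntry a.mat s q • psiStar q =
      (∑ q ∈ J, matEntry a.mat s q • psiStar q) * fockOp b -
        ∑ q ∈ J', (∑ r ∈ J, matEntry a.mat s r * matEntry b.mat r q) • psiStar q := by
    simp only [Finset.mul_sum, Finset.sum_mul, mul_smul_comm, smul_mul_assoc, Finset.sum_smul]
    rw [Finset.sum_comm, ← Finset.sum_sub_distrib]
    refine Finset.sum_congr rfl fun r hr => ?_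
    rw [eb' r hr, smul_sub, Finset.smul_sum]
    simp only [smul_smul]
  simp only [hmul, sub_smul, Finset.sum_sub_distrib] at ec
  simp only [sub_mul, mul_sub, mul_assoc, ea, eb, ec]
  rw [sa, sb]
  simp only [← mul_assoc, ea, eb, sub_mul]
  abel

/-- `fockOp` turns brackets into commutators: the difference is determined by its value on the vacuum,
which is a multiple of the vacuum with coefficient zero. -/
lemma fockOp_lie (a b : AInfty) :
    fockOp ⁅a, b⁆ = fockOp a * fockOp b - fockOp b * fockOp a := by
  refine (sub_eq_zero.1 (eq_zero_of_commute (commutator_mul_psi a b) (commutator_mul_psiStar a b)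
    ?_)).symm
  set X := fockOp a * fockOp b - fockOp b * fockOp a - fockOp ⁅a, b⁆ with hX
  have h1 : ∀ p, X * psi p = psi p * X := commutator_mul_psi a b
  have h2 : ∀ p, X * psiStar p = psiStar p * X := commutator_mul_psiStar a b
  clear_value X
  have hcomm : ∀ p, normalOrdered p p * X = X * normalOrdered p p := fun p => by
    rw [normalOrdered_eq, sub_mul, mul_sub, mul_assoc, ← h2, ← mul_assoc, ← h1, mul_assoc]
    split_ifs <;> simp
  rw [eq_vacCoeff_smul (x := X (Fock.basis vacuum)) fun p => ?_]
  · have : vacCoeff (X (Fock.basis vacuum)) = 0 := by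
      simp only [hX, LinearMap.sub_apply, Module.End.mul_apply, map_sub, vacCoeff_commutator,
        vacCoeff_fockOp_vacuum, AInfty.c_lie, sub_self]
    rw [this, zero_smul]
  · rw [← Module.End.mul_apply, hcomm, Module.End.mul_apply,
      normalOrdered_vacuum (by omega), map_zero]

/-- The representation of `a_∞` on Fock space. -/
def fockRep : AInfty →ₗ⁅ℂ⁆ Module.End ℂ Fock where
  toFun := fockOp
  map_add' := fockOp_add
  map_smul' := fockOp_smul
  map_lie' {a b} := by rw [fockOp_lie, LieRing.of_associative_ring_bracket]

lemma fockRep_apply (a : AInfty) : fockRep a = fockOp a := rfl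

lemma fockOp_of_mat_eq_zero {a : AInfty} (h : a.mat = 0) : fockOp a = a.c • 1 := by
  ext x
  obtain ⟨m, hm⟩ := (eventually_fockOp a x).exists
  rw [hm, boxOp_apply, h]
  simp [matEntry]

/-- A diagram with a gap at `q` detects the coefficient of `ψ_q`. -/
lemma psiVec_injective : Function.Injective psiVec := by
  refine (injective_iff_map_eq_zero _).2 fun u hu => VHalf.basis.repr.injective
    (Finsupp.ext fun q => ?_)
  set v : MayaDiagram := vacuum.eraseBead q
  have hq : q ∉ v.black := fun h => h.2 rfl
  have key : ∀ u : VHalf, Fock.basis.repr (psiVec u (Fock.basis v)) (v.insertBead q) =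
      VHalf.basis.repr u q * v.sign q := by
    intro u
    have : Fock.basis.coord (v.insertBead q) ∘ₗ LinearMap.applyₗ (Fock.basis v) ∘ₗ psiVec =
        v.sign q • VHalf.basis.coord q := by
      refine VHalf.basis.ext fun r => ?_
      simp only [LinearMap.comp_apply, LinearMap.applyₗ_apply_apply, psiVec_basis,
        Module.Basis.coord_apply, Module.Basis.repr_self, LinearMap.smul_apply]
      by_cases h : r = q
      · subst h
        rw [psi_basis_of_notMem hq, map_smul, Module.Basis.repr_self, Finsupp.smul_apply,
          Finsupp.single_eq_same, Finsupp.single_eq_same]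
      · rw [Finsupp.single_eq_of_ne' h, smul_zero]
        by_cases hr : r ∈ v.black
        · rw [psi_basis_of_mem hr, map_zero, Finsupp.zero_apply]
        · rw [psi_basis_of_notMem hr, map_smul, Module.Basis.repr_self, Finsupp.smul_apply,
            Finsupp.single_eq_of_ne', smul_zero]
          intro h'
          have h2 : r ∈ (v.insertBead r).black := Or.inl rfl
          rw [h'] at h2
          exact h2.elim h hr
    have := LinearMap.congr_fun this u
    rw [mul_comm]
    exact this
  have := key u
  rw [hu, LinearMap.zero_apply, map_zero, Finsupp.zero_apply] at this
  rw [map_zero, Finsupp.zero_apply]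
  exact (mul_eq_zero.1 this.symm).resolve_right (sign_ne_zero _ _)

instance : Nontrivial Fock :=
  ⟨⟨Fock.basis vacuum, 0, fun h => by
    have := vacCoeff_vacuum; rw [h, map_zero] at this; exact zero_ne_one this⟩⟩

lemma fockRep_injective : Function.Injective fockRep := by
  refine (injective_iff_map_eq_zero _).2 fun a ha => ?_
  rw [fockRep_apply] at ha
  have hmat : a.mat = 0 := by
    refine Subtype.ext (VHalf.basis.ext fun s => psiVec_injective ?_)
    have := fockOp_mul_psi a s
    rw [ha, zero_mul, mul_zero, zero_add] at this
    rw [← this]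
    simp
  rw [fockOp_of_mat_eq_zero hmat] at ha
  exact AInfty.ext hmat ((smul_eq_zero.1 ha).resolve_right one_ne_zero)

/-! ### The embedding of the affine Lie algebra in `a_∞` -/

section Positions

variable {ℓ : ℕ} [NeZero ℓ]

/-- The row or column `i` such that `p = i + 1 + k ℓ`. -/
def res (ℓ : ℕ) [NeZero ℓ] (p : ℤ) : Fin ℓ :=
  ⟨((p - 1) % ℓ).toNat, by
    have h0 : (0 : ℤ) < ℓ := by exact_mod_cast NeZero.pos ℓ
    have := Int.emod_nonneg (p - 1) h0.ne'
    have := Int.emod_lt_of_pos (p - 1) h0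
    omega⟩

/-- The integer `k` such that `p = i + 1 + k ℓ` with `0 ≤ i < ℓ`. -/
def lev (ℓ : ℕ) (p : ℤ) : ℤ := (p - 1) / ℓ

lemma res_add_lev (p : ℤ) : (res ℓ p : ℤ) + 1 + lev ℓ p * ℓ = p := by
  have h0 : (0 : ℤ) < ℓ := by exact_mod_cast NeZero.pos ℓ
  have := Int.emod_nonneg (p - 1) h0.ne'
  have h := Int.emod_add_mul_ediv (p - 1) ℓ
  simp only [res, lev, Int.toNat_of_nonneg this]
  linarith [mul_comm ((p - 1) / (ℓ : ℤ)) ℓ]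

lemma res_lev_unique {p k : ℤ} {i : Fin ℓ} (h : p = (i : ℤ) + 1 + k * ℓ) :
    res ℓ p = i ∧ lev ℓ p = k := by
  have h0 : (0 : ℤ) < ℓ := by exact_mod_cast NeZero.pos ℓ
  have hp : p - 1 = i + ℓ * k := by rw [h]; ring
  have hi : (i : ℤ) < ℓ := by exact_mod_cast i.2
  constructor
  · ext
    simp only [res]
    rw [hp, Int.add_mul_emod_self_left, Int.emod_eq_of_lt (by positivity) hi, Int.toNat_natCast]
  · rw [lev, hp, Int.add_mul_ediv_left _ _ h0.ne', Int.ediv_eq_zero_of_lt (by positivity) hi,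
      zero_add]

/-- Positions are numbered by the residue and the level. -/
def posEquiv (ℓ : ℕ) [NeZero ℓ] : ℤ ≃ Fin ℓ × ℤ where
  toFun p := (res ℓ p, lev ℓ p)
  invFun x := (x.1 : ℤ) + 1 + x.2 * ℓ
  left_inv := res_add_lev
  right_inv _ := Prod.ext (res_lev_unique rfl).1 (res_lev_unique rfl).2

lemma eq_iff_res_lev {p q : ℤ} : p = q ↔ res ℓ p = res ℓ q ∧ lev ℓ p = lev ℓ q := by
  rw [← (posEquiv ℓ).injective.eq_iff, Prod.ext_iff]; rfl

lemma nonpos_iff_lev {p : ℤ} : p ≤ 0 ↔ lev ℓ p < 0 := by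
  have h0 : (0 : ℤ) < ℓ := by exact_mod_cast NeZero.pos ℓ
  rw [lev, Int.ediv_lt_iff_lt_mul h0]; omega

lemma abs_sub_le_of_lev {p q M : ℤ} (h : |lev ℓ p - lev ℓ q| ≤ M) : |p - q| ≤ ℓ * (M + 1) := by
  have h1 := res_add_lev (ℓ := ℓ) p
  have h2 := res_add_lev (ℓ := ℓ) q
  have h3 : ((res ℓ p : Fin ℓ) : ℤ) < ℓ := by exact_mod_cast (res ℓ p).2
  have h4 : ((res ℓ q : Fin ℓ) : ℤ) < ℓ := by exact_mod_cast (res ℓ q).2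
  rw [abs_le] at h ⊢
  constructor <;> nlinarith [NeZero.pos ℓ]

end Positions

section Loop

variable {ℓ : ℕ}

/-- `t d/dt`, applied to each entry of a vector of Laurent polynomials. -/
def vecEuler (ℓ : ℕ) : Module.End ℂ (Fin ℓ → ℂ[T;T⁻¹]) := LinearMap.compLeft laurentEuler (Fin ℓ)

lemma vecEuler_apply (v : Fin ℓ → ℂ[T;T⁻¹]) (i : Fin ℓ) : vecEuler ℓ v i = laurentEuler (v i) := rfl

lemma vecEuler_mulVec (X : Matrix (Fin ℓ) (Fin ℓ) ℂ[T;T⁻¹]) (v : Fin ℓ → ℂ[T;T⁻¹]) :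
    vecEuler ℓ (X.mulVec v) = (AffineGl.euler X).mulVec v + X.mulVec (vecEuler ℓ v) := by
  ext1 i
  simp [vecEuler_apply, AffineGl.euler, Matrix.mulVec, dotProduct, laurentEuler_mul,
    Finset.sum_add_distrib]

/-- The action of the affine Lie algebra on `ℂ^ℓ ⊗ ℂ[t, t⁻¹]`, of level zero: `X ⊗ tᵐ` acts by
multiplication and `d` as `t d/dt`. -/
def loopRep (ℓ : ℕ) : AffineGl ℓ →ₗ⁅ℂ⁆ Module.End ℂ (Fin ℓ → ℂ[T;T⁻¹]) where
  toFun x := x.mat.mulVecLin.restrictScalars ℂ + x.d • vecEuler ℓ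
  map_add' x y := by
    refine LinearMap.ext fun v => ?_
    simp [add_smul]
    abel
  map_smul' r x := by
    refine LinearMap.ext fun v => ?_
    simp [mul_smul]
  map_lie' {x y} := by
    refine LinearMap.ext fun v => ?_
    simp only [AffineGl.mat_lie, AffineGl.d_lie, LinearMap.add_apply, LinearMap.smul_apply,
      LinearMap.coe_restrictScalars, Matrix.mulVecLin_apply, LieRing.of_associative_ring_bracket,
      LinearMap.sub_apply, Module.End.mul_apply, map_add, map_smul, Matrix.add_mulVec,
      Matrix.sub_mulVec, Matrix.smul_mulVec,
      vecEuler_mulVec, Matrix.mulVec_mulVec]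
    module

lemma loopRep_apply (x : AffineGl ℓ) (v : Fin ℓ → ℂ[T;T⁻¹]) :
    loopRep ℓ x v = x.mat.mulVec v + x.d • vecEuler ℓ v := rfl

/-- A bound for the exponents of `t` that occur in a matrix of Laurent polynomials. -/
lemma exists_coeff_bound (X : Matrix (Fin ℓ) (Fin ℓ) ℂ[T;T⁻¹]) :
    ∃ M : ℤ, 0 ≤ M ∧ ∀ i j m, M < |m| → (X i j).coeff m = 0 := by
  have h : ∀ i j, ∃ M : ℤ, ∀ m, M < |m| → (X i j).coeff m = 0 := fun i j => by
    obtain ⟨M, hM⟩ := ((X i j).coeff.support.image fun m => |m|).bddAbove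
    refine ⟨M, fun m hm => ?_⟩
    by_contra hne
    exact hm.not_ge (hM (by
      simp only [Finset.coe_image]
      exact ⟨m, by simpa using hne, rfl⟩))
  choose M hM using h
  refine ⟨∑ i, ∑ j, |M i j|, Finset.sum_nonneg fun i _ => Finset.sum_nonneg fun j _ => abs_nonneg _,
    fun i j m hm => hM i j m (lt_of_le_of_lt ?_ hm)⟩
  calc M i j ≤ |M i j| := le_abs_self _
    _ ≤ ∑ j, |M i j| := Finset.single_le_sum (f := fun j => |M i j|)
        (fun j _ => abs_nonneg _) (Finset.mem_univ j)
    _ ≤ _ := Finset.single_le_sum (f := fun i => ∑ j, |M i j|)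
        (fun i _ => Finset.sum_nonneg fun j _ => abs_nonneg _) (Finset.mem_univ i)

/-- The number of `k` with `k < 0 ≤ k + m`, minus the number of `k` with `k + m < 0 ≤ k`, is `m`. -/
lemma sum_indicator_shift {m M : ℤ} (hm : |m| ≤ M) : ∑ k ∈ Finset.Icc (-M) M,
    ((if k < 0 then 1 else 0) - (if k + m < 0 then 1 else 0) : ℂ) = m := by
  have hM : 0 ≤ M := (abs_nonneg m).trans hm
  rw [abs_le] at hm
  rw [Finset.sum_sub_distrib, Finset.sum_boole, Finset.sum_boole]
  have h1 : (Finset.Icc (-M) M).filter (fun k => k < 0) = Finset.Ico (-M) 0 := by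
    ext k; simp; omega
  have h2 : (Finset.Icc (-M) M).filter (fun k => k + m < 0) = Finset.Ico (-M) (-m) := by
    ext k; simp; omega
  rw [h1, h2, Int.card_Ico, Int.card_Ico]
  have h3 : (((0 - -M).toNat : ℤ) : ℂ) = M := by rw [Int.toNat_of_nonneg (by omega)]; simp
  have h4 : (((-m - -M).toNat : ℤ) : ℂ) = M - m := by
    rw [Int.toNat_of_nonneg (by omega)]; push_cast; ring
  rw [Int.cast_natCast] at h3 h4
  rw [h3, h4]
  ring

lemma coeff_zero_mul (f g : ℂ[T;T⁻¹]) {J : Finset ℤ} (hJ : ∀ m, m ∉ J → f.coeff m = 0) :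
    (f * g).coeff 0 = ∑ m ∈ J, f.coeff m * g.coeff (-m) := by
  have h : (f * g).coeff 0 = f.coeff.sum fun m c => c * g.coeff (-m) := by
    clear hJ
    induction f using AddMonoidAlgebra.induction_linear with
    | zero => simp
    | add f f' hf hf' =>
      rw [add_mul, AddMonoidAlgebra.coeff_add, Finsupp.add_apply, hf, hf',
        AddMonoidAlgebra.coeff_add, Finsupp.sum_add_index'] <;> simp [add_mul]
    | single m a =>
      rw [AddMonoidAlgebra.coeff_single_mul_eq_mul_coeff (-m), AddMonoidAlgebra.coeff_single,
        Finsupp.sum_single_index (zero_mul _)]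
      intro n _; constructor <;> intro h <;> linarith
  rw [h]
  exact Finsupp.sum_of_support_subset _ (fun m hm => by
    by_contra h'; exact (Finsupp.mem_support_iff.1 hm) (hJ m h')) _ (by simp)

lemma form_euler_eq_sum (X Y : Matrix (Fin ℓ) (Fin ℓ) ℂ[T;T⁻¹]) {M : ℤ}
    (hM : ∀ i j m, M < |m| → (X i j).coeff m = 0) :
    AffineGl.form (AffineGl.euler X) Y = ∑ i, ∑ j, ∑ m ∈ Finset.Icc (-M) M,
      m * ((X i j).coeff m * (Y j i).coeff (-m)) := by
  simp only [AffineGl.form, Matrix.trace, Matrix.diag_apply, Matrix.mul_apply,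
    AddMonoidAlgebra.coeff_sum, Finsupp.finsetSum_apply]
  refine Finset.sum_congr rfl fun i _ => Finset.sum_congr rfl fun j _ => ?_
  rw [coeff_zero_mul _ _ (J := Finset.Icc (-M) M)]
  · refine Finset.sum_congr rfl fun m _ => ?_
    simp only [AffineGl.euler, LinearMap.mapMatrix_apply, Matrix.map_apply, laurentEuler_coeff]
    ring
  · intro m hm
    simp only [AffineGl.euler, LinearMap.mapMatrix_apply, Matrix.map_apply, laurentEuler_coeff]
    rw [hM i j m, mul_zero]
    rw [Finset.mem_Icc, ← abs_le] at hm
    omega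

variable [NeZero ℓ]

/-- The basis of the Laurent polynomials given by the powers of `t`. -/
def laurentBasis : Module.Basis ℤ ℂ ℂ[T;T⁻¹] :=
  .ofRepr { AddMonoidAlgebra.coeffAddEquiv with map_smul' := fun _ _ => rfl }

lemma laurentBasis_repr (f : ℂ[T;T⁻¹]) : laurentBasis.repr f = f.coeff := rfl

/-- The basis of `ℂ^ℓ ⊗ ℂ[t, t⁻¹]` whose member with index `i + 1 + k ℓ` is the vector with entry
`t⁻ᵏ` in row `i`. It identifies `ℂ^ℓ ⊗ ℂ[t, t⁻¹]` with the space `V_{ℤ+1/2}`. -/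
def loopBasis (ℓ : ℕ) [NeZero ℓ] : Module.Basis ℤ ℂ (Fin ℓ → ℂ[T;T⁻¹]) :=
  (Pi.basis fun _ : Fin ℓ => laurentBasis).reindex
    ((Equiv.sigmaEquivProd (Fin ℓ) ℤ).trans
      (((Equiv.refl (Fin ℓ)).prodCongr (Equiv.neg ℤ)).trans (posEquiv ℓ).symm))

lemma loopBasis_apply (p : ℤ) :
    loopBasis ℓ p = Pi.single (res ℓ p) (.single (-lev ℓ p) 1) := by
  rw [loopBasis, Module.Basis.reindex_apply, Pi.basis_apply]
  rfl

lemma loopBasis_repr (v : Fin ℓ → ℂ[T;T⁻¹]) (p : ℤ) :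
    (loopBasis ℓ).repr v p = (v (res ℓ p)).coeff (-lev ℓ p) := by
  rw [loopBasis, Module.Basis.repr_reindex_apply, Pi.basis_repr, laurentBasis_repr]
  rfl

/-- The action of the affine Lie algebra on `V_{ℤ+1/2}`, transported from `ℂ^ℓ ⊗ ℂ[t, t⁻¹]`. -/
def loopEnd (ℓ : ℕ) [NeZero ℓ] : AffineGl ℓ →ₗ⁅ℂ⁆ Module.End ℂ VHalf :=
  (((loopBasis ℓ).equiv VHalf.basis (Equiv.refl ℤ)).lieConj : _ →ₗ⁅ℂ⁆ _).comp (loopRep ℓ)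

lemma matEntry_loopEnd (x : AffineGl ℓ) (p q : ℤ) : matEntry (loopEnd ℓ x) p q =
    (x.mat (res ℓ p) (res ℓ q)).coeff (lev ℓ q - lev ℓ p) +
      if p = q then -(lev ℓ p * x.d) else 0 := by
  have h : matEntry (loopEnd ℓ x) p q = (loopBasis ℓ).repr (loopRep ℓ x (loopBasis ℓ q)) p := by
    have h1 : loopEnd ℓ x = ((loopBasis ℓ).equiv VHalf.basis (Equiv.refl ℤ)).conj (loopRep ℓ x) := rfl
    have h2 : ((loopBasis ℓ).equiv VHalf.basis (Equiv.refl ℤ)).symm (VHalf.basis q) =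
        loopBasis ℓ q := by
      rw [LinearEquiv.symm_apply_eq, Module.Basis.equiv_apply]; rfl
    have h3 : ∀ u, VHalf.basis.repr ((loopBasis ℓ).equiv VHalf.basis (Equiv.refl ℤ) u) =
        (loopBasis ℓ).repr u := fun u => by
      simp [Module.Basis.equiv]
    rw [matEntry, h1, LinearEquiv.conj_apply_apply, h2, h3]
  rw [h, loopBasis_repr, loopRep_apply, loopBasis_apply, Pi.add_apply, Pi.smul_apply,
    AddMonoidAlgebra.coeff_add, Finsupp.add_apply, Matrix.mulVec_single]
  congr 1
  · simp only [Pi.smul_apply, MulOpposite.smul_eq_mul_unop, MulOpposite.unop_op, Matrix.col_apply]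
    rw [AddMonoidAlgebra.coeff_mul_single_eq_coeff_mul (lev ℓ q - lev ℓ p), mul_one]
    intro m _
    constructor <;> intro h <;> linarith
  · rw [AddMonoidAlgebra.coeff_smul, Finsupp.smul_apply, vecEuler_apply]
    by_cases hr : res ℓ p = res ℓ q
    · rw [hr, Pi.single_eq_same, laurentEuler_single, AddMonoidAlgebra.coeff_single]
      by_cases hl : lev ℓ p = lev ℓ q
      · rw [if_pos (eq_iff_res_lev.2 ⟨hr, hl⟩), hl, Finsupp.single_eq_same]
        push_cast; simp; ring
      · rw [if_neg (fun h => hl (eq_iff_res_lev.1 h).2), Finsupp.single_eq_of_ne (by omega),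
          smul_zero]
    · rw [Pi.single_eq_of_ne hr, map_zero, if_neg (fun h => hr (eq_iff_res_lev.1 h).1)]
      simp

lemma isBand_loopEnd (x : AffineGl ℓ) : IsBand (loopEnd ℓ x) := by
  obtain ⟨M, hM0, hM⟩ := exists_coeff_bound x.mat
  refine ⟨ℓ * (M + 1), fun p q h => ?_⟩
  rw [matEntry_loopEnd, hM, if_neg, add_zero]
  · rintro rfl
    rw [sub_self, abs_zero] at h
    have : (0 : ℤ) ≤ ℓ * (M + 1) := by positivity
    omega
  · by_contra h'
    rw [abs_sub_comm] at h'
    exact h.not_ge (abs_sub_le_of_lev (not_lt.1 h'))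

/-- The cocycle of `a_∞` restricts to the cocycle of the affine Lie algebra. For `X_{i,j} ⊗ tᵐ` and
`X_{j,i} ⊗ t⁻ᵐ` it is the sum over `k` of the signs of the pairs of positions `(i, k)` and
`(j, k + m)`, which depend only on `k` and `k + m`, and add up to `m`. -/
lemma bandCocycle_loopEnd (x y : AffineGl ℓ) :
    bandCocycle (loopEnd ℓ x) (loopEnd ℓ y) = AffineGl.form (AffineGl.euler x.mat) y.mat := by
  obtain ⟨M, hM0, hM⟩ := exists_coeff_bound x.mat
  rw [form_euler_eq_sum _ _ hM]
  -- the pair of positions `(i, k)`, `(j, k + m)` is coded by `((i, j), (m, k))`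
  let e : ((Fin ℓ × Fin ℓ) × ℤ × ℤ) ≃ ℤ × ℤ :=
    { toFun := fun z => ((posEquiv ℓ).symm (z.1.1, z.2.2), (posEquiv ℓ).symm (z.1.2, z.2.2 + z.2.1))
      invFun := fun pq => ((res ℓ pq.1, res ℓ pq.2), (lev ℓ pq.2 - lev ℓ pq.1, lev ℓ pq.1))
      left_inv := fun ⟨⟨i, j⟩, m, k⟩ => by
        obtain ⟨r1, l1⟩ := res_lev_unique (ℓ := ℓ) (p := (posEquiv ℓ).symm (i, k)) rfl
        obtain ⟨r2, l2⟩ := res_lev_unique (ℓ := ℓ) (p := (posEquiv ℓ).symm (j, k + m)) rfl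
        simp only [r1, l1, r2, l2, add_sub_cancel_left]
      right_inv := fun pq => by
        have h1 : (posEquiv ℓ).symm (res ℓ pq.1, lev ℓ pq.1) = pq.1 := res_add_lev _
        have h2 : (posEquiv ℓ).symm (res ℓ pq.2, lev ℓ pq.2) = pq.2 := res_add_lev _
        simp only [h1, h2, add_sub_cancel] }
  have he : ∀ i j m k, (e ((i, j), (m, k))).1 = (posEquiv ℓ).symm (i, k) ∧
    (e ((i, j), (m, k))).2 = (posEquiv ℓ).symm (j, k + m) := fun _ _ _ _ => ⟨rfl, rfl⟩
  have hterm : ∀ i j m k, cocycleSign (e ((i, j), (m, k))).1 (e ((i, j), (m, k))).2 *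
      (matEntry (loopEnd ℓ x) (e ((i, j), (m, k))).1 (e ((i, j), (m, k))).2 *
        matEntry (loopEnd ℓ y) (e ((i, j), (m, k))).2 (e ((i, j), (m, k))).1) =
      ((if k < 0 then 1 else 0) - (if k + m < 0 then 1 else 0)) *
        ((x.mat i j).coeff m * (y.mat j i).coeff (-m)) := by
    intro i j m k
    rw [(he i j m k).1, (he i j m k).2, cocycleSign_eq, matEntry_loopEnd, matEntry_loopEnd]
    obtain ⟨r1, l1⟩ := res_lev_unique (ℓ := ℓ) (p := (posEquiv ℓ).symm (i, k)) (i := i) (k := k) rfl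
    obtain ⟨r2, l2⟩ := res_lev_unique (ℓ := ℓ) (p := (posEquiv ℓ).symm (j, k + m)) (i := j)
      (k := k + m) rfl
    simp only [nonpos_iff_lev (ℓ := ℓ), r1, l1, r2, l2]
    by_cases hpq : (posEquiv ℓ).symm (i, k) = (posEquiv ℓ).symm (j, k + m)
    · have : m = 0 := by
        have := congrArg Prod.snd ((posEquiv ℓ).symm.injective hpq)
        simpa using this
      subst this
      simp
    · rw [if_neg hpq, if_neg (Ne.symm hpq), add_zero, add_zero]
      congr 4 <;> ring
  rw [bandCocycle, ← finsum_comp_equiv e, finsum_eq_sum_of_support_subset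
    (s := Finset.univ ×ˢ (Finset.Icc (-M) M ×ˢ Finset.Icc (-M) M))]
  · simp only [Finset.sum_product, ← Finset.univ_product_univ]
    refine Finset.sum_congr rfl fun i _ => Finset.sum_congr rfl fun j _ =>
      Finset.sum_congr rfl fun m hm => ?_
    simp only [hterm]
    rw [← Finset.sum_mul, sum_indicator_shift]
    rw [abs_le]; exact Finset.mem_Icc.1 hm
  · rintro ⟨⟨i, j⟩, m, k⟩ h
    simp only [Function.mem_support, hterm] at h
    have h1 : |m| ≤ M := by
      by_contra h1
      exact h (by rw [hM i j m (not_le.1 h1)]; ring)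
    have h2 := left_ne_zero_of_mul h
    simp only [Finset.coe_product, Finset.coe_univ, Finset.coe_Icc, Set.mem_prod, Set.mem_univ,
      Set.mem_Icc, true_and]
    rw [abs_le] at h1
    refine ⟨h1, ?_⟩
    split_ifs at h2 <;> first | omega | (exfalso; simp at h2)

/-- The homomorphism from the affine Lie algebra of `gl_ℓ`, with the element `d`, to `a_∞`. The element
`d` goes to a diagonal matrix, with entry `-k` in the positions of level `k`. -/
def affineToInfty (ℓ : ℕ) [NeZero ℓ] : AffineGl ℓ →ₗ⁅ℂ⁆ AInfty where
  toFun x := ⟨⟨loopEnd ℓ x, isBand_loopEnd x⟩, x.c⟩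
  map_add' _ _ := AInfty.ext (Subtype.ext (map_add _ _ _)) rfl
  map_smul' _ _ := AInfty.ext (Subtype.ext (map_smul _ _ _)) rfl
  map_lie' {x y} := AInfty.ext (Subtype.ext (LieHom.map_lie _ _ _)) (bandCocycle_loopEnd x y).symm

lemma matEntry_affineToInfty (x : AffineGl ℓ) (p q : ℤ) :
    matEntry (affineToInfty ℓ x).mat p q =
      (x.mat (res ℓ p) (res ℓ q)).coeff (lev ℓ q - lev ℓ p) +
        if p = q then -(lev ℓ p * x.d) else 0 := matEntry_loopEnd x p q

lemma affineToInfty_eq_zero {x : AffineGl ℓ} (hd : x.d = 0) (h : affineToInfty ℓ x = 0) :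
    x = 0 := by
  refine AffineGl.ext ?_ (congrArg AInfty.c h) hd
  ext i j m
  have h1 := matEntry_affineToInfty x ((posEquiv ℓ).symm (i, 0)) ((posEquiv ℓ).symm (j, m))
  obtain ⟨r1, l1⟩ := res_lev_unique (ℓ := ℓ) (p := (posEquiv ℓ).symm (i, 0)) (i := i) (k := 0) rfl
  obtain ⟨r2, l2⟩ := res_lev_unique (ℓ := ℓ) (p := (posEquiv ℓ).symm (j, m)) (i := j) (k := m) rfl
  rw [r1, l1, r2, l2, hd, h] at h1
  simpa [matEntry] using h1.symm

lemma loopEntry_eq (i j : Fin ℓ) (m p q : ℤ) : loopEntry i j m p q =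
    if res ℓ p = i ∧ res ℓ q = j ∧ lev ℓ q - lev ℓ p = m then 1 else 0 := by
  have key : ∀ k : ℤ, (p = (i : ℤ) + 1 + k * ℓ ∧ q = (j : ℤ) + 1 + k * ℓ + m * ℓ) ↔
      (k = lev ℓ p ∧ (res ℓ p = i ∧ res ℓ q = j ∧ lev ℓ q - lev ℓ p = m)) := by
    intro k
    constructor
    · rintro ⟨h1, h2⟩
      have h2' : q = (j : ℤ) + 1 + (k + m) * ℓ := by rw [h2]; ring
      obtain ⟨r1, l1⟩ := res_lev_unique h1
      obtain ⟨r2, l2⟩ := res_lev_unique h2'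
      exact ⟨l1.symm, r1, r2, by omega⟩
    · rintro ⟨rfl, rfl, rfl, rfl⟩
      refine ⟨(res_add_lev p).symm, ?_⟩
      conv_lhs => rw [← res_add_lev (ℓ := ℓ) q]
      ring
  rw [loopEntry]
  simp only [key]
  rw [finsum_eq_single _ (lev ℓ p)]
  · simp
  · intro k hk; simp [hk]

end Loop

/-! ### Chevalley generators of the affine Lie algebra -/

section Units

variable {ℓ : ℕ}

/-- The element `X_{i,j} ⊗ tᵐ`. -/
def affineUnit (i j : Fin ℓ) (m : ℤ) : AffineGl ℓ := ⟨Matrix.single i j (.T m), 0, 0⟩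

/-- The element of the Cartan subalgebra given by a diagonal matrix and the coefficients of `c` and
`d`. -/
def cartan (y : Fin ℓ → ℂ) (c d : ℂ) : AffineGl ℓ :=
  ⟨Matrix.diagonal fun i => .C (y i), c, d⟩

lemma laurent_single_eq_smul_T (m : ℤ) (a : ℂ) :
    (AddMonoidAlgebra.single m a : ℂ[T;T⁻¹]) = a • LaurentPolynomial.T m := by
  rw [LaurentPolynomial.T, AddMonoidAlgebra.smul_single, smul_eq_mul, mul_one]

lemma affineGl_mk_sub (X Y : Matrix (Fin ℓ) (Fin ℓ) ℂ[T;T⁻¹]) (c d c' d' : ℂ) :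
    (⟨X, c, d⟩ - ⟨Y, c', d'⟩ : AffineGl ℓ) = ⟨X - Y, c - c', d - d'⟩ := rfl

lemma laurentEuler_T (m : ℤ) : laurentEuler (.T m) = (m : ℂ) • .T m := by
  rw [LaurentPolynomial.T, laurentEuler_single, AddMonoidAlgebra.smul_single, smul_eq_mul]

lemma laurentEuler_C (a : ℂ) : laurentEuler (.C a) = 0 := by
  change laurentEuler (.single 0 a) = 0
  rw [laurentEuler_single]; simp

lemma euler_single (i j : Fin ℓ) (f : ℂ[T;T⁻¹]) :
    AffineGl.euler (Matrix.single i j f) = Matrix.single i j (laurentEuler f) := by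
  ext1 a b
  simp only [AffineGl.euler, LinearMap.mapMatrix_apply, Matrix.map_apply, Matrix.single_apply]
  split_ifs <;> simp

lemma euler_diagonal_C (y : Fin ℓ → ℂ) :
    AffineGl.euler (Matrix.diagonal fun i => (.C (y i) : ℂ[T;T⁻¹])) = 0 := by
  ext1 a b
  simp only [AffineGl.euler, LinearMap.mapMatrix_apply, Matrix.map_apply, Matrix.diagonal_apply]
  split_ifs
  · exact laurentEuler_C _
  · simp

lemma affineUnit_lie (i j k l : Fin ℓ) (m n : ℤ) : ⁅affineUnit i j m, affineUnit k l n⁆ =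
    ⟨(if j = k then Matrix.single i l (.T (m + n)) else 0) -
      (if l = i then Matrix.single k j (.T (m + n)) else 0),
      if j = k ∧ l = i ∧ m + n = 0 then m else 0, 0⟩ := by
  ext1
  · simp only [AffineGl.mat_lie, affineUnit, zero_smul, sub_zero, add_zero]
    congr 1
    · split_ifs with h
      · subst h; rw [Matrix.single_mul_single_same, LaurentPolynomial.T_add]
      · exact Matrix.single_mul_single_of_ne _ _ _ _ h _
    · split_ifs with h
      · subst h; rw [Matrix.single_mul_single_same, add_comm, LaurentPolynomial.T_add]
      · exact Matrix.single_mul_single_of_ne _ _ _ _ h _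
  · simp only [AffineGl.c_lie, affineUnit, euler_single, laurentEuler_T, AffineGl.form]
    by_cases h : j = k
    · subst h
      rw [Matrix.single_mul_single_same, smul_mul_assoc, ← LaurentPolynomial.T_add]
      by_cases h2 : i = l
      · subst h2
        rw [Matrix.trace_single_eq_same, AddMonoidAlgebra.coeff_smul, Finsupp.smul_apply,
          LaurentPolynomial.T_apply]
        by_cases h3 : m + n = 0 <;> simp [h3]
      · rw [Matrix.trace_single_eq_of_ne _ _ _ h2]
        simp [Ne.symm h2]
    · rw [Matrix.single_mul_single_of_ne _ _ _ _ h]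
      simp [h]
  · rfl

lemma cartan_lie_affineUnit (y : Fin ℓ → ℂ) (c d : ℂ) (i j : Fin ℓ) (m : ℤ) :
    ⁅cartan y c d, affineUnit i j m⁆ = (y i - y j + d * m) • affineUnit i j m := by
  ext1
  · simp only [AffineGl.mat_lie, cartan, affineUnit, zero_smul, sub_zero, euler_single,
      laurentEuler_T, AffineGl.mat_smul]
    ext1 a b
    simp only [Matrix.add_apply, Matrix.sub_apply, Matrix.smul_apply, Matrix.diagonal_mul,
      Matrix.mul_diagonal, Matrix.single_apply]
    split_ifs with h
    · obtain ⟨rfl, rfl⟩ := h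
      rw [add_smul, sub_smul, mul_smul, LaurentPolynomial.smul_eq_C_mul (y _),
        LaurentPolynomial.smul_eq_C_mul (y _), mul_comm (LaurentPolynomial.T m)]
    · simp
  · simp [cartan, affineUnit, euler_diagonal_C, AffineGl.form]
  · simp [affineUnit]

end Units

section Generation

variable {ℓ : ℕ} {K : LieSubalgebra ℂ (AffineGl ℓ)}

lemma affineUnit_mem_of_chain {i j k : Fin ℓ} {m n : ℤ} (hik : i ≠ k)
    (h1 : affineUnit i j m ∈ K) (h2 : affineUnit j k n ∈ K) : affineUnit i k (m + n) ∈ K := by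
  have := K.lie_mem h1 h2
  rw [affineUnit_lie] at this
  simpa [hik.symm, affineUnit] using this

/-- `[[X_{ij} ⊗ tᵐ, X_{ji} ⊗ tⁿ], X_{ij} ⊗ tʳ] = 2 X_{ij} ⊗ t^{m+n+r}`. -/
lemma affineUnit_mem_of_triple {i j : Fin ℓ} {m n r : ℤ} (hij : i ≠ j)
    (h1 : affineUnit i j m ∈ K) (h2 : affineUnit j i n ∈ K) (h3 : affineUnit i j r ∈ K) :
    affineUnit i j (m + n + r) ∈ K := by
  have h := K.lie_mem (K.lie_mem h1 h2) h3
  have e : ⁅⁅affineUnit i j m, affineUnit j i n⁆, affineUnit i j r⁆ =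
      (2 : ℂ) • affineUnit i j (m + n + r) := by
    have h1 (f g : ℂ[T;T⁻¹]) : Matrix.single j j f * Matrix.single i j g = 0 :=
      Matrix.single_mul_single_of_ne _ _ _ _ hij.symm _
    have h2 (f g : ℂ[T;T⁻¹]) : Matrix.single i j f * Matrix.single i i g = 0 :=
      Matrix.single_mul_single_of_ne _ _ _ _ hij.symm _
    rw [affineUnit_lie]
    ext1
    · simp only [AffineGl.mat_lie, affineUnit, if_true, zero_smul, sub_zero, add_zero, sub_mul,
        mul_sub, Matrix.single_mul_single_same, h1, h2, ← LaurentPolynomial.T_add, add_comm r]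
      change _ = (2 : ℂ) • Matrix.single i j _
      rw [two_smul, zero_sub, sub_neg_eq_add]
    · simp only [AffineGl.c_lie, affineUnit, if_true, map_sub, euler_single, AffineGl.form, sub_mul,
        Matrix.single_mul_single_same, h1, sub_zero, Matrix.trace_single_eq_of_ne _ _ _ hij,
        AffineGl.c_smul]
      simp
    · simp [affineUnit]
  rw [e] at h
  have := K.smul_mem (2⁻¹ : ℂ) h
  rwa [smul_smul, inv_mul_cancel₀ two_ne_zero, one_smul] at this

end Generation

section Chevalley

variable {ℓ : ℕ}

lemma coe_affineLoop_single (i j : Fin ℓ) (h : i ≠ j) (m : ℤ) :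
    ((affineLoop (LieAlgebra.SpecialLinear.single i j h (1 : ℂ)) m : affineSl ℓ) : AffineGl ℓ) =
      affineUnit i j m := by
  refine AffineGl.ext ?_ rfl rfl
  change ((LieAlgebra.SpecialLinear.single i j h (1 : ℂ)).1.map fun a =>
    LaurentPolynomial.C a * LaurentPolynomial.T m) = Matrix.single i j (.T m)
  ext1 a b
  rw [LieAlgebra.SpecialLinear.val_single, Matrix.map_apply, Matrix.single_apply,
    Matrix.single_apply]
  split_ifs <;> simp

variable [ℓ.AtLeastTwo]

lemma coe_chevalleyE (i : Fin ℓ) : ((chevalleyE i : affineSl ℓ) : AffineGl ℓ) =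
    affineUnit (i - 1) i (if i = 0 then 1 else 0) := coe_affineLoop_single _ _ _ _

lemma coe_chevalleyF (i : Fin ℓ) : ((chevalleyF i : affineSl ℓ) : AffineGl ℓ) =
    affineUnit i (i - 1) (if i = 0 then -1 else 0) := coe_affineLoop_single _ _ _ _

lemma coe_chevalleyH (i : Fin ℓ) : ((chevalleyH i : affineSl ℓ) : AffineGl ℓ) =
    cartan (Pi.single (i - 1) 1 - Pi.single i 1) (if i = 0 then 1 else 0) 0 := by
  change ⁅((chevalleyE i : affineSl ℓ) : AffineGl ℓ), ((chevalleyF i : affineSl ℓ) : AffineGl ℓ)⁆ = _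
  rw [coe_chevalleyE, coe_chevalleyF, affineUnit_lie]
  ext1
  · have h : ((if i = 0 then 1 else 0) + (if i = 0 then -1 else 0) : ℤ) = 0 := by split_ifs <;> rfl
    simp only [if_true, h, cartan, LaurentPolynomial.T_zero]
    ext1 a b
    simp only [Matrix.sub_apply, Matrix.single_apply, Matrix.diagonal_apply, Pi.sub_apply,
      Pi.single_apply]
    grind
  · simp only [cartan]; split_ifs <;> simp_all
  · rfl

lemma val_sub_one_add_one {i : Fin ℓ} (hi : i ≠ 0) : ((i - 1 : Fin ℓ) : ℕ) + 1 = i := by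
  obtain ⟨n, rfl⟩ := Nat.exists_eq_add_of_le' (Nat.AtLeastTwo.prop : 2 ≤ ℓ)
  have := Fin.val_sub_one_of_ne_zero hi
  have h0 : (i : ℕ) ≠ 0 := fun h => hi (Fin.ext h)
  omega

lemma val_zero_sub_one : ((0 - 1 : Fin ℓ) : ℕ) + 1 = ℓ := by
  obtain ⟨n, rfl⟩ := Nat.exists_eq_add_of_le' (Nat.AtLeastTwo.prop : 2 ≤ ℓ)
  simp

lemma chevalleyE_lie_chevalleyF {i j : Fin ℓ} (h : i ≠ j) : ⁅chevalleyE i, chevalleyF j⁆ = 0 := by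
  refine Subtype.ext (Subtype.ext ?_)
  change ⁅((chevalleyE i : affineSl ℓ) : AffineGl ℓ), ((chevalleyF j : affineSl ℓ) : AffineGl ℓ)⁆ = 0
  rw [coe_chevalleyE, coe_chevalleyF, affineUnit_lie, if_neg h,
    if_neg (fun h' => h (sub_left_injective h').symm), if_neg (fun h' => h h'.1), sub_zero]
  rfl

lemma exists_chevalleyH_lie_chevalleyF (i j : Fin ℓ) :
    ∃ a : ℂ, ⁅chevalleyH i, chevalleyF j⁆ = a • chevalleyF j := by
  have h : ∃ a : ℂ, ⁅((chevalleyH i : affineSl ℓ) : AffineGl ℓ),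
      ((chevalleyF j : affineSl ℓ) : AffineGl ℓ)⁆ =
      a • ((chevalleyF j : affineSl ℓ) : AffineGl ℓ) := by
    rw [coe_chevalleyH, coe_chevalleyF, cartan_lie_affineUnit]
    exact ⟨_, rfl⟩
  obtain ⟨a, ha⟩ := h
  exact ⟨a, Subtype.ext (Subtype.ext ha)⟩

lemma res_lev_add_one (p : ℤ) : res ℓ (p + 1) - 1 = res ℓ p ∧
    lev ℓ (p + 1) = lev ℓ p + if res ℓ (p + 1) = 0 then 1 else 0 := by
  have h := res_add_lev (ℓ := ℓ) (p + 1)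
  by_cases h0 : res ℓ (p + 1) = 0
  · rw [h0, if_pos rfl]
    rw [h0] at h
    have h1 : (((0 - 1 : Fin ℓ) : ℕ) : ℤ) + 1 = ℓ := by exact_mod_cast val_zero_sub_one (ℓ := ℓ)
    simp only [Fin.val_zero, Nat.cast_zero] at h
    obtain ⟨h2, h3⟩ := res_lev_unique (ℓ := ℓ) (p := p) (i := 0 - 1) (k := lev ℓ (p + 1) - 1)
      (by linarith)
    exact ⟨h2.symm, by omega⟩
  · rw [if_neg h0]
    have h1 : ((res ℓ (p + 1) - 1 : Fin ℓ) : ℤ) + 1 = res ℓ (p + 1) := by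
      exact_mod_cast val_sub_one_add_one h0
    obtain ⟨h2, h3⟩ := res_lev_unique (ℓ := ℓ) (p := p) (i := res ℓ (p + 1) - 1)
      (k := lev ℓ (p + 1)) (by linarith)
    exact ⟨h2.symm, by omega⟩

/-- The element `X_{i,j} ⊗ tᵐ` whose image in `a_∞` is the sum of the `Ē_{p+kℓ,q+kℓ}` over `k ∈ ℤ`. -/
def posUnit (ℓ : ℕ) [NeZero ℓ] (p q : ℤ) : AffineGl ℓ :=
  affineUnit (res ℓ p) (res ℓ q) (lev ℓ q - lev ℓ p)

lemma posUnit_add_one_right (p : ℤ) :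
    posUnit ℓ p (p + 1) = ((chevalleyE (res ℓ (p + 1)) : affineSl ℓ) : AffineGl ℓ) := by
  obtain ⟨h1, h2⟩ := res_lev_add_one (ℓ := ℓ) p
  rw [coe_chevalleyE, posUnit, h1, h2, add_sub_cancel_left]

lemma posUnit_add_one_left (p : ℤ) :
    posUnit ℓ (p + 1) p = ((chevalleyF (res ℓ (p + 1)) : affineSl ℓ) : AffineGl ℓ) := by
  obtain ⟨h1, h2⟩ := res_lev_add_one (ℓ := ℓ) p
  rw [coe_chevalleyF, posUnit, h1, h2]
  congr 1
  split_ifs <;> omega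

/-- By induction on `n`, the root vectors of height `±n` lie in every Lie subalgebra that contains the
Chevalley generators. -/
lemma posUnit_mem {K : LieSubalgebra ℂ (AffineGl ℓ)}
    (hE : ∀ i : Fin ℓ, ((chevalleyE i : affineSl ℓ) : AffineGl ℓ) ∈ K)
    (hF : ∀ i : Fin ℓ, ((chevalleyF i : affineSl ℓ) : AffineGl ℓ) ∈ K) (n : ℕ) (p : ℤ)
    (hres : res ℓ p ≠ res ℓ (p + n)) : posUnit ℓ p (p + n) ∈ K ∧ posUnit ℓ (p + n) p ∈ K := by
  induction n using Nat.strong_induction_on generalizing p with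
  | _ n ih =>
  match n with
  | 0 => simp at hres
  | 1 =>
    push_cast
    rw [posUnit_add_one_right, posUnit_add_one_left]
    exact ⟨hE _, hF _⟩
  | n + 2 =>
    have hq : p + ((n + 2 : ℕ) : ℤ) = p + (n + 1 : ℕ) + 1 := by push_cast; ring
    rw [hq] at hres ⊢
    have hs1 := posUnit_add_one_right (ℓ := ℓ) (p + (n + 1 : ℕ)) ▸ hE _
    have hs2 := posUnit_add_one_left (ℓ := ℓ) (p + (n + 1 : ℕ)) ▸ hF _
    by_cases hr : res ℓ p = res ℓ (p + (n + 1 : ℕ))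
    · -- removing the last simple root leaves an imaginary root; but then the first and the last
      -- simple root coincide, and the double bracket of `affineUnit_mem_of_triple` applies
      have hj : res ℓ (p + 1) = res ℓ (p + (n + 1 : ℕ) + 1) := by
        have h1 := (res_lev_add_one (ℓ := ℓ) p).1
        have h2 := (res_lev_add_one (ℓ := ℓ) (p + (n + 1 : ℕ))).1
        exact sub_left_injective (b := 1) (h1.trans (hr.trans h2.symm))
      have hm := ih n (by omega) (p + 1) (by
        have : p + 1 + (n : ℤ) = p + (n + 1 : ℕ) := by push_cast; ring
        rw [this, hj, ← hr]; exact hres.symm)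
      have e : p + 1 + (n : ℤ) = p + (n + 1 : ℕ) := by push_cast; ring
      rw [e] at hm
      have h1 := posUnit_add_one_right (ℓ := ℓ) p ▸ hE _
      have h2 := posUnit_add_one_left (ℓ := ℓ) p ▸ hF _
      simp only [posUnit, hj, ← hr] at hm hs1 hs2 h1 h2 ⊢
      constructor
      · convert affineUnit_mem_of_triple hres h1 hm.1 hs1 using 2; ring
      · convert affineUnit_mem_of_triple hres.symm hs2 hm.2 h2 using 2; ring
    · have h := ih (n + 1) (by omega) p hr
      simp only [posUnit] at h hs1 hs2 ⊢
      constructor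
      · convert affineUnit_mem_of_chain hres h.1 hs1 using 2; ring
      · convert affineUnit_mem_of_chain hres.symm hs2 h.2 using 2; ring

lemma affineUnit_mem {K : LieSubalgebra ℂ (AffineGl ℓ)}
    (hE : ∀ i : Fin ℓ, ((chevalleyE i : affineSl ℓ) : AffineGl ℓ) ∈ K)
    (hF : ∀ i : Fin ℓ, ((chevalleyF i : affineSl ℓ) : AffineGl ℓ) ∈ K) {i j : Fin ℓ} (hij : i ≠ j)
    (m : ℤ) : affineUnit i j m ∈ K := by
  obtain ⟨r1, l1⟩ := res_lev_unique (ℓ := ℓ) (p := (posEquiv ℓ).symm (i, 0)) (i := i) (k := 0) rfl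
  obtain ⟨r2, l2⟩ := res_lev_unique (ℓ := ℓ) (p := (posEquiv ℓ).symm (j, m)) (i := j) (k := m) rfl
  set p := (posEquiv ℓ).symm (i, 0)
  set q := (posEquiv ℓ).symm (j, m)
  have h : affineUnit i j m = posUnit ℓ p q := by rw [posUnit, r1, l1, r2, l2, sub_zero]
  rw [h]
  rw [← r1, ← r2] at hij
  rcases le_total p q with hpq | hpq
  · obtain ⟨n, hn⟩ := Int.le.dest hpq
    rw [← hn] at hij ⊢
    exact (posUnit_mem hE hF n p hij).1
  · obtain ⟨n, hn⟩ := Int.le.dest hpq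
    rw [← hn] at hij ⊢
    exact (posUnit_mem hE hF n q hij.symm).2

/-- The elements of `AffineGl ℓ` without `c` and `d` components. -/
def matIncl (ℓ : ℕ) : Matrix (Fin ℓ) (Fin ℓ) ℂ[T;T⁻¹] →ₗ[ℂ] AffineGl ℓ where
  toFun X := ⟨X, 0, 0⟩
  map_add' _ _ := AffineGl.ext rfl (add_zero _).symm (add_zero _).symm
  map_smul' _ _ := AffineGl.ext rfl (mul_zero _).symm (mul_zero _).symm

/-- The Chevalley generators generate the derived affine Lie algebra. -/
lemma mem_of_chevalley_mem {K : LieSubalgebra ℂ (AffineGl ℓ)}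
    (hE : ∀ i : Fin ℓ, ((chevalleyE i : affineSl ℓ) : AffineGl ℓ) ∈ K)
    (hF : ∀ i : Fin ℓ, ((chevalleyF i : affineSl ℓ) : AffineGl ℓ) ∈ K) {x : AffineGl ℓ}
    (hx : x.mat.trace = 0) (hd : x.d = 0) : x ∈ K := by
  have hcoroot : ∀ {i j : Fin ℓ}, i ≠ j → ∀ m n : ℤ,
      (⟨Matrix.single i i (.T (m + n)) - Matrix.single j j (.T (m + n)), if m + n = 0 then m else 0,
        0⟩ : AffineGl ℓ) ∈ K := fun {i j} hij m n => by
    have := K.lie_mem (affineUnit_mem hE hF hij m) (affineUnit_mem hE hF hij.symm n)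
    rw [affineUnit_lie] at this
    simpa using this
  -- the coroots of `α + δ` and `α` differ by `c`
  have hc : (⟨0, 1, 0⟩ : AffineGl ℓ) ∈ K := by
    have h := K.sub_mem (hcoroot (fin_sub_one_ne (0 : Fin ℓ)) 1 (-1))
      (hcoroot (fin_sub_one_ne (0 : Fin ℓ)) 0 0)
    rw [affineGl_mk_sub] at h
    simpa using h
  have hdiag : ∀ (i j : Fin ℓ) (f : ℂ[T;T⁻¹]),
      Matrix.single i i f - Matrix.single j j f ∈ K.toSubmodule.comap (matIncl ℓ) := by
    intro i j f
    by_cases hij : i = j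
    · subst hij; rw [sub_self]; exact zero_mem _
    induction f using AddMonoidAlgebra.induction_linear with
    | zero => simp
    | add f g hf hg =>
      rw [Matrix.single_add, Matrix.single_add, add_sub_add_comm]
      exact add_mem hf hg
    | single m a =>
      rw [laurent_single_eq_smul_T, ← Matrix.smul_single, ← Matrix.smul_single, ← smul_sub]
      refine Submodule.smul_mem _ _ ?_
      have h2 := hcoroot hij 0 m
      simp only [zero_add, Int.cast_zero, ite_self] at h2
      exact h2
  have hoff : ∀ (i j : Fin ℓ) (f : ℂ[T;T⁻¹]), i ≠ j →
      Matrix.single i j f ∈ K.toSubmodule.comap (matIncl ℓ) := by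
    intro i j f hij
    induction f using AddMonoidAlgebra.induction_linear with
    | zero => simp
    | add f g hf hg => rw [Matrix.single_add]; exact add_mem hf hg
    | single m a =>
      rw [laurent_single_eq_smul_T, ← Matrix.smul_single]
      exact Submodule.smul_mem _ _ (affineUnit_mem hE hF hij m)
  have hmat : x.mat ∈ K.toSubmodule.comap (matIncl ℓ) := by
    -- what is subtracted adds up to the trace, placed in the corner
    have h : x.mat = ∑ i, ∑ j, (Matrix.single i j (x.mat i j) -
        if i = j then Matrix.single 0 0 (x.mat i j) else 0) := by
      simp only [Finset.sum_sub_distrib, Finset.sum_ite_eq, Finset.mem_univ, if_true]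
      rw [← Matrix.matrix_eq_sum_single, eq_comm, sub_eq_self]
      have : ∑ i, Matrix.single (0 : Fin ℓ) (0 : Fin ℓ) (x.mat i i) =
          Matrix.singleAddMonoidHom 0 0 x.mat.trace := by
        rw [Matrix.trace, map_sum]; rfl
      rw [this, hx, map_zero]
    rw [h]
    refine sum_mem fun i _ => sum_mem fun j _ => ?_
    split_ifs with hij
    · subst hij; exact hdiag _ _ _
    · rw [sub_zero]; exact hoff _ _ _ hij
  have e : x = matIncl ℓ x.mat + x.c • ⟨0, 1, 0⟩ := by
    ext1
    · change x.mat = x.mat + x.c • 0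
      simp
    · change x.c = 0 + x.c * 1
      ring
    · change x.d = 0 + x.c * 0
      rw [hd]; ring
  rw [e]
  exact K.add_mem hmat (K.smul_mem _ hc)

lemma lieSubalgebra_eq_top {K : LieSubalgebra ℂ (affineSl' ℓ)} (hE : ∀ i, chevalleyE i ∈ K)
    (hF : ∀ i, chevalleyF i ∈ K) : K = ⊤ := by
  refine eq_top_iff.2 fun x _ => ?_
  let f : affineSl' ℓ →ₗ⁅ℂ⁆ AffineGl ℓ := (affineSl ℓ).incl.comp (affineSl' ℓ).incl
  have hx : f x ∈ K.map f := mem_of_chevalley_mem (fun i => (LieSubalgebra.mem_map ..).2 ⟨_, hE i, rfl⟩)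
    (fun i => (LieSubalgebra.mem_map ..).2 ⟨_, hF i, rfl⟩) x.1.2 x.2
  obtain ⟨y, hy, hyx⟩ := hx
  have : y = x := Subtype.ext (Subtype.ext hyx)
  exact this ▸ hy

/-! ### The Cartan subalgebra -/

/-- The element of the Cartan subalgebra `h ⊂ ŝl_ℓ` given by a traceless diagonal matrix. -/
def cartanSl (y : Fin ℓ → ℂ) (hy : ∑ i, y i = 0) (c d : ℂ) : affineSl ℓ :=
  ⟨cartan y c d, by
    change (cartan y c d).mat.trace = 0
    simp only [cartan, Matrix.trace_diagonal]
    rw [← map_sum, hy, map_zero]⟩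

/-- The linear parametrisation of the Cartan subalgebra. -/
def cartanLin (ℓ : ℕ) : ((Fin ℓ → ℂ) × ℂ × ℂ) →ₗ[ℂ] AffineGl ℓ where
  toFun z := cartan z.1 z.2.1 z.2.2
  map_add' z w := by
    refine AffineGl.ext ?_ rfl rfl
    change Matrix.diagonal _ = Matrix.diagonal _ + Matrix.diagonal _
    rw [Matrix.diagonal_add]
    simp
  map_smul' r z := by
    refine AffineGl.ext ?_ rfl rfl
    change Matrix.diagonal _ = r • Matrix.diagonal _
    rw [← Matrix.diagonal_smul]
    congr 1
    funext i
    simp [LaurentPolynomial.smul_eq_C_mul]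

/-- The coroots `H_i` and `d` span the Cartan subalgebra. -/
lemma cartanSl_mem {S : Submodule ℂ (affineSl ℓ)}
    (hH : ∀ i : Fin ℓ, (chevalleyH i : affineSl ℓ) ∈ S) (hd : affineD ℓ ∈ S) (y : Fin ℓ → ℂ)
    (hy : ∑ i, y i = 0) (c d : ℂ) : cartanSl y hy c d ∈ S := by
  set R : Submodule ℂ ((Fin ℓ → ℂ) × ℂ × ℂ) :=
    (S.map (affineSl ℓ).toSubmodule.subtype).comap (cartanLin ℓ) with hR
  have hH' : ∀ i : Fin ℓ, ((Pi.single (i - 1) 1 - Pi.single i 1, if i = 0 then 1 else 0, 0) :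
      (Fin ℓ → ℂ) × ℂ × ℂ) ∈ R := fun i => by
    exact ⟨_, hH i, coe_chevalleyH i⟩
  have hd' : ((0, 0, 1) : (Fin ℓ → ℂ) × ℂ × ℂ) ∈ R := by
    refine ⟨_, hd, AffineGl.ext ?_ rfl rfl⟩
    change (0 : Matrix (Fin ℓ) (Fin ℓ) ℂ[T;T⁻¹]) = Matrix.diagonal fun _ => .C 0
    simp
  -- `c` is the sum of the `H_i`
  have hc' : ((0, 1, 0) : (Fin ℓ → ℂ) × ℂ × ℂ) ∈ R := by
    have h := R.sum_mem (t := Finset.univ) fun i _ => hH' i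
    convert h using 1
    refine Prod.ext ?_ (Prod.ext ?_ ?_)
    · rw [Prod.fst_sum]
      simp only [Finset.sum_sub_distrib]
      rw [eq_comm, sub_eq_zero]
      exact (Equiv.subRight (1 : Fin ℓ)).sum_comp fun i => (Pi.single i 1 : Fin ℓ → ℂ)
    · simp [Prod.snd_sum, Prod.fst_sum]
    · simp [Prod.snd_sum]
  have hX : ∀ (r : ℕ) (hr : r < ℓ), ((Pi.single 0 1 - Pi.single ⟨r, hr⟩ 1, 0, 0) :
      (Fin ℓ → ℂ) × ℂ × ℂ) ∈ R := by
    intro r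
    induction r with
    | zero =>
      intro hr
      have : (⟨0, hr⟩ : Fin ℓ) = 0 := rfl
      rw [this, sub_self]; exact zero_mem _
    | succ r ih =>
      intro hr
      have h0 : (⟨r + 1, hr⟩ : Fin ℓ) ≠ 0 := fun h => by simpa using congrArg Fin.val h
      have h1 : (⟨r + 1, hr⟩ : Fin ℓ) - 1 = ⟨r, by omega⟩ := by
        ext; have := val_sub_one_add_one h0; simpa using this
      have h := R.add_mem (ih (by omega)) (hH' ⟨r + 1, hr⟩)
      rw [h1, if_neg h0] at h
      simpa using h
  have hmem : (y, c, d) ∈ R := by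
    have h : (y, c, d) = (-∑ i, y i • ((Pi.single 0 1 - Pi.single i 1, 0, 0) :
        (Fin ℓ → ℂ) × ℂ × ℂ)) + c • ((0, 1, 0) : (Fin ℓ → ℂ) × ℂ × ℂ) +
        d • ((0, 0, 1) : (Fin ℓ → ℂ) × ℂ × ℂ) := by
      refine Prod.ext ?_ (Prod.ext ?_ ?_)
      · simp only [Prod.fst_add, Prod.fst_neg, Prod.fst_sum, Prod.smul_fst, smul_zero, add_zero,
          smul_sub, Finset.sum_sub_distrib, ← Finset.sum_smul, hy, zero_smul, zero_sub, neg_neg]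
        funext j
        simp [Pi.single_apply]
      · simp [Prod.snd_sum]
      · simp [Prod.snd_sum]
    rw [h]
    exact R.add_mem (R.add_mem (R.neg_mem (R.sum_mem fun i _ => R.smul_mem _ (hX i i.2)))
      (R.smul_mem _ hc')) (R.smul_mem _ hd')
  obtain ⟨z, hz, hzz⟩ := hmem
  have : z = cartanSl y hy c d := Subtype.ext hzz
  exact this ▸ hz

/-- The element of the Cartan subalgebra at which all simple roots take the value `1`. Its bracket with
each `F_i` is `-F_i`, so it measures the depth below a highest weight. The constant `(ℓ - 1)/2` makes
the diagonal matrix traceless. -/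
def principalD (ℓ : ℕ) [ℓ.AtLeastTwo] : affineSl ℓ :=
  cartanSl (fun i => ((ℓ : ℂ) - 1) / 2 - i) (by
    rw [Finset.sum_sub_distrib, Finset.sum_const, Finset.card_univ, Fintype.card_fin, nsmul_eq_mul,
      Fin.sum_univ_eq_sum_range (fun i => (i : ℂ)) ℓ, ← Nat.cast_sum, Finset.sum_range_id]
    have h : ((ℓ * (ℓ - 1) / 2 : ℕ) : ℂ) = ℓ * (ℓ - 1) / 2 := by
      rw [Nat.cast_div (Nat.even_mul_pred_self ℓ).two_dvd two_ne_zero, Nat.cast_mul,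
        Nat.cast_pred (NeZero.pos ℓ)]
      simp
    rw [h]; ring) 0 ℓ

lemma principalD_lie_chevalleyF (i : Fin ℓ) :
    ⁅principalD ℓ, (chevalleyF i : affineSl ℓ)⁆ = -(chevalleyF i : affineSl ℓ) := by
  refine Subtype.ext ?_
  change ⁅cartan _ _ _, ((chevalleyF i : affineSl ℓ) : AffineGl ℓ)⁆ =
    -((chevalleyF i : affineSl ℓ) : AffineGl ℓ)
  rw [coe_chevalleyF, cartan_lie_affineUnit]
  refine Eq.trans (congrArg (· • _) ?_) (neg_one_smul ℂ _)
  by_cases hi : i = 0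
  · subst hi
    have h : (((0 - 1 : Fin ℓ) : ℕ) : ℂ) = ℓ - 1 := by
      rw [eq_sub_iff_add_eq]; exact_mod_cast val_zero_sub_one (ℓ := ℓ)
    simp only [h, if_true, Fin.val_zero]
    push_cast; ring
  · have h : (((i - 1 : Fin ℓ) : ℕ) : ℂ) = (i : ℕ) - 1 := by
      rw [eq_sub_iff_add_eq]; exact_mod_cast val_sub_one_add_one hi
    simp only [h, if_neg hi]
    push_cast; ring

end Chevalley

/-! ### Highest weight vectors -/

section Words

variable {ℓ : ℕ} {V : Type*} [AddCommGroup V] [Module ℂ V] {π : affineSl' ℓ →ₗ⁅ℂ⁆ Module.End ℂ V}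

lemma lie_apply_apply (x y : affineSl' ℓ) (v : V) : π x (π y v) = π ⁅x, y⁆ v + π y (π x v) := by
  rw [LieHom.map_lie, LieRing.of_associative_ring_bracket]
  simp

variable [ℓ.AtLeastTwo]

/-- The vector `F_{i₁} F_{i₂} ⋯ w` given by a list of indices. -/
def fWord (π : affineSl' ℓ →ₗ⁅ℂ⁆ Module.End ℂ V) (w : V) : List (Fin ℓ) → V
  | [] => w
  | i :: l => π (chevalleyF i) (fWord π w l)

/-- The span of the vectors `F_{i₁} F_{i₂} ⋯ w`. -/
def wordSpan (π : affineSl' ℓ →ₗ⁅ℂ⁆ Module.End ℂ V) (w : V) : Submodule ℂ V :=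
  Submodule.span ℂ (Set.range (fWord π w))

/-- `w` is killed by the `E_i` and is an eigenvector of the `H_i`, with eigenvalues `lam i`. -/
def IsHighestWeight (π : affineSl' ℓ →ₗ⁅ℂ⁆ Module.End ℂ V) (lam : Fin ℓ → ℂ) (w : V) : Prop :=
  (∀ i, π (chevalleyE i) w = 0) ∧ ∀ i, π (chevalleyH i) w = lam i • w

variable {lam : Fin ℓ → ℂ} {w : V}

lemma fWord_mem (l : List (Fin ℓ)) : fWord π w l ∈ wordSpan π w := Submodule.subset_span ⟨l, rfl⟩

lemma self_mem_wordSpan : w ∈ wordSpan π w := fWord_mem (w := w) []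

lemma map_mem_wordSpan {f : Module.End ℂ V} {N : Submodule ℂ V} (h : ∀ l, f (fWord π w l) ∈ N)
    {x : V} (hx : x ∈ wordSpan π w) : f x ∈ N := by
  have : wordSpan π w ≤ N.comap f := by
    refine Submodule.span_le.2 ?_
    rintro _ ⟨l, rfl⟩
    exact h l
  exact this hx

lemma exists_chevalleyH_fWord (hw : IsHighestWeight π lam w) (i : Fin ℓ) (l : List (Fin ℓ)) :
    ∃ a : ℂ, π (chevalleyH i) (fWord π w l) = a • fWord π w l := by
  induction l with
  | nil => exact ⟨_, hw.2 i⟩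
  | cons j l ih =>
    obtain ⟨a, ha⟩ := ih
    obtain ⟨b, hb⟩ := exists_chevalleyH_lie_chevalleyF i j
    refine ⟨b + a, ?_⟩
    rw [fWord, lie_apply_apply, hb, ha, map_smul, map_smul, LinearMap.smul_apply, add_smul]

lemma chevalleyE_fWord_mem (hw : IsHighestWeight π lam w) (i : Fin ℓ) (l : List (Fin ℓ)) :
    π (chevalleyE i) (fWord π w l) ∈ wordSpan π w := by
  induction l with
  | nil => rw [fWord, hw.1 i]; exact zero_mem _
  | cons j l ih =>
    rw [fWord, lie_apply_apply]
    refine add_mem ?_ (map_mem_wordSpan (fun l' => fWord_mem (j :: l')) ih)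
    by_cases hij : i = j
    · subst hij
      obtain ⟨a, ha⟩ := exists_chevalleyH_fWord hw i l
      change π (chevalleyH i) _ ∈ _
      rw [ha]
      exact Submodule.smul_mem _ _ (fWord_mem l)
    · rw [chevalleyE_lie_chevalleyF hij, map_zero]; exact zero_mem _

lemma isSubrep_of_chevalley {N : Submodule ℂ V} (hE : ∀ i, ∀ v ∈ N, π (chevalleyE i) v ∈ N)
    (hF : ∀ i, ∀ v ∈ N, π (chevalleyF i) v ∈ N) : IsSubrep π N := by
  let K : LieSubalgebra ℂ (affineSl' ℓ) :=
    { carrier := {x | ∀ v ∈ N, π x v ∈ N}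
      zero_mem' := fun v _ => by simp
      add_mem' := fun {x y} hx hy v hv => by
        rw [map_add, LinearMap.add_apply]; exact add_mem (hx v hv) (hy v hv)
      smul_mem' := fun r x hx v hv => by
        rw [map_smul, LinearMap.smul_apply]; exact N.smul_mem _ (hx v hv)
      lie_mem' := fun {x y} hx hy v hv => by
        rw [LieHom.map_lie, LieRing.of_associative_ring_bracket, LinearMap.sub_apply]
        exact sub_mem (hx _ (hy v hv)) (hy _ (hx v hv)) }
  have hK : K = ⊤ := lieSubalgebra_eq_top hE hF
  intro x
  have hx : x ∈ K := hK ▸ LieSubalgebra.mem_top x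
  exact hx

/-- The words in the `F_i` applied to a highest weight vector span a subrepresentation. -/
lemma isSubrep_wordSpan (hw : IsHighestWeight π lam w) : IsSubrep π (wordSpan π w) :=
  isSubrep_of_chevalley (fun i _ hv => map_mem_wordSpan (chevalleyE_fWord_mem hw i) hv)
    (fun i _ hv => map_mem_wordSpan (fun l => fWord_mem (i :: l)) hv)

lemma wordSpan_le {N : Submodule ℂ V} (hN : IsSubrep π N) (hw : w ∈ N) : wordSpan π w ≤ N := by
  refine Submodule.span_le.2 ?_
  rintro _ ⟨l, rfl⟩
  induction l with
  | nil => exact hw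
  | cons i l ih => exact hN _ _ ih

end Words

/-! ### The irreducible quotient of a Verma module -/

section Verma

variable {ℓ : ℕ}

lemma toU_lie (x y : affineSl ℓ) : toU ⁅x, y⁆ = toU x * toU y - toU y * toU x := by
  rw [toU, LieHom.map_lie]; rfl

lemma subalgebra_eq_top {A : Subalgebra ℂ (UAffine ℓ)} (h : ∀ x, toU x ∈ A) : A = ⊤ := by
  let f : affineSl ℓ →ₗ⁅ℂ⁆ A :=
    { toFun := fun x => ⟨toU x, h x⟩
      map_add' := fun x y => Subtype.ext (map_add (UniversalEnvelopingAlgebra.ι ℂ) x y)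
      map_smul' := fun r x => Subtype.ext (map_smul (UniversalEnvelopingAlgebra.ι ℂ) r x)
      map_lie' := fun {x y} => Subtype.ext (toU_lie x y) }
  have hid : A.val.comp (UniversalEnvelopingAlgebra.lift ℂ f) = AlgHom.id ℂ (UAffine ℓ) := by
    refine UniversalEnvelopingAlgebra.hom_ext ℂ ?_
    ext x
    change ((UniversalEnvelopingAlgebra.lift ℂ f (UniversalEnvelopingAlgebra.ι ℂ x) : A) :
      UAffine ℓ) = UniversalEnvelopingAlgebra.ι ℂ x
    rw [UniversalEnvelopingAlgebra.lift_ι_apply]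
    rfl
  refine eq_top_iff.2 fun u _ => ?_
  have := AlgHom.congr_fun hid u
  change ((UniversalEnvelopingAlgebra.lift ℂ f u : A) : UAffine ℓ) = u at this
  rw [← this]
  exact Subtype.prop _

variable {M : Type*} [AddCommGroup M] [Module ℂ M] [Module (UAffine ℓ) M]
  [IsScalarTower ℂ (UAffine ℓ) M]

lemma smul_mem_of_toU {N : Submodule ℂ M} (h : ∀ x : affineSl ℓ, ∀ v ∈ N, toU x • v ∈ N)
    (u : UAffine ℓ) {v : M} (hv : v ∈ N) : u • v ∈ N := by
  let A : Subalgebra ℂ (UAffine ℓ) :=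
    { carrier := {u | ∀ v ∈ N, u • v ∈ N}
      mul_mem' := fun {a b} ha hb v hv => by rw [mul_smul]; exact ha _ (hb v hv)
      add_mem' := fun {a b} ha hb v hv => by rw [add_smul]; exact add_mem (ha v hv) (hb v hv)
      algebraMap_mem' := fun r v hv => by rw [algebraMap_smul]; exact N.smul_mem r hv }
  have hA : A = ⊤ := subalgebra_eq_top h
  have hu : u ∈ A := hA ▸ Algebra.mem_top
  exact hu v hv

variable [ℓ.AtLeastTwo]

/-- The representation of `ŝl_ℓ'` on a module over the enveloping algebra of `ŝl_ℓ`. -/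
def derivedRep (ℓ : ℕ) [ℓ.AtLeastTwo] (M : Type*) [AddCommGroup M] [Module ℂ M]
    [Module (UAffine ℓ) M] [IsScalarTower ℂ (UAffine ℓ) M] : affineSl' ℓ →ₗ⁅ℂ⁆ Module.End ℂ M :=
  ((Algebra.lsmul ℂ ℂ M : UAffine ℓ →ₐ[ℂ] Module.End ℂ M).toLieHom.comp
    (UniversalEnvelopingAlgebra.ι ℂ)).comp (affineSl' ℓ).incl

lemma derivedRep_apply (x : affineSl' ℓ) (v : M) :
    derivedRep ℓ M x v = toU (x : affineSl ℓ) • v := rfl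

/-- A subspace is a submodule over the enveloping algebra of `ŝl_ℓ` as soon as the derived algebra and
`d` preserve it. -/
lemma smul_mem_of_isSubrep {N : Submodule ℂ M} (h : IsSubrep (derivedRep ℓ M) N)
    (hd : ∀ v ∈ N, toU (affineD ℓ) • v ∈ N) (u : UAffine ℓ) {v : M} (hv : v ∈ N) : u • v ∈ N := by
  refine smul_mem_of_toU (fun x v hv => ?_) u hv
  have hx : x - x.1.d • affineD ℓ ∈ affineSl' ℓ := by
    change x.1.d - x.1.d * 1 = 0
    ring
  have e : toU x = toU (((⟨_, hx⟩ : affineSl' ℓ) : affineSl ℓ)) + x.1.d • toU (affineD ℓ) := by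
    change UniversalEnvelopingAlgebra.ι ℂ x = UniversalEnvelopingAlgebra.ι ℂ _ +
      x.1.d • UniversalEnvelopingAlgebra.ι ℂ _
    rw [← map_smul, ← map_add, sub_add_cancel]
  rw [e, add_smul, smul_assoc]
  exact add_mem (h ⟨_, hx⟩ v hv) (N.smul_mem _ (hd v hv))

/-- `w` is a highest weight vector, also for `d`. -/
def IsHighestWeightD (lam : Fin ℓ → ℂ) (lamD : ℂ) (w : M) : Prop :=
  IsHighestWeight (derivedRep ℓ M) lam w ∧ toU (affineD ℓ) • w = lamD • w

variable {lam : Fin ℓ → ℂ} {lamD : ℂ} {w : M}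

/-- A highest weight vector is an eigenvector of `principalD ℓ`, as it is one of the `H_i` and of `d`. -/
lemma IsHighestWeightD.exists_principalD (hw : IsHighestWeightD lam lamD w) :
    ∃ κ : ℂ, toU (principalD ℓ) • w = κ • w := by
  let S : Submodule ℂ (affineSl ℓ) :=
    { carrier := {x | ∃ κ : ℂ, toU x • w = κ • w}
      zero_mem' := ⟨0, by
        change UniversalEnvelopingAlgebra.ι ℂ 0 • w = _
        rw [map_zero, zero_smul, zero_smul]⟩
      add_mem' := by
        rintro x y ⟨a, ha⟩ ⟨b, hb⟩
        refine ⟨a + b, ?_⟩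
        change UniversalEnvelopingAlgebra.ι ℂ (x + y) • w = _
        rw [map_add, add_smul, add_smul, ← ha, ← hb]; rfl
      smul_mem' := by
        rintro r x ⟨a, ha⟩
        refine ⟨r * a, ?_⟩
        change UniversalEnvelopingAlgebra.ι ℂ (r • x) • w = _
        rw [map_smul, smul_assoc, mul_smul, ← ha]; rfl }
  exact cartanSl_mem (S := S) (fun i => ⟨_, hw.1.2 i⟩) ⟨_, hw.2⟩ _ _ _ _

lemma principalD_smul_fWord {κ : ℂ} (hκ : toU (principalD ℓ) • w = κ • w) (l : List (Fin ℓ)) :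
    toU (principalD ℓ) • fWord (derivedRep ℓ M) w l =
      (κ - l.length) • fWord (derivedRep ℓ M) w l := by
  induction l with
  | nil => simpa [fWord] using hκ
  | cons i l ih =>
    have h : toU (principalD ℓ) * toU (chevalleyF i : affineSl ℓ) =
        toU (chevalleyF i : affineSl ℓ) * toU (principalD ℓ) - toU (chevalleyF i : affineSl ℓ) := by
      have h1 := toU_lie (principalD ℓ) (chevalleyF i : affineSl ℓ)
      rw [principalD_lie_chevalleyF] at h1
      have h2 : toU (-(chevalleyF i : affineSl ℓ)) = - toU (chevalleyF i : affineSl ℓ) :=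
        map_neg (UniversalEnvelopingAlgebra.ι ℂ) _
      rw [h2] at h1
      rw [sub_eq_add_neg, h1]; abel
    rw [fWord, derivedRep_apply, ← mul_smul, h, sub_smul, mul_smul, ih,
      smul_comm (toU (chevalleyF i : affineSl ℓ)) (κ - (l.length : ℂ)), List.length_cons,
      Nat.cast_succ, ← sub_sub, sub_smul _ (1 : ℂ), one_smul]

lemma d_smul_fWord_mem (hw : IsHighestWeightD lam lamD w) (l : List (Fin ℓ)) :
    toU (affineD ℓ) • fWord (derivedRep ℓ M) w l ∈ wordSpan (derivedRep ℓ M) w := by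
  induction l with
  | nil => rw [fWord, hw.2]; exact Submodule.smul_mem _ _ self_mem_wordSpan
  | cons i l ih =>
    have h1 := toU_lie (affineD ℓ) (chevalleyF i : affineSl ℓ)
    -- `[d, F_i]` again lies in the derived algebra
    have h2 : ⁅affineD ℓ, (chevalleyF i : affineSl ℓ)⁆ ∈ affineSl' ℓ := rfl
    rw [fWord, derivedRep_apply, ← mul_smul, eq_add_of_sub_eq h1.symm, add_smul, mul_smul]
    exact add_mem (isSubrep_wordSpan hw.1 ⟨_, h2⟩ _ (fWord_mem l))
      (isSubrep_wordSpan hw.1 (chevalleyF i) _ ih)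

lemma smul_mem_wordSpan (hw : IsHighestWeightD lam lamD w) (u : UAffine ℓ) {v : M}
    (hv : v ∈ wordSpan (derivedRep ℓ M) w) : u • v ∈ wordSpan (derivedRep ℓ M) w :=
  smul_mem_of_isSubrep (isSubrep_wordSpan hw.1) (fun _ hv =>
    map_mem_wordSpan (f := Algebra.lsmul ℂ ℂ M (toU (affineD ℓ))) (d_smul_fWord_mem hw) hv) u hv

/-- The product of the operators `D - κ + n` over `1 ≤ n ≤ m`. It kills the weights at depths
`1, …, m` below a highest weight at which `D` takes the value `κ`. -/
def depthKill (ℓ : ℕ) [ℓ.AtLeastTwo] (κ : ℂ) : ℕ → UAffine ℓ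
  | 0 => 1
  | m + 1 => (toU (principalD ℓ) - algebraMap ℂ _ (κ - (m + 1))) * depthKill ℓ κ m

lemma depthKill_smul {κ : ℂ} {n : ℕ} {x : M} (hx : toU (principalD ℓ) • x = (κ - n) • x) (m : ℕ) :
    depthKill ℓ κ m • x = (∏ k ∈ Finset.range m, ((k : ℂ) + 1 - n)) • x := by
  induction m with
  | zero => simp [depthKill]
  | succ m ih =>
    rw [depthKill, mul_smul, ih, smul_comm, sub_smul, hx, algebraMap_smul, ← sub_smul, smul_smul,
      Finset.prod_range_succ]
    congr 2
    ring

lemma depthKill_smul_fWord {κ : ℂ} (hκ : toU (principalD ℓ) • w = κ • w) {l : List (Fin ℓ)} {m : ℕ}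
    (hl : l ≠ []) (hm : l.length ≤ m) : depthKill ℓ κ m • fWord (derivedRep ℓ M) w l = 0 := by
  rw [depthKill_smul (principalD_smul_fWord hκ l), Finset.prod_eq_zero (i := l.length - 1), zero_smul]
  · have := List.length_pos_iff.2 hl
    rw [Finset.mem_range]; omega
  · have h1 := List.length_pos_iff.2 hl
    rw [Nat.cast_sub (by omega)]; simp

lemma depthKill_smul_self {κ : ℂ} (hκ : toU (principalD ℓ) • w = κ • w) (m : ℕ) :
    depthKill ℓ κ m • w = (m.factorial : ℂ) • w := by
  rw [depthKill_smul (n := 0) (by simpa using hκ)]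
  congr 1
  rw [← Finset.prod_range_add_one_eq_factorial]
  push_cast
  simp

lemma exists_depthKill_smul {κ : ℂ} (hκ : toU (principalD ℓ) • w = κ • w) {x : M}
    (hx : x ∈ wordSpan (derivedRep ℓ M) w) : ∃ m : ℕ, ∃ c : ℂ, depthKill ℓ κ m • x = c • w := by
  suffices h : ∃ m₀ : ℕ, ∀ m ≥ m₀, ∃ c : ℂ, depthKill ℓ κ m • x = c • w by
    obtain ⟨m, hm⟩ := h
    exact ⟨m, hm m le_rfl⟩
  induction hx using Submodule.span_induction with
  | mem x hx =>
    obtain ⟨l, rfl⟩ := hx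
    refine ⟨l.length, fun m hm => ?_⟩
    by_cases hl : l = []
    · subst hl; exact ⟨_, depthKill_smul_self hκ m⟩
    · exact ⟨0, by rw [depthKill_smul_fWord hκ hl hm, zero_smul]⟩
  | zero => exact ⟨0, fun m _ => ⟨0, by simp⟩⟩
  | add x y _ _ hx hy =>
    obtain ⟨a, ha⟩ := hx
    obtain ⟨b, hb⟩ := hy
    refine ⟨max a b, fun m hm => ?_⟩
    obtain ⟨c, hc⟩ := ha m (le_of_max_le_left hm)
    obtain ⟨c', hc'⟩ := hb m (le_of_max_le_right hm)
    exact ⟨c + c', by rw [smul_add, hc, hc', add_smul]⟩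
  | smul r x _ hx =>
    obtain ⟨a, ha⟩ := hx
    refine ⟨a, fun m hm => ?_⟩
    obtain ⟨c, hc⟩ := ha m hm
    exact ⟨r * c, by rw [smul_comm, hc, mul_smul]⟩

/-- The highest weight vector of the Verma module. -/
def vermaVec (lam : Fin ℓ → ℂ) (lamD : ℂ) : Verma lam lamD := Submodule.Quotient.mk 1

lemma smul_vermaVec (u : UAffine ℓ) :
    u • vermaVec lam lamD = Submodule.Quotient.mk (p := vermaIdeal lam lamD) u := by
  rw [vermaVec, ← Submodule.Quotient.mk_smul, smul_eq_mul, mul_one]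

lemma isHighestWeightD_vermaVec : IsHighestWeightD lam lamD (vermaVec lam lamD) := by
  have h : ∀ u ∈ vermaIdeal lam lamD, u • vermaVec lam lamD = 0 := fun u hu => by
    rw [smul_vermaVec, (Submodule.Quotient.mk_eq_zero _).2 hu]
  have h' : ∀ (u : UAffine ℓ) (a : ℂ), u - algebraMap ℂ _ a ∈ vermaIdeal lam lamD →
      u • vermaVec lam lamD = a • vermaVec lam lamD := fun u a hu => by
    have := h _ hu
    rwa [sub_smul, algebraMap_smul, sub_eq_zero] at this
  refine ⟨⟨fun i => h _ (Submodule.subset_span (Or.inl (Or.inl ⟨i, rfl⟩))), fun i => h' _ _ ?_⟩,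
    h' _ _ ?_⟩
  · exact Submodule.subset_span (Or.inl (Or.inr ⟨i, rfl⟩))
  · exact Submodule.subset_span (Or.inr rfl)

lemma wordSpan_vermaVec : wordSpan (derivedRep ℓ (Verma lam lamD)) (vermaVec lam lamD) = ⊤ := by
  refine eq_top_iff.2 fun x _ => ?_
  obtain ⟨u, rfl⟩ := Submodule.Quotient.mk_surjective _ x
  rw [← smul_vermaVec]
  exact smul_mem_wordSpan isHighestWeightD_vermaVec u self_mem_wordSpan

/-- The highest weight vector of the irreducible highest weight representation. -/
def highestVec (lam : Fin ℓ → ℂ) (lamD : ℂ) : HighestWeightModule lam lamD :=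
  Submodule.Quotient.mk (vermaVec lam lamD)

/-- A module generated by a highest weight vector in such a way that the vector can be recovered
from every non-zero element is the irreducible highest weight representation. -/
lemma exists_highestWeightModule_embedding (hw : IsHighestWeightD lam lamD w) (hw0 : w ≠ 0)
    (hirr : ∀ u : UAffine ℓ, u • w ≠ 0 → ∃ u' : UAffine ℓ, u' • u • w = w) :
    ∃ g : HighestWeightModule lam lamD →ₗ[UAffine ℓ] M,
      Function.Injective g ∧ g (highestVec lam lamD) = w := by
  have hker : vermaIdeal lam lamD ≤ LinearMap.ker (LinearMap.toSpanSingleton (UAffine ℓ) M w) := by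
    refine Submodule.span_le.2 ?_
    rintro u ((⟨i, rfl⟩ | ⟨i, rfl⟩) | rfl)
    · exact hw.1.1 i
    · change (_ - _ : UAffine ℓ) • w = 0
      rw [sub_smul, algebraMap_smul, sub_eq_zero]
      exact hw.1.2 i
    · change (_ - _ : UAffine ℓ) • w = 0
      rw [sub_smul, algebraMap_smul, sub_eq_zero]
      exact hw.2
  set g₀ : Verma lam lamD →ₗ[UAffine ℓ] M := (vermaIdeal lam lamD).liftQ _ hker with hg₀
  have hg₀w : g₀ (vermaVec lam lamD) = w := by
    rw [hg₀, vermaVec, Submodule.liftQ_apply, LinearMap.toSpanSingleton_apply, one_smul]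
  have hmax : LinearMap.ker g₀ = vermaMaximal lam lamD := by
    refine le_antisymm (le_sSup fun h => ?_) (sSup_le fun N hN => ?_)
    · have : vermaVec lam lamD ∈ LinearMap.ker g₀ := h ▸ Submodule.mem_top
      rw [LinearMap.mem_ker, hg₀w] at this
      exact hw0 this
    · by_contra hle
      refine hN (eq_top_iff.2 fun y _ => ?_)
      obtain ⟨x, hxN, hx⟩ := Set.not_subset.1 hle
      obtain ⟨u, rfl⟩ := Submodule.Quotient.mk_surjective _ x
      rw [← smul_vermaVec] at hxN hx
      have hu : u • w ≠ 0 := fun h => hx (by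
        rw [SetLike.mem_coe, LinearMap.mem_ker, map_smul, hg₀w, h])
      obtain ⟨u', hu'⟩ := hirr u hu
      obtain ⟨κ, hκ⟩ :=
        (isHighestWeightD_vermaVec (lam := lam) (lamD := lamD)).exists_principalD
      have hκw : toU (principalD ℓ) • w = κ • w := by
        rw [← hg₀w, ← map_smul, hκ]
        exact LinearMap.map_smul_of_tower g₀ κ _
      obtain ⟨m, c, hc⟩ := exists_depthKill_smul hκ (x := u' • u • vermaVec lam lamD)
        (by rw [wordSpan_vermaVec]; exact Submodule.mem_top)
      -- in `M` the vector `u' u v` becomes `w`, so its component along `v` is not zero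
      have hcw : (m.factorial : ℂ) • w = c • w := by
        have := congrArg g₀ hc
        rw [map_smul, map_smul, map_smul, LinearMap.map_smul_of_tower g₀ c, hg₀w, hu',
          depthKill_smul_self hκw] at this
        exact this
      have hc0 : c ≠ 0 := by
        rw [← smul_left_injective ℂ hw0 hcw]
        exact_mod_cast m.factorial_ne_zero
      have hv : vermaVec lam lamD ∈ N := by
        have h1 : c • vermaVec lam lamD ∈ N := hc ▸ N.smul_mem _ (N.smul_mem _ hxN)
        have h2 := N.smul_mem (algebraMap ℂ (UAffine ℓ) c⁻¹) h1
        rwa [algebraMap_smul, smul_smul, inv_mul_cancel₀ hc0, one_smul] at h2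
      obtain ⟨u'', rfl⟩ := Submodule.Quotient.mk_surjective _ y
      rw [← smul_vermaVec]
      exact N.smul_mem _ hv
  refine ⟨(vermaMaximal lam lamD).liftQ g₀ hmax.ge, ?_, ?_⟩
  · rw [← LinearMap.ker_eq_bot]
    exact Submodule.ker_liftQ_eq_bot _ _ _ hmax.le
  · rw [highestVec, Submodule.liftQ_apply, hg₀w]

end Verma

/-! ### Gradings of Fock space -/

section Grading

variable {A : Type*} [AddCommGroup A]

/-- The span of the Maya diagrams of weight `δ`, with respect to the weights `g p` of the positions. -/
def fockWeight (g : ℤ → A) (δ : A) : Submodule ℂ Fock := fockSpan {v | v.weight g = δ}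

lemma basis_mem_fockWeight (g : ℤ → A) (v : MayaDiagram) :
    Fock.basis v ∈ fockWeight g (v.weight g) := basis_mem_fockSpan rfl

/-- If all entries of `a` shift the weight by `s`, then so does the operator of `a`. -/
lemma fockOp_basis_mem (g : ℤ → A) {a : AInfty} {s : A} (hc : a.c = 0 ∨ s = 0)
    (h : ∀ p q, matEntry a.mat p q ≠ 0 → g p - g q = s) (v : MayaDiagram) :
    fockOp a (Fock.basis v) ∈ fockWeight g (v.weight g + s) := by
  obtain ⟨m, hm⟩ := (eventually_fockOp a (Fock.basis v)).exists
  rw [hm, boxOp_apply]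
  refine add_mem ?_ (sum_mem fun p _ => sum_mem fun q _ => ?_)
  · rcases hc with hc | hs
    · rw [hc, zero_smul]; exact zero_mem _
    · rw [hs, add_zero]; exact Submodule.smul_mem _ _ (basis_mem_fockWeight g v)
  · by_cases hpq : matEntry a.mat p q = 0
    · rw [hpq, zero_smul]; exact zero_mem _
    · rw [← h p q hpq]
      exact Submodule.smul_mem _ _ (normalOrdered_basis_mem g p q v)

lemma fockOp_mem_fockWeight (g : ℤ → A) {a : AInfty} {s : A} (hc : a.c = 0 ∨ s = 0)
    (h : ∀ p q, matEntry a.mat p q ≠ 0 → g p - g q = s) {δ : A} {x : Fock}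
    (hx : x ∈ fockWeight g δ) : fockOp a x ∈ fockWeight g (δ + s) :=
  fockSpan_induction _ (fun v hv => hv ▸ fockOp_basis_mem g hc h v) hx

open Classical in
/-- The projection of Fock space to the weight `δ`. -/
def weightProj (g : ℤ → A) (δ : A) : Module.End ℂ Fock :=
  Fock.basis.constr ℂ fun v => if v.weight g = δ then Fock.basis v else 0

open Classical in
lemma weightProj_basis (g : ℤ → A) (δ : A) (v : MayaDiagram) :
    weightProj g δ (Fock.basis v) = if v.weight g = δ then Fock.basis v else 0 := by
  rw [weightProj, Module.Basis.constr_basis]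

lemma weightProj_of_mem {g : ℤ → A} {δ : A} {x : Fock} (hx : x ∈ fockWeight g δ) :
    weightProj g δ x = x := by
  have := fockSpan_induction (N := ⊥) (weightProj g δ - 1) (fun v hv => by
    rw [Submodule.mem_bot, LinearMap.sub_apply, weightProj_basis,
      if_pos (show v.weight g = δ from hv), Module.End.one_apply, sub_self]) hx
  rwa [Submodule.mem_bot, LinearMap.sub_apply, Module.End.one_apply, sub_eq_zero] at this

lemma weightProj_of_mem_ne {g : ℤ → A} {δ δ' : A} (h : δ' ≠ δ) {x : Fock}
    (hx : x ∈ fockWeight g δ') : weightProj g δ x = 0 :=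
  (Submodule.mem_bot ℂ).1 (fockSpan_induction (N := ⊥) (weightProj g δ) (fun v hv => by
    rw [Submodule.mem_bot, weightProj_basis, if_neg]
    rintro rfl
    exact h hv.symm) hx)

lemma weightProj_mem (g : ℤ → A) (δ : A) (x : Fock) : weightProj g δ x ∈ fockWeight g δ := by
  induction x using fock_induction with
  | h0 => rw [map_zero]; exact zero_mem _
  | hb v =>
    rw [weightProj_basis]
    split_ifs with h
    · exact h ▸ basis_mem_fockWeight g v
    · exact zero_mem _
  | hadd x y hx hy => rw [map_add]; exact add_mem hx hy
  | hsmul r x hx => rw [map_smul]; exact Submodule.smul_mem _ _ hx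

lemma weightProj_fockOp (g : ℤ → A) {a : AInfty} {s : A} (hc : a.c = 0 ∨ s = 0)
    (h : ∀ p q, matEntry a.mat p q ≠ 0 → g p - g q = s) (δ : A) (x : Fock) :
    weightProj g (δ + s) (fockOp a x) = fockOp a (weightProj g δ x) := by
  have : weightProj g (δ + s) ∘ₗ fockOp a = fockOp a ∘ₗ weightProj g δ := by
    refine Fock.basis.ext fun v => ?_
    rw [LinearMap.comp_apply, LinearMap.comp_apply, weightProj_basis]
    have hv := fockOp_basis_mem g hc h v
    split_ifs with hδ
    · subst hδ; exact weightProj_of_mem hv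
    · rw [map_zero]
      exact weightProj_of_mem_ne (fun h' => hδ (add_right_cancel h')) hv
  exact LinearMap.congr_fun this x

/-- A vector lies in `N` if all its homogeneous components do. -/
lemma mem_of_weightProj_mem (g : ℤ → A) {N : Submodule ℂ Fock} {x : Fock}
    (h : ∀ δ, weightProj g δ x ∈ N) : x ∈ N := by
  classical
  suffices h' : ∃ t : Finset A, ∀ t', t ⊆ t' → ∑ δ ∈ t', weightProj g δ x = x by
    obtain ⟨t, ht⟩ := h'
    rw [← ht t subset_rfl]
    exact sum_mem fun δ _ => h δ
  clear h
  induction x using fock_induction with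
  | h0 => exact ⟨∅, fun t _ => by simp⟩
  | hb v =>
    refine ⟨{v.weight g}, fun t ht => ?_⟩
    simp only [weightProj_basis]
    rw [Finset.sum_ite_eq, if_pos (ht (Finset.mem_singleton_self _))]
  | hadd x y hx hy =>
    obtain ⟨t, ht⟩ := hx
    obtain ⟨s, hs⟩ := hy
    refine ⟨t ∪ s, fun t' ht' => ?_⟩
    simp only [map_add, Finset.sum_add_distrib]
    rw [ht t' (Finset.union_subset_left ht'), hs t' (Finset.union_subset_right ht')]
  | hsmul r x hx =>
    obtain ⟨t, ht⟩ := hx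
    refine ⟨t, fun t' ht' => ?_⟩
    simp only [map_smul]
    rw [← Finset.smul_sum, ht t' ht']

end Grading

/-- A diagonal element of `a_∞` acts on a Maya diagram by a weight. -/
lemma fockOp_diagonal {a : AInfty} {f : ℤ → ℂ}
    (h : ∀ p q, matEntry a.mat p q = if p = q then f p else 0) (v : MayaDiagram) :
    fockOp a (Fock.basis v) = (a.c + v.weight f) • Fock.basis v := by
  classical
  obtain ⟨b, hb⟩ := v.finite_pos.bddAbove
  obtain ⟨b', hb'⟩ := v.finite_neg.bddBelow
  obtain ⟨m, hm, hmb⟩ := ((eventually_fockOp a (Fock.basis v)).and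
    (eventually_ge_atTop (max 0 (max b (-b'))))).exists
  rw [hm, boxOp_apply, add_smul]
  congr 1
  have h1 : v.finite_pos.toFinset =
      (Finset.Icc (-m) m).filter fun p => 0 < p ∧ p ∈ v.black := by
    ext p
    simp only [Set.Finite.mem_toFinset, Set.mem_ofPred_eq, Finset.mem_filter, Finset.mem_Icc]
    refine ⟨fun hp => ⟨?_, hp⟩, fun hp => hp.2⟩
    have := hb hp
    omega
  have h2 : v.finite_neg.toFinset =
      (Finset.Icc (-m) m).filter fun p => p ≤ 0 ∧ p ∉ v.black := by
    ext p
    simp only [Set.Finite.mem_toFinset, Set.mem_ofPred_eq, Finset.mem_filter, Finset.mem_Icc]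
    refine ⟨fun hp => ⟨?_, hp⟩, fun hp => hp.2⟩
    have := hb' hp
    omega
  rw [weight, h1, h2, Finset.sum_filter, Finset.sum_filter, ← Finset.sum_sub_distrib,
    Finset.sum_smul]
  refine Finset.sum_congr rfl fun p hp => ?_
  simp only [h, ite_smul, zero_smul]
  rw [Finset.sum_ite_eq, if_pos hp, normalOrdered_self_basis, smul_smul]
  congr 1
  split_ifs <;> simp

/-! ### The inner product on Fock space -/

/-- The Hermitian form for which the Maya diagrams are orthonormal. -/
def fockInner : Fock →ₗ⋆[ℂ] Fock →ₗ[ℂ] ℂ :=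
  LinearMap.mk₂'ₛₗ (starRingEnd ℂ) (RingHom.id ℂ)
    (fun x y => (Fock.basis.repr x).sum fun v a => starRingEnd ℂ a * Fock.basis.repr y v)
    (fun x x' y => by
      rw [map_add, Finsupp.sum_add_index'] <;> simp [add_mul])
    (fun r x y => by
      rw [map_smul, Finsupp.sum_smul_index (by simp), smul_eq_mul, Finsupp.mul_sum]
      simp [mul_assoc])
    (fun x y y' => by simp [mul_add])
    (fun r x y => by
      simp only [map_smul, Finsupp.smul_apply, smul_eq_mul, RingHom.id_apply, Finsupp.mul_sum]
      exact Finsupp.sum_congr fun _ _ => by ring)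

lemma fockInner_apply (x y : Fock) : fockInner x y =
    (Fock.basis.repr x).sum fun v a => starRingEnd ℂ a * Fock.basis.repr y v := rfl

open Classical in
lemma fockInner_basis (v v' : MayaDiagram) :
    fockInner (Fock.basis v) (Fock.basis v') = if v = v' then 1 else 0 := by
  rw [fockInner_apply, Module.Basis.repr_self, Module.Basis.repr_self,
    Finsupp.sum_single_index (by simp), Finsupp.single_apply]
  simp [eq_comm]

lemma conj_fockInner (x y : Fock) : starRingEnd ℂ (fockInner x y) = fockInner y x := by
  classical
  induction x using fock_induction with
  | h0 => simp
  | hadd x x' hx hx' => simp only [map_add, LinearMap.add_apply, hx, hx']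
  | hsmul r x hx => simp [hx]
  | hb v =>
    induction y using fock_induction with
    | h0 => simp
    | hadd y y' hy hy' => simp only [map_add, LinearMap.add_apply, hy, hy']
    | hsmul r y hy => simp [hy]
    | hb v' => rw [fockInner_basis, fockInner_basis]; simp [eq_comm, apply_ite]

lemma fockInner_self (x : Fock) : fockInner x x =
    (((Fock.basis.repr x).sum fun _ a => ‖a‖ ^ 2 : ℝ) : ℂ) := by
  rw [fockInner_apply, Finsupp.sum, Finsupp.sum, Complex.ofReal_sum]
  refine Finset.sum_congr rfl fun v _ => ?_
  rw [Complex.conj_mul']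
  push_cast
  rfl

lemma re_fockInner_self_nonneg (x : Fock) : 0 ≤ (fockInner x x).re := by
  rw [fockInner_self, Complex.ofReal_re]
  exact Finset.sum_nonneg fun _ _ => by positivity

lemma fockInner_self_eq_zero {x : Fock} (h : fockInner x x = 0) : x = 0 := by
  rw [fockInner_self, Complex.ofReal_eq_zero, Finsupp.sum,
    Finset.sum_eq_zero_iff_of_nonneg fun _ _ => by positivity] at h
  refine Fock.basis.repr.injective (Finsupp.ext fun v => ?_)
  rw [map_zero, Finsupp.zero_apply]
  by_contra hv
  exact hv (by simpa using h v (Finsupp.mem_support_iff.2 hv))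

/-- Fock space as a pre-Hilbert space. -/
abbrev fockCore : InnerProductSpace.Core ℂ Fock where
  inner x y := fockInner x y
  conj_inner_symm x y := conj_fockInner y x
  re_inner_nonneg := re_fockInner_self_nonneg
  add_left x y z := by rw [map_add, LinearMap.add_apply]
  smul_left x y r := by simp
  definite _ := fockInner_self_eq_zero

/-- Orthogonal projection to a finite-dimensional subspace. -/
lemma exists_orthogonal_decomposition (T : Submodule ℂ Fock) [FiniteDimensional ℂ T] (x : Fock) :
    ∃ y ∈ T, ∀ t ∈ T, fockInner t (x - y) = 0 := by
  let : NormedAddCommGroup Fock := fockCore.toNormedAddCommGroup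
  let : InnerProductSpace ℂ Fock := InnerProductSpace.ofCore fockCore.toCore
  have : CompleteSpace T := FiniteDimensional.complete ℂ T
  obtain ⟨y, hy, z, hz, hxyz⟩ := T.exists_add_mem_mem_orthogonal x
  refine ⟨y, hy, fun t ht => ?_⟩
  rw [hxyz, add_sub_cancel_left]
  exact (Submodule.mem_orthogonal T z).1 hz t ht

lemma fockInner_psi (p : ℤ) (x y : Fock) : fockInner (psi p x) y = fockInner x (psiStar p y) := by
  classical
  induction x using fock_induction with
  | h0 => simp
  | hadd x x' hx hx' => simp only [map_add, LinearMap.add_apply, hx, hx']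
  | hsmul r x hx => simp [hx]
  | hb v =>
    induction y using fock_induction with
    | h0 => simp
    | hadd y y' hy hy' => simp only [map_add, hy, hy']
    | hsmul r y hy => simp [hy]
    | hb v' =>
      by_cases h : p ∈ v.black
      · rw [psi_basis_of_mem h, map_zero, LinearMap.zero_apply]
        by_cases h' : p ∈ v'.black
        · rw [psiStar_basis_of_mem h', map_smul, fockInner_basis, if_neg, smul_zero]
          rintro rfl
          exact h.2 rfl
        · rw [psiStar_basis_of_notMem h', map_zero]
      · rw [psi_basis_of_notMem h, LinearMap.map_smulₛₗ, LinearMap.smul_apply, fockInner_basis,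
          conj_sign]
        by_cases h' : p ∈ v'.black
        · rw [psiStar_basis_of_mem h', map_smul, fockInner_basis]
          by_cases hv : v.insertBead p = v'
          · subst hv
            rw [if_pos rfl, eraseBead_insertBead h, if_pos rfl, sign_insertBead_self h]
          · rw [if_neg hv, if_neg, smul_zero, smul_zero]
            rintro rfl
            exact hv (insertBead_eraseBead h')
        · rw [psiStar_basis_of_notMem h', map_zero, if_neg, smul_zero]
          rintro rfl
          exact h' (Or.inl rfl)

lemma fockInner_psiStar (p : ℤ) (x y : Fock) :
    fockInner (psiStar p x) y = fockInner x (psi p y) := by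
  rw [← conj_fockInner, ← fockInner_psi, conj_fockInner]

lemma fockInner_normalOrdered (p q : ℤ) (x y : Fock) :
    fockInner (normalOrdered p q x) y = fockInner x (normalOrdered q p y) := by
  rw [normalOrdered_eq, normalOrdered_eq]
  simp only [LinearMap.sub_apply, Module.End.mul_apply, map_sub, fockInner_psi, fockInner_psiStar]
  congr 1
  by_cases h : p = q
  · subst h; split_ifs <;> simp
  · rw [if_neg (fun h' => h h'.1), if_neg (fun h' => h h'.1.symm)]; simp

/-- The representation of `a_∞` is unitary: conjugate transposed matrices act by adjoint operators. -/
lemma fockInner_fockOp {a b : AInfty} (hc : b.c = starRingEnd ℂ a.c)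
    (h : ∀ p q, matEntry b.mat p q = starRingEnd ℂ (matEntry a.mat q p)) (x y : Fock) :
    fockInner (fockOp a x) y = fockInner x (fockOp b y) := by
  obtain ⟨m, hm, hm'⟩ := ((eventually_fockOp a x).and (eventually_fockOp b y)).exists
  rw [hm, hm', boxOp_apply, boxOp_apply]
  simp only [map_add, map_sum, LinearMap.add_apply, LinearMap.sum_apply, LinearMap.map_smulₛₗ,
    LinearMap.smul_apply, RingHom.id_apply, hc, h, fockInner_normalOrdered]
  rw [Finset.sum_comm]

/-! ### The grading of Fock space by the Cartan subalgebra -/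

section Degree

variable {ℓ : ℕ} [ℓ.AtLeastTwo]

/-- The degree of a position: the basis vector of its residue class, and its level. The corresponding
weight of a Maya diagram consists of the charges of the residue classes and minus the eigenvalue of `d`. -/
def posDeg (ℓ : ℕ) [NeZero ℓ] (p : ℤ) : (Fin ℓ → ℤ) × ℤ := (Pi.single (res ℓ p) 1, lev ℓ p)

/-- The amount by which `E_i` shifts the degree. -/
def rootDeg (i : Fin ℓ) : (Fin ℓ → ℤ) × ℤ :=
  (Pi.single (i - 1) 1 - Pi.single i 1, -(if i = 0 then 1 else 0))

/-- The charge of a Maya diagram, as a function of its degree. -/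
def chargeHom (ℓ : ℕ) : (Fin ℓ → ℤ) × ℤ →+ ℤ where
  toFun δ := ∑ i, δ.1 i
  map_zero' := by simp
  map_add' δ δ' := by simp [Finset.sum_add_distrib]

/-- The energy of a Maya diagram, as a function of its degree. The energy is the sum of the positions
`p : ℤ` of the positive beads minus the sum of the positions of the negative gaps; it differs from the
energy for half-integral positions by half the charge. -/
def energyHom (ℓ : ℕ) : (Fin ℓ → ℤ) × ℤ →+ ℤ where
  toFun δ := ∑ i : Fin ℓ, (((i : ℕ) : ℤ) + 1) * δ.1 i + ℓ * δ.2
  map_zero' := by simp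
  map_add' δ δ' := by simp [Finset.sum_add_distrib, mul_add]; ring

/-- The eigenvalue of `H_i` on the weight space of degree `δ`. -/
def corootDeg (i : Fin ℓ) (δ : (Fin ℓ → ℤ) × ℤ) : ℤ :=
  δ.1 (i - 1) - δ.1 i + if i = 0 then 1 else 0

lemma chargeHom_posDeg (p : ℤ) : chargeHom ℓ (posDeg ℓ p) = 1 := by
  simp [chargeHom, posDeg]

lemma energyHom_posDeg (p : ℤ) : energyHom ℓ (posDeg ℓ p) = p := by
  have h := res_add_lev (ℓ := ℓ) p
  simp only [energyHom, posDeg, AddMonoidHom.coe_mk, ZeroHom.coe_mk]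
  rw [Finset.sum_eq_single (res ℓ p)]
  · rw [Pi.single_eq_same, mul_one]; linarith
  · intro i _ hi; rw [Pi.single_eq_of_ne hi, mul_zero]
  · simp

lemma chargeHom_rootDeg (i : Fin ℓ) : chargeHom ℓ (rootDeg i) = 0 := by
  simp [chargeHom, rootDeg]

lemma energyHom_rootDeg (i : Fin ℓ) : energyHom ℓ (rootDeg i) = -1 := by
  simp only [energyHom, rootDeg, AddMonoidHom.coe_mk, ZeroHom.coe_mk, Pi.sub_apply, mul_sub,
    Finset.sum_sub_distrib]
  simp only [Pi.single_apply, mul_ite, mul_one, mul_zero, Finset.sum_ite_eq', Finset.mem_univ,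
    if_true]
  by_cases hi : i = 0
  · subst hi
    have h : (((0 - 1 : Fin ℓ) : ℕ) : ℤ) + 1 = ℓ := by exact_mod_cast val_zero_sub_one (ℓ := ℓ)
    rw [h]; simp; ring
  · have h : (((i - 1 : Fin ℓ) : ℕ) : ℤ) + 1 = i := by exact_mod_cast val_sub_one_add_one hi
    rw [h]; simp [hi]

lemma charge_eq (v : MayaDiagram) : v.charge = chargeHom ℓ (v.weight (posDeg ℓ)) := by
  rw [charge_eq_weight, ← weight_map]
  simp only [chargeHom_posDeg]

lemma energy_eq (v : MayaDiagram) : v.weight (fun p => p) = energyHom ℓ (v.weight (posDeg ℓ)) := by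
  rw [← weight_map]
  simp only [energyHom_posDeg]

end Degree

/-- A bead at `p > 0` contributes `p` to the energy, and a gap at `p ≤ 0` contributes `-p`. -/
lemma MayaDiagram.energy_nonneg (v : MayaDiagram) : 0 ≤ v.weight fun p => p := by
  rw [weight, sub_nonneg]
  refine (Finset.sum_nonpos fun p hp => ?_).trans (Finset.sum_nonneg fun p hp => ?_)
  · exact ((Set.Finite.mem_toFinset _).1 hp).1
  · exact ((Set.Finite.mem_toFinset _).1 hp).1.le

/-- There are finitely many Maya diagrams of given energy, as it bounds the positions of the positive
beads and of the negative gaps. -/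
lemma finite_energy (n : ℤ) : {v : MayaDiagram | v.weight (fun p => p) = n}.Finite := by
  refine Set.Finite.of_finite_image (f := MayaDiagram.black) (Set.Finite.subset
    (((Set.finite_Icc 1 n).powerset.prod (Set.finite_Icc (-n) 0).powerset).image
      fun s : Set ℤ × Set ℤ => s.1 ∪ (Set.Iic 0 \ s.2)) ?_)
    (fun v _ w _ h => MayaDiagram.ext h)
  rintro _ ⟨v, hv, rfl⟩
  have hv : v.weight (fun p => p) = n := hv
  have h1 : ∀ p ∈ v.finite_pos.toFinset, (0 : ℤ) ≤ p :=
    fun p hp => ((Set.Finite.mem_toFinset _).1 hp).1.le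
  have h2 : ∀ p ∈ v.finite_neg.toFinset, (0 : ℤ) ≤ -p := fun p hp => by
    have := ((Set.Finite.mem_toFinset _).1 hp).1
    omega
  rw [weight, sub_eq_add_neg, ← Finset.sum_neg_distrib] at hv
  have h3 := Finset.sum_nonneg h1
  have h4 := Finset.sum_nonneg h2
  refine ⟨({p | 0 < p ∧ p ∈ v.black}, {p | p ≤ 0 ∧ p ∉ v.black}), ⟨fun p hp => ?_, fun p hp => ?_⟩, ?_⟩
  · have h5 := Finset.single_le_sum h1 ((Set.Finite.mem_toFinset _).2 hp)
    have h6 : (0 : ℤ) < p := hp.1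
    rw [Set.mem_Icc]; omega
  · have h5 := Finset.single_le_sum h2 ((Set.Finite.mem_toFinset _).2 hp)
    have h6 : p ≤ (0 : ℤ) := hp.1
    rw [Set.mem_Icc]; omega
  · ext p
    simp only [Set.mem_union, Set.mem_sdiff, Set.mem_ofPred_eq, Set.mem_Iic]
    grind

/-! ### The representation of the affine Lie algebra on Fock space -/

section AffineFock

variable {ℓ : ℕ} [ℓ.AtLeastTwo]

/-- The embedding of `ŝl_ℓ'` in `a_∞`. -/
def affineEmbedding (ℓ : ℕ) [ℓ.AtLeastTwo] : affineSl' ℓ →ₗ⁅ℂ⁆ AInfty :=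
  (affineToInfty ℓ).comp ((affineSl ℓ).incl.comp (affineSl' ℓ).incl)

lemma affineEmbedding_apply (x : affineSl' ℓ) :
    affineEmbedding ℓ x = affineToInfty ℓ ((x : affineSl ℓ) : AffineGl ℓ) := rfl

/-- The representation of `ŝl_ℓ'` on Fock space. -/
def affineFock (ℓ : ℕ) [ℓ.AtLeastTwo] : affineSl' ℓ →ₗ⁅ℂ⁆ Module.End ℂ Fock :=
  fockRep.comp (affineEmbedding ℓ)

lemma affineFock_apply (x : affineSl' ℓ) :
    affineFock ℓ x = fockOp (affineToInfty ℓ ((x : affineSl ℓ) : AffineGl ℓ)) := rfl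

lemma matEntry_affineUnit (i j : Fin ℓ) (m p q : ℤ) :
    matEntry (affineToInfty ℓ (affineUnit i j m)).mat p q =
      if i = res ℓ p ∧ j = res ℓ q ∧ m = lev ℓ q - lev ℓ p then 1 else 0 := by
  rw [matEntry_affineToInfty]
  simp only [affineUnit, mul_zero, neg_zero, ite_self, add_zero, Matrix.single_apply]
  by_cases h : i = res ℓ p ∧ j = res ℓ q
  · rw [if_pos h, LaurentPolynomial.T_apply]
    simp [h.1, h.2]
  · rw [if_neg h, if_neg (fun h' => h ⟨h'.1, h'.2.1⟩)]
    rfl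

lemma posDeg_sub_of_matEntry_ne_zero {i j : Fin ℓ} {m p q : ℤ}
    (h : matEntry (affineToInfty ℓ (affineUnit i j m)).mat p q ≠ 0) :
    posDeg ℓ p - posDeg ℓ q = (Pi.single i 1 - Pi.single j 1, -m) := by
  rw [matEntry_affineUnit] at h
  obtain ⟨h1, h2, h3⟩ : i = res ℓ p ∧ j = res ℓ q ∧ m = lev ℓ q - lev ℓ p := by
    by_contra h'; exact h (if_neg h')
  rw [posDeg, posDeg, ← h1, ← h2, h3, neg_sub]
  rfl

lemma chevalleyE_shift (i : Fin ℓ) (p q : ℤ)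
    (h : matEntry (affineToInfty ℓ ((chevalleyE i : affineSl ℓ) : AffineGl ℓ)).mat p q ≠ 0) :
    posDeg ℓ p - posDeg ℓ q = rootDeg i := by
  rw [coe_chevalleyE] at h
  rw [posDeg_sub_of_matEntry_ne_zero h]
  rfl

lemma chevalleyF_shift (i : Fin ℓ) (p q : ℤ)
    (h : matEntry (affineToInfty ℓ ((chevalleyF i : affineSl ℓ) : AffineGl ℓ)).mat p q ≠ 0) :
    posDeg ℓ p - posDeg ℓ q = -rootDeg i := by
  rw [coe_chevalleyF] at h
  rw [posDeg_sub_of_matEntry_ne_zero h, rootDeg]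
  ext
  · simp
  · simp only [Prod.snd_neg]; split_ifs <;> simp

lemma affineFock_chevalleyE_mem (i : Fin ℓ) {δ : (Fin ℓ → ℤ) × ℤ} {x : Fock}
    (hx : x ∈ fockWeight (posDeg ℓ) δ) :
    affineFock ℓ (chevalleyE i) x ∈ fockWeight (posDeg ℓ) (δ + rootDeg i) :=
  fockOp_mem_fockWeight _ (Or.inl rfl) (chevalleyE_shift i) hx

lemma affineFock_chevalleyF_mem (i : Fin ℓ) {δ : (Fin ℓ → ℤ) × ℤ} {x : Fock}
    (hx : x ∈ fockWeight (posDeg ℓ) δ) :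
    affineFock ℓ (chevalleyF i) x ∈ fockWeight (posDeg ℓ) (δ - rootDeg i) := by
  rw [sub_eq_add_neg]
  exact fockOp_mem_fockWeight _ (Or.inl rfl) (chevalleyF_shift i) hx

lemma weightProj_chevalleyE (i : Fin ℓ) (δ : (Fin ℓ → ℤ) × ℤ) (x : Fock) :
    weightProj (posDeg ℓ) (δ + rootDeg i) (affineFock ℓ (chevalleyE i) x) =
      affineFock ℓ (chevalleyE i) (weightProj (posDeg ℓ) δ x) :=
  weightProj_fockOp _ (Or.inl rfl) (chevalleyE_shift i) δ x

lemma fockOp_cartan (y : Fin ℓ → ℂ) (c d : ℂ) {δ : (Fin ℓ → ℤ) × ℤ} {x : Fock}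
    (hx : x ∈ fockWeight (posDeg ℓ) δ) : fockOp (affineToInfty ℓ (cartan y c d)) x =
      (c + (∑ i, y i * δ.1 i - d * δ.2)) • x := by
  let f : (Fin ℓ → ℤ) × ℤ →+ ℂ :=
    { toFun := fun δ => ∑ i, y i * δ.1 i - d * δ.2
      map_zero' := by simp
      map_add' := fun δ δ' => by simp [Finset.sum_add_distrib, mul_add]; ring }
  have hf : ∀ p q, matEntry (affineToInfty ℓ (cartan y c d)).mat p q =
      if p = q then f (posDeg ℓ p) else 0 := by
    intro p q
    rw [matEntry_affineToInfty]
    by_cases h : p = q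
    · subst h
      have : ∑ i, y i * (((Pi.single (res ℓ p) 1 : Fin ℓ → ℤ) i : ℤ) : ℂ) = y (res ℓ p) := by
        rw [Finset.sum_eq_single (res ℓ p)]
        · simp
        · intro i _ hi; simp [hi]
        · simp
      simp only [if_true, cartan, Matrix.diagonal_apply_eq, sub_self, f, posDeg,
        AddMonoidHom.coe_mk, ZeroHom.coe_mk, this]
      have h0 : (LaurentPolynomial.C (y (res ℓ p))).coeff 0 = y (res ℓ p) := by
        rw [← LaurentPolynomial.single_eq_C, AddMonoidAlgebra.coeff_single, Finsupp.single_eq_same]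
      rw [h0]; ring
    · rw [if_neg h, if_neg h, add_zero]
      simp only [cartan]
      by_cases hr : res ℓ p = res ℓ q
      · have hl : lev ℓ q - lev ℓ p ≠ 0 := fun hl =>
          h (eq_iff_res_lev.2 ⟨hr, (sub_eq_zero.1 hl).symm⟩)
        rw [hr, Matrix.diagonal_apply_eq, ← LaurentPolynomial.single_eq_C,
          AddMonoidAlgebra.coeff_single, Finsupp.single_eq_of_ne hl]
      · rw [Matrix.diagonal_apply_ne _ hr]; rfl
  have key := fockSpan_induction (N := ⊥)
    (fockOp (affineToInfty ℓ (cartan y c d)) - (c + f δ) • 1) (fun v hv => by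
      have hv' : v.weight (posDeg ℓ) = δ := hv
      rw [Submodule.mem_bot, LinearMap.sub_apply, fockOp_diagonal hf, weight_map, hv',
        LinearMap.smul_apply, Module.End.one_apply]
      exact sub_self _) hx
  rw [Submodule.mem_bot, LinearMap.sub_apply, sub_eq_zero] at key
  exact key

lemma affineFock_chevalleyH (i : Fin ℓ) {δ : (Fin ℓ → ℤ) × ℤ} {x : Fock}
    (hx : x ∈ fockWeight (posDeg ℓ) δ) :
    affineFock ℓ (chevalleyH i) x = (corootDeg i δ : ℂ) • x := by
  rw [affineFock_apply, coe_chevalleyH, fockOp_cartan _ _ _ hx]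
  congr 1
  simp only [Pi.sub_apply, sub_mul, Finset.sum_sub_distrib, Pi.single_apply, ite_mul, one_mul,
    zero_mul, Finset.sum_ite_eq', Finset.mem_univ, if_true, corootDeg]
  push_cast
  ring

/-- `E_i` and `F_i` are adjoint to each other. -/
lemma fockInner_chevalleyF (i : Fin ℓ) (x y : Fock) :
    fockInner (affineFock ℓ (chevalleyF i) x) y = fockInner x (affineFock ℓ (chevalleyE i) y) := by
  rw [affineFock_apply, affineFock_apply, coe_chevalleyE, coe_chevalleyF]
  refine fockInner_fockOp ?_ (fun p q => ?_) x y
  · exact (map_zero _).symm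
  · rw [matEntry_affineUnit, matEntry_affineUnit, apply_ite (starRingEnd ℂ), map_one, map_zero]
    congr 1
    rw [eq_iff_iff]
    split_ifs <;> grind

/-- The vectors of Fock space killed by all `E_i`. -/
def singular (ℓ : ℕ) [ℓ.AtLeastTwo] : Submodule ℂ Fock :=
  ⨅ i : Fin ℓ, LinearMap.ker (affineFock ℓ (chevalleyE i))

lemma mem_singular {x : Fock} : x ∈ singular ℓ ↔ ∀ i, affineFock ℓ (chevalleyE i) x = 0 := by
  simp [singular, Submodule.mem_iInf]

lemma weightProj_mem_singular {x : Fock} (hx : x ∈ singular ℓ) (δ : (Fin ℓ → ℤ) × ℤ) :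
    weightProj (posDeg ℓ) δ x ∈ singular ℓ :=
  mem_singular.2 fun i => by rw [← weightProj_chevalleyE, mem_singular.1 hx i, map_zero]

/-- A dominant weight of level one is a fundamental weight, and the charge determines which. -/
lemma corootDeg_eq {δ : (Fin ℓ → ℤ) × ℤ} (h : ∀ i, 0 ≤ corootDeg i δ) (i : Fin ℓ) :
    (corootDeg i δ : ℂ) = fundamentalWeight ℓ (chargeHom ℓ δ) i := by
  have hshift : ∀ f : Fin ℓ → ℤ, ∑ i, f (i - 1) = ∑ i, f i :=
    fun f => (Equiv.subRight (1 : Fin ℓ)).sum_comp f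
  have hsum : ∑ i, corootDeg i δ = 1 := by
    simp only [corootDeg, Finset.sum_add_distrib, Finset.sum_sub_distrib, hshift δ.1]
    simp
  obtain ⟨j, hj⟩ : ∃ j, 0 < corootDeg j δ := by
    by_contra! h'
    have := Finset.sum_nonpos fun i (_ : i ∈ Finset.univ) => h' i
    omega
  have hval : ∀ i, corootDeg i δ = if i = j then 1 else 0 := by
    have h1 := Finset.add_sum_erase Finset.univ (fun i => corootDeg i δ) (Finset.mem_univ j)
    have h2 := Finset.sum_nonneg fun i (_ : i ∈ Finset.univ.erase j) => h i
    have h3 : ∑ i ∈ Finset.univ.erase j, corootDeg i δ = 0 := by omega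
    intro i
    split_ifs with hij
    · subst hij; omega
    · exact (Finset.sum_eq_zero_iff_of_nonneg fun i _ => h i).1 h3 i
        (Finset.mem_erase.2 ⟨hij, Finset.mem_univ i⟩)
  have hcast : ∀ i : Fin ℓ, (((i - 1 : Fin ℓ) : ℕ) : ZMod ℓ) + 1 = ((i : ℕ) : ZMod ℓ) := by
    intro i
    by_cases hi : i = 0
    · subst hi
      have := congrArg (Nat.cast : ℕ → ZMod ℓ) (val_zero_sub_one (ℓ := ℓ))
      push_cast at this
      rw [this]; simp
    · exact_mod_cast congrArg (Nat.cast : ℕ → ZMod ℓ) (val_sub_one_add_one hi)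
  -- in `ℤ/ℓℤ` the sum of the `i H_i` is the charge
  have hj' : ((chargeHom ℓ δ : ℤ) : ZMod ℓ) = ((j : ℕ) : ZMod ℓ) := by
    have h1 : ∑ i : Fin ℓ, ((i : ℕ) : ZMod ℓ) * (corootDeg i δ : ZMod ℓ) = ((j : ℕ) : ZMod ℓ) := by
      simp [hval]
    rw [← h1]
    have h2 : ∑ i : Fin ℓ, ((i : ℕ) : ZMod ℓ) * ((δ.1 (i - 1) : ℤ) : ZMod ℓ) =
        ∑ i : Fin ℓ, (((i : ℕ) : ZMod ℓ) + 1) * ((δ.1 i : ℤ) : ZMod ℓ) := by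
      rw [← (Equiv.subRight (1 : Fin ℓ)).sum_comp
        fun i : Fin ℓ => (((i : ℕ) : ZMod ℓ) + 1) * ((δ.1 i : ℤ) : ZMod ℓ)]
      refine Finset.sum_congr rfl fun i _ => ?_
      rw [Equiv.subRight_apply, hcast]
    have h3 : ∑ i : Fin ℓ, ((i : ℕ) : ZMod ℓ) * ((if i = 0 then 1 else 0 : ℤ) : ZMod ℓ) = 0 := by
      refine Finset.sum_eq_zero fun i _ => ?_
      split_ifs with hi <;> simp [hi]
    simp only [corootDeg, Int.cast_add, Int.cast_sub, mul_add, mul_sub, Finset.sum_add_distrib,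
      Finset.sum_sub_distrib, h2, h3, add_mul, one_mul]
    simp [chargeHom]
  have hinj : ((i : ℕ) : ZMod ℓ) = ((j : ℕ) : ZMod ℓ) ↔ i = j := by
    rw [ZMod.natCast_eq_natCast_iff', Nat.mod_eq_of_lt i.2, Nat.mod_eq_of_lt j.2, Fin.val_inj]
  rw [hval, fundamentalWeight, hj']
  simp only [hinj]
  split_ifs <;> simp

/-- A homogeneous singular vector is a highest weight vector of fundamental weight: positivity of the
Hermitian form makes its weight dominant, and its level is one. -/
lemma isHighestWeight_of_singular {δ : (Fin ℓ → ℤ) × ℤ} {w : Fock}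
    (hδ : w ∈ fockWeight (posDeg ℓ) δ) (hw : w ∈ singular ℓ) (hw0 : w ≠ 0) :
    IsHighestWeight (affineFock ℓ) (fundamentalWeight ℓ (chargeHom ℓ δ)) w := by
  refine ⟨mem_singular.1 hw, fun i => ?_⟩
  rw [affineFock_chevalleyH i hδ, corootDeg_eq]
  intro i
  -- `‖F_i w‖² = ⟨w, E_i F_i w⟩ = ⟨w, H_i w⟩`
  have h1 : fockInner (affineFock ℓ (chevalleyF i) w) (affineFock ℓ (chevalleyF i) w) =
      corootDeg i δ * fockInner w w := by
    rw [fockInner_chevalleyF, lie_apply_apply, mem_singular.1 hw i, map_zero, add_zero]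
    change fockInner w (affineFock ℓ (chevalleyH i) w) = _
    rw [affineFock_chevalleyH i hδ, map_smul, smul_eq_mul]
  have h2 := re_fockInner_self_nonneg (affineFock ℓ (chevalleyF i) w)
  have h3 : 0 < (fockInner w w).re := by
    refine lt_of_le_of_ne (re_fockInner_self_nonneg w) fun h => hw0 (fockInner_self_eq_zero ?_)
    rw [fockInner_self] at h ⊢
    rw [Complex.ofReal_re] at h
    rw [← h, Complex.ofReal_zero]
  rw [h1] at h2
  have h4 : ((corootDeg i δ : ℂ) * fockInner w w).re = (corootDeg i δ : ℝ) * (fockInner w w).re := by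
    simp
  rw [h4] at h2
  exact_mod_cast nonneg_of_mul_nonneg_left h2 h3

end AffineFock

/-! ### Complete reducibility -/

lemma fockOp_mem_fockCharge (a : AInfty) {h : ℤ} {x : Fock} (hx : x ∈ fockCharge h) :
    fockOp a x ∈ fockCharge h := by
  have e : fockCharge h = fockWeight (fun _ => (1 : ℤ)) h := by
    simp only [fockCharge, fockWeight, fockSpan, charge_eq_weight]
  rw [e] at hx ⊢
  have := fockOp_mem_fockWeight (fun _ => (1 : ℤ)) (a := a) (Or.inr rfl) (fun _ _ _ => sub_self _) hx
  rwa [add_zero] at this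

lemma isSubrep_sSup {L V : Type*} [LieRing L] [LieAlgebra ℂ L] [AddCommGroup V] [Module ℂ V]
    {π : L →ₗ⁅ℂ⁆ Module.End ℂ V} {S : Set (Submodule ℂ V)} (hS : ∀ N ∈ S, IsSubrep π N) :
    IsSubrep π (sSup S) := fun x => by
  have : sSup S ≤ (sSup S).comap (π x) := sSup_le fun N hN v hv => le_sSup hN (hS N hN x v hv)
  exact fun v hv => this hv

section Reducibility

variable {ℓ : ℕ} [ℓ.AtLeastTwo]

lemma isSubrep_fockCharge (h : ℤ) : IsSubrep (affineFock ℓ) (fockCharge h) :=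
  fun _ _ hx => fockOp_mem_fockCharge _ hx

lemma fockWeight_le_fockCharge (δ : (Fin ℓ → ℤ) × ℤ) :
    fockWeight (posDeg ℓ) δ ≤ fockCharge (chargeHom ℓ δ) :=
  fockSpan_mono fun v (hv : v.weight (posDeg ℓ) = δ) => by
    rw [Set.mem_ofPred_eq, charge_eq (ℓ := ℓ), hv]

lemma weightProj_eq_zero_of_charge {h : ℤ} {δ : (Fin ℓ → ℤ) × ℤ} (hδ : chargeHom ℓ δ ≠ h) {x : Fock}
    (hx : x ∈ fockCharge h) : weightProj (posDeg ℓ) δ x = 0 :=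
  (Submodule.mem_bot ℂ).1 (fockSpan_induction (N := ⊥) _ (fun v (hv : v.charge = h) => by
    rw [Submodule.mem_bot, weightProj_basis, if_neg]
    rintro rfl
    exact hδ (by rw [← charge_eq, hv])) hx)

/-- The span of the Maya diagrams of energy less than `n`. -/
def energyLt (n : ℕ) : Submodule ℂ Fock := fockSpan {v | v.weight (fun p => p) < n}

/-- The subspaces of bounded energy exhaust Fock space. -/
lemma exists_mem_energyLt (x : Fock) : ∃ n, x ∈ energyLt n := by
  have hmono : ∀ {m n : ℕ}, m ≤ n → energyLt m ≤ energyLt n := fun {m n} hmn =>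
    fockSpan_mono fun v (hv : v.weight (fun p => p) < m) => by
      rw [Set.mem_ofPred_eq]; omega
  induction x using fock_induction with
  | h0 => exact ⟨0, zero_mem _⟩
  | hb v =>
    refine ⟨(v.weight (fun p => p)).toNat + 1, basis_mem_fockSpan ?_⟩
    rw [Set.mem_ofPred_eq]; omega
  | hadd x y hx hy =>
    obtain ⟨m, hm⟩ := hx
    obtain ⟨n, hn⟩ := hy
    exact ⟨max m n, add_mem (hmono (le_max_left _ _) hm) (hmono (le_max_right _ _) hn)⟩
  | hsmul r x hx =>
    obtain ⟨m, hm⟩ := hx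
    exact ⟨m, Submodule.smul_mem _ _ hm⟩

lemma chevalleyE_mem_energyLt (i : Fin ℓ) {n : ℕ} {x : Fock} (hx : x ∈ energyLt (n + 1)) :
    affineFock ℓ (chevalleyE i) x ∈ energyLt n :=
  fockSpan_induction _ (fun v (hv : v.weight (fun p => p) < (n + 1 : ℕ)) => by
    have h := affineFock_chevalleyE_mem i (basis_mem_fockWeight (posDeg ℓ) v)
    refine fockSpan_mono (fun v' (hv' : v'.weight (posDeg ℓ) = _) => ?_) h
    rw [Set.mem_ofPred_eq, energy_eq (ℓ := ℓ), hv', map_add, energyHom_rootDeg, ← energy_eq]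
    push_cast at hv
    omega) hx

/-- As the energy is bounded below and lowered by the `E_i`, every non-zero subspace stable under the
`E_i` contains a singular vector. -/
lemma exists_singular {N : Submodule ℂ Fock} (hN : ∀ i, ∀ v ∈ N, affineFock ℓ (chevalleyE i) v ∈ N)
    (hN0 : N ≠ ⊥) : ∃ w ∈ N, w ∈ singular ℓ ∧ w ≠ 0 := by
  obtain ⟨x, hx, hx0⟩ := Submodule.exists_mem_ne_zero_of_ne_bot hN0
  obtain ⟨n, hn⟩ := exists_mem_energyLt x
  induction n generalizing x with
  | zero =>
    have h0 : energyLt 0 = ⊥ := by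
      have : {v : MayaDiagram | v.weight (fun p => p) < (0 : ℕ)} = ∅ :=
        Set.eq_empty_of_forall_notMem fun v hv => (not_lt.2 v.energy_nonneg) (by exact_mod_cast hv)
      rw [energyLt, fockSpan, this, Set.image_empty, Submodule.span_empty]
    rw [h0, Submodule.mem_bot] at hn
    exact absurd hn hx0
  | succ n ih =>
    by_cases hs : x ∈ singular ℓ
    · exact ⟨x, hx, hs, hx0⟩
    · rw [mem_singular] at hs
      push Not at hs
      obtain ⟨i, hi⟩ := hs
      exact ih _ (hN i x hx) hi (chevalleyE_mem_energyLt i hn)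

/-- A singular vector is orthogonal to all `F_i u`. Hence the singular vectors in the
subrepresentation generated by a highest weight vector `w` are the multiples of `w`. -/
lemma exists_eq_smul_of_singular {w y : Fock} (hw : w ∈ singular ℓ)
    (hy : y ∈ wordSpan (affineFock ℓ) w) (hys : y ∈ singular ℓ) : ∃ c : ℂ, y = c • w := by
  set W : Submodule ℂ Fock :=
    Submodule.span ℂ {u | ∃ i : Fin ℓ, ∃ u', u = affineFock ℓ (chevalleyF i) u'} with hW
  have hdec : ∃ c : ℂ, y - c • w ∈ W := by
    clear hys
    induction hy using Submodule.span_induction with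
    | mem y hy =>
      obtain ⟨l, rfl⟩ := hy
      rcases l with - | ⟨i, l⟩
      · exact ⟨1, by rw [fWord, one_smul, sub_self]; exact zero_mem _⟩
      · exact ⟨0, by
          rw [zero_smul, sub_zero]
          exact Submodule.subset_span ⟨i, _, rfl⟩⟩
    | zero => exact ⟨0, by simp⟩
    | add x x' _ _ hx hx' =>
      obtain ⟨c, hc⟩ := hx
      obtain ⟨c', hc'⟩ := hx'
      exact ⟨c + c', by rw [add_smul, add_sub_add_comm]; exact add_mem hc hc'⟩
    | smul r x _ hx =>
      obtain ⟨c, hc⟩ := hx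
      exact ⟨r * c, by rw [mul_smul, ← smul_sub]; exact Submodule.smul_mem _ r hc⟩
  obtain ⟨c, hc⟩ := hdec
  refine ⟨c, sub_eq_zero.1 (fockInner_self_eq_zero ?_)⟩
  have hs : y - c • w ∈ singular ℓ := sub_mem hys (Submodule.smul_mem _ _ hw)
  have hle : W ≤ LinearMap.ker (fockInner (y - c • w)) := by
    rw [hW]
    refine Submodule.span_le.2 ?_
    rintro _ ⟨i, u, rfl⟩
    rw [SetLike.mem_coe, LinearMap.mem_ker, ← conj_fockInner, fockInner_chevalleyF,
      mem_singular.1 hs i, map_zero, map_zero]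
  exact hle hc

/-- The subrepresentation generated by a highest weight vector is irreducible. -/
lemma isIrreducibleSubrep_wordSpan {lam : Fin ℓ → ℂ} {w : Fock}
    (hw : IsHighestWeight (affineFock ℓ) lam w) (hw0 : w ≠ 0) :
    IsIrreducibleSubrep (affineFock ℓ) (wordSpan (affineFock ℓ) w) := by
  refine ⟨isSubrep_wordSpan hw, fun h => hw0 ?_, fun N hN hle => or_iff_not_imp_left.2 fun hN0 => ?_⟩
  · exact (Submodule.mem_bot ℂ).1 (h ▸ self_mem_wordSpan)
  · obtain ⟨y, hy, hys, hy0⟩ := exists_singular (fun i v hv => hN (chevalleyE i) v hv) hN0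
    obtain ⟨c, rfl⟩ := exists_eq_smul_of_singular (mem_singular.2 hw.1) (hle hy) hys
    have hc : c ≠ 0 := fun hc => hy0 (by rw [hc, zero_smul])
    exact le_antisymm hle (wordSpan_le hN ((Submodule.smul_mem_iff _ hc).1 hy))

/-- The sum of the irreducible subrepresentations of charge `h` contains all weight spaces of charge
`h`. By induction on the energy, the orthogonal complement of this sum in a weight space consists of
singular vectors, and each of them generates an irreducible subrepresentation. -/
lemma fockWeight_le_sSup {h : ℤ} {δ : (Fin ℓ → ℤ) × ℤ} (hδ : chargeHom ℓ δ = h) :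
    fockWeight (posDeg ℓ) δ ≤
      sSup {N | IsIrreducibleSubrep (affineFock ℓ) N ∧ N ≤ fockCharge h} := by
  set T := sSup {N | IsIrreducibleSubrep (affineFock ℓ) N ∧ N ≤ fockCharge h} with hT
  have hTs : IsSubrep (affineFock ℓ) T := isSubrep_sSup fun N hN => hN.1.1
  suffices ∀ n : ℕ, ∀ δ, chargeHom ℓ δ = h → energyHom ℓ δ < n → fockWeight (posDeg ℓ) δ ≤ T from
    this ((energyHom ℓ δ).toNat + 1) δ hδ (by push_cast; omega)
  intro n
  induction n with
  | zero =>
    intro δ _ hn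
    refine Submodule.span_le.2 ?_
    rintro _ ⟨v, hv, rfl⟩
    have hv : v.weight (posDeg ℓ) = δ := hv
    have := v.energy_nonneg
    rw [energy_eq (ℓ := ℓ), hv] at this
    exact absurd hn (not_lt.2 (by exact_mod_cast this))
  | succ n ih =>
    intro δ hδ hn x hx
    have hfin : FiniteDimensional ℂ (fockWeight (posDeg ℓ) δ) := by
      refine FiniteDimensional.span_of_finite ℂ (Set.Finite.image _ ?_)
      refine (finite_energy (energyHom ℓ δ)).subset fun v (hv : v.weight (posDeg ℓ) = δ) => ?_
      rw [Set.mem_ofPred_eq, energy_eq (ℓ := ℓ), hv]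
    have hfin' : FiniteDimensional ℂ (T ⊓ fockWeight (posDeg ℓ) δ : Submodule ℂ Fock) :=
      Submodule.finiteDimensional_of_le inf_le_right
    obtain ⟨y, hy, hyx⟩ := exists_orthogonal_decomposition (T ⊓ fockWeight (posDeg ℓ) δ) x
    have hz : x - y ∈ fockWeight (posDeg ℓ) δ := sub_mem hx hy.2
    have hzs : x - y ∈ singular ℓ := by
      refine mem_singular.2 fun i => fockInner_self_eq_zero ?_
      rw [← fockInner_chevalleyF]
      have hE := affineFock_chevalleyE_mem i hz
      have hEF := affineFock_chevalleyF_mem i hE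
      rw [add_sub_cancel_right] at hEF
      -- `‖E_i z‖² = ⟨F_i E_i z, z⟩`, and `F_i E_i z` lies in the sum by induction
      refine hyx _ ⟨hTs _ _ (ih (δ + rootDeg i) ?_ ?_ hE), hEF⟩
      · rw [map_add, chargeHom_rootDeg, add_zero, hδ]
      · rw [map_add, energyHom_rootDeg]; push_cast at hn; omega
    have hzT : x - y ∈ T := by
      by_cases hz0 : x - y = 0
      · rw [hz0]; exact zero_mem _
      · have hw := isHighestWeight_of_singular hz hzs hz0
        refine (le_sSup ⟨isIrreducibleSubrep_wordSpan hw hz0, wordSpan_le (isSubrep_fockCharge h) ?_⟩ :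
          wordSpan (affineFock ℓ) (x - y) ≤ T) self_mem_wordSpan
        exact hδ ▸ fockWeight_le_fockCharge δ hz
    rw [← sub_add_cancel x y]
    exact add_mem hzT hy.1

lemma fockCharge_eq_sSup (h : ℤ) : fockCharge h =
    sSup {N | IsIrreducibleSubrep (affineFock ℓ) N ∧ N ≤ fockCharge h} := by
  refine le_antisymm (Submodule.span_le.2 ?_) (sSup_le fun N hN => hN.2)
  rintro _ ⟨v, hv, rfl⟩
  have hv : v.charge = h := hv
  exact fockWeight_le_sSup (by rw [← charge_eq, hv]) (basis_mem_fockWeight (posDeg ℓ) v)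

end Reducibility

/-! ### Fundamental representations in Fock space -/

section Fundamental

variable {ℓ : ℕ} [ℓ.AtLeastTwo]

/-- The representation of the whole of `ŝl_ℓ` on Fock space in which `d` acts by minus the second
component of the degree, shifted by the constant `e`. -/
def fockRepD (ℓ : ℕ) [ℓ.AtLeastTwo] (e : ℂ) : affineSl ℓ →ₗ⁅ℂ⁆ Module.End ℂ Fock where
  toFun x := fockOp (affineToInfty ℓ x) + (e * (x : AffineGl ℓ).d) • 1
  map_add' x y := by
    have h := map_add (fockRep.comp (affineToInfty ℓ)) (x : AffineGl ℓ) y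
    change fockOp (affineToInfty ℓ (x + y)) = fockOp (affineToInfty ℓ x) + fockOp (affineToInfty ℓ y)
      at h
    change fockOp (affineToInfty ℓ (x + y)) + (e * ((x : AffineGl ℓ).d + (y : AffineGl ℓ).d)) • 1 = _
    rw [h]
    module
  map_smul' r x := by
    have h := map_smul (fockRep.comp (affineToInfty ℓ)) r (x : AffineGl ℓ)
    change fockOp (affineToInfty ℓ (r • (x : AffineGl ℓ))) = r • fockOp (affineToInfty ℓ x) at h
    change fockOp (affineToInfty ℓ (r • (x : AffineGl ℓ))) + (e * (r * (x : AffineGl ℓ).d)) • 1 = _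
    rw [h, RingHom.id_apply]
    module
  map_lie' {x y} := by
    have h := LieHom.map_lie (fockRep.comp (affineToInfty ℓ)) (x : AffineGl ℓ) y
    change fockOp (affineToInfty ℓ ⁅(x : AffineGl ℓ), (y : AffineGl ℓ)⁆) =
      ⁅fockOp (affineToInfty ℓ x), fockOp (affineToInfty ℓ y)⁆ at h
    rw [LieSubalgebra.coe_bracket, h, AffineGl.d_lie, mul_zero, zero_smul, add_zero]
    simp only [LieRing.of_associative_ring_bracket, mul_add, add_mul, smul_mul_assoc, mul_smul_comm,
      one_mul, mul_one]
    module

/-- The highest weight vector generates the irreducible highest weight representation. -/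
lemma exists_smul_highestVec {lam : Fin ℓ → ℂ} {lamD : ℂ} (v : HighestWeightModule lam lamD) :
    ∃ u : UAffine ℓ, v = u • highestVec lam lamD := by
  obtain ⟨v, rfl⟩ := Submodule.Quotient.mk_surjective _ v
  obtain ⟨u, rfl⟩ := Submodule.Quotient.mk_surjective _ v
  exact ⟨u, by rw [highestVec, ← Submodule.Quotient.mk_smul, smul_vermaVec]⟩

/-- A homogeneous singular vector of charge `h` generates a copy of `V_{Λ_h}`. -/
lemma exists_embedding_of_homogeneous {δ : (Fin ℓ → ℤ) × ℤ} {w : Fock}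
    (hδ : w ∈ fockWeight (posDeg ℓ) δ) (hw : w ∈ singular ℓ) (hw0 : w ≠ 0) :
    ∃ g : FundamentalModule ℓ (chargeHom ℓ δ) →ₗ[ℂ] Fock, Function.Injective g ∧
      g (highestVec _ _) = w ∧ (∀ v, g v ∈ wordSpan (affineFock ℓ) w) ∧
      ∀ (x : affineSl' ℓ) (v : FundamentalModule ℓ (chargeHom ℓ δ)),
        g (toU (x : affineSl ℓ) • v) = affineFock ℓ x (g v) := by
  have hhw := isHighestWeight_of_singular hδ hw hw0
  let : Module (UAffine ℓ) Fock := Module.compHom Fock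
    (UniversalEnvelopingAlgebra.lift ℂ (fockRepD ℓ δ.2) : UAffine ℓ →ₐ[ℂ] Module.End ℂ Fock).toRingHom
  have smul_def : ∀ (u : UAffine ℓ) (v : Fock),
      u • v = UniversalEnvelopingAlgebra.lift ℂ (fockRepD ℓ δ.2) u v := fun _ _ => rfl
  have toU_smul : ∀ (x : affineSl ℓ) (v : Fock), toU x • v = fockRepD ℓ δ.2 x v := fun x v => by
    rw [smul_def, toU, UniversalEnvelopingAlgebra.lift_ι_apply]
  have : IsScalarTower ℂ (UAffine ℓ) Fock := ⟨fun c u v => by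
    rw [smul_def, smul_def, map_smul, LinearMap.smul_apply]⟩
  have hrep : derivedRep ℓ Fock = affineFock ℓ := by
    ext1 x
    refine LinearMap.ext fun v => ?_
    have hx : ((x : affineSl ℓ) : AffineGl ℓ).d = 0 := x.2
    rw [derivedRep_apply, toU_smul]
    change (fockOp (affineToInfty ℓ x) + (δ.2 * ((x : affineSl ℓ) : AffineGl ℓ).d : ℂ) • 1 :
      Module.End ℂ Fock) v = _
    rw [hx, mul_zero, zero_smul, add_zero, affineFock_apply]
  -- the shift is chosen such that `d` kills `w`
  have hd : toU (affineD ℓ) • w = (0 : ℂ) • w := by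
    have e : ((affineD ℓ : affineSl ℓ) : AffineGl ℓ) = cartan 0 0 1 := by
      ext1
      · simp [affineD, cartan]
      · rfl
      · rfl
    rw [toU_smul]
    change (fockOp (affineToInfty ℓ (affineD ℓ : affineSl ℓ)) + (δ.2 * 1 : ℂ) • 1 :
      Module.End ℂ Fock) w = _
    rw [LinearMap.add_apply, e, fockOp_cartan _ _ _ hδ, LinearMap.smul_apply, Module.End.one_apply,
      ← add_smul]
    congr 1
    simp
  have hwD : IsHighestWeightD (fundamentalWeight ℓ (chargeHom ℓ δ)) 0 w := ⟨hrep.symm ▸ hhw, hd⟩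
  have hword : ∀ u : UAffine ℓ, u • w ∈ wordSpan (affineFock ℓ) w := fun u => by
    have := smul_mem_wordSpan hwD u self_mem_wordSpan
    rwa [hrep] at this
  have hirr : ∀ u : UAffine ℓ, u • w ≠ 0 → ∃ u' : UAffine ℓ, u' • u • w = w := by
    intro u hu
    let N : Submodule ℂ Fock := (Submodule.span (UAffine ℓ) {u • w}).restrictScalars ℂ
    have hN : IsSubrep (affineFock ℓ) N := fun x v hv => by
      rw [← hrep, derivedRep_apply]
      exact (Submodule.span (UAffine ℓ) {u • w}).smul_mem _ hv
    have hmem : u • w ∈ N := Submodule.mem_span_singleton_self _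
    have hle : N ≤ wordSpan (affineFock ℓ) w := by
      intro y hy
      obtain ⟨u', rfl⟩ := Submodule.mem_span_singleton.1 (show y ∈ Submodule.span _ _ from hy)
      rw [← mul_smul]
      exact hword _
    have hNw := ((isIrreducibleSubrep_wordSpan hhw hw0).2.2 N hN hle).resolve_left fun h =>
      hu ((Submodule.mem_bot ℂ).1 (h ▸ hmem))
    have hwN : w ∈ N := hNw ▸ self_mem_wordSpan
    exact Submodule.mem_span_singleton.1 (show w ∈ Submodule.span _ _ from hwN)
  obtain ⟨g, hg, hgw⟩ := exists_highestWeightModule_embedding hwD hw0 hirr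
  refine ⟨g.restrictScalars ℂ, hg, hgw, fun v => ?_, fun x v => ?_⟩
  · obtain ⟨u, rfl⟩ := exists_smul_highestVec v
    rw [LinearMap.restrictScalars_apply, map_smul, hgw]
    exact hword u
  · rw [LinearMap.restrictScalars_apply, map_smul, ← hrep]
    rfl

/-- The highest weight vector of `V_{Λ_h}` can be sent to any singular vector of charge `h`,
homogeneous or not: the possible images form a subspace. -/
lemma exists_hom_of_singular {h : ℤ} {w : Fock} (hh : w ∈ fockCharge h) (hw : w ∈ singular ℓ) :
    ∃ g : FundamentalModule ℓ h →ₗ[ℂ] Fock, g (highestVec _ _) = w ∧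
      ∀ (x : affineSl' ℓ) (v : FundamentalModule ℓ h),
        g (toU (x : affineSl ℓ) • v) = affineFock ℓ x (g v) := by
  let P : Submodule ℂ Fock :=
    { carrier := {w | ∃ g : FundamentalModule ℓ h →ₗ[ℂ] Fock, g (highestVec _ _) = w ∧
        ∀ (x : affineSl' ℓ) (v : FundamentalModule ℓ h),
          g (toU (x : affineSl ℓ) • v) = affineFock ℓ x (g v)}
      zero_mem' := ⟨0, rfl, fun x v => (map_zero _).symm⟩
      add_mem' := by
        rintro _ _ ⟨g, rfl, hg⟩ ⟨g', rfl, hg'⟩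
        exact ⟨g + g', rfl, fun x v => by
          rw [LinearMap.add_apply, LinearMap.add_apply, hg, hg', map_add]⟩
      smul_mem' := by
        rintro r _ ⟨g, rfl, hg⟩
        exact ⟨r • g, rfl, fun x v => by
          rw [LinearMap.smul_apply, LinearMap.smul_apply, hg, map_smul]⟩ }
  suffices w ∈ P from this
  refine mem_of_weightProj_mem (posDeg ℓ) fun δ => ?_
  by_cases h0 : weightProj (posDeg ℓ) δ w = 0
  · rw [h0]; exact zero_mem _
  · have hδ : chargeHom ℓ δ = h := by
      by_contra hne
      exact h0 (weightProj_eq_zero_of_charge hne hh)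
    subst hδ
    obtain ⟨g, -, hgw, -, hg⟩ := exists_embedding_of_homogeneous (weightProj_mem (posDeg ℓ) δ w)
      (weightProj_mem_singular hw δ) h0
    exact ⟨g, hgw, hg⟩

/-- The restriction of `V_{Λ_h}` to the derived algebra stays irreducible, since `V_{Λ_h}` embeds in
Fock space as the subrepresentation generated by a singular vector. -/
lemma fundamentalModule_irreducible {h : ℤ} {w : Fock} (hh : w ∈ fockCharge h) (hw : w ∈ singular ℓ)
    (hw0 : w ≠ 0) {N : Submodule ℂ (FundamentalModule ℓ h)}
    (hN : IsSubrep (derivedRep ℓ (FundamentalModule ℓ h)) N) : N = ⊥ ∨ N = ⊤ := by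
  obtain ⟨δ, hδ⟩ : ∃ δ, weightProj (posDeg ℓ) δ w ≠ 0 := by
    by_contra! h0
    have : w ∈ (⊥ : Submodule ℂ Fock) :=
      mem_of_weightProj_mem (posDeg ℓ) fun δ => (Submodule.mem_bot ℂ).2 (h0 δ)
    exact hw0 ((Submodule.mem_bot ℂ).1 this)
  obtain rfl : chargeHom ℓ δ = h := by
    by_contra hne
    exact hδ (weightProj_eq_zero_of_charge hne hh)
  have hs := weightProj_mem_singular hw δ
  have hδm := weightProj_mem (posDeg ℓ) δ w
  obtain ⟨g, hg, -, hgle, hgx⟩ := exists_embedding_of_homogeneous hδm hs hδ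
  have hmap : IsSubrep (affineFock ℓ) (N.map g) := by
    rintro x _ ⟨v, hv, rfl⟩
    rw [← hgx]
    exact ⟨_, hN x v hv, rfl⟩
  have hle : N.map g ≤ wordSpan (affineFock ℓ) (weightProj (posDeg ℓ) δ w) := by
    rintro _ ⟨v, -, rfl⟩
    exact hgle v
  rcases (isIrreducibleSubrep_wordSpan (isHighestWeight_of_singular hδm hs hδ) hδ).2.2 _ hmap hle
    with h0 | h1
  · refine Or.inl ((Submodule.eq_bot_iff _).2 fun v hv => hg ?_)
    rw [map_zero]
    exact (Submodule.mem_bot ℂ).1 (h0 ▸ Submodule.mem_map_of_mem hv)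
  · refine Or.inr (eq_top_iff.2 fun v _ => ?_)
    have hv := hgle v
    rw [← h1] at hv
    obtain ⟨v', hv', e⟩ := hv
    exact hg e ▸ hv'

/-- A homomorphism that sends the highest weight vector to a singular vector of an irreducible
subrepresentation is an isomorphism to it, as both sides are irreducible. -/
lemma exists_equiv_fundamentalModule {h : ℤ} {N : Submodule ℂ Fock}
    (hN : IsIrreducibleSubrep (affineFock ℓ) N) (hle : N ≤ fockCharge h) :
    ∃ f : FundamentalModule ℓ (h : ZMod ℓ) ≃ₗ[ℂ] N,
      ∀ (x : affineSl' ℓ) (v : FundamentalModule ℓ (h : ZMod ℓ)),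
        (f (toU (x : affineSl ℓ) • v) : Fock) = affineFock ℓ x (f v) := by
  obtain ⟨hNs, hN0, hNirr⟩ := hN
  obtain ⟨w, hwN, hw, hw0⟩ := exists_singular (fun i v hv => hNs (chevalleyE i) v hv) hN0
  obtain ⟨g, hgw, hg⟩ := exists_hom_of_singular (hle hwN) hw
  have hirr := fun N' => fundamentalModule_irreducible (hle hwN) hw hw0 (N := N')
  have hinj : Function.Injective g := by
    rw [← LinearMap.ker_eq_bot]
    refine (hirr _ fun x v hv => ?_).resolve_right fun htop => hw0 ?_
    · rw [LinearMap.mem_ker] at hv ⊢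
      rw [derivedRep_apply, hg, hv, map_zero]
    · have : highestVec _ _ ∈ LinearMap.ker g := htop ▸ Submodule.mem_top
      rw [← hgw]
      exact this
  have hmem : ∀ v, g v ∈ N := by
    have hcomap := (hirr (N.comap g) fun x v hv => by
      rw [Submodule.mem_comap, derivedRep_apply, hg]
      exact hNs x _ hv).resolve_left fun hbot => hw0 (by
        have hv : highestVec _ _ ∈ N.comap g := by
          rw [Submodule.mem_comap, hgw]
          exact hwN
        rw [hbot, Submodule.mem_bot] at hv
        rw [← hgw, hv, map_zero])
    intro v
    have : v ∈ N.comap g := hcomap ▸ Submodule.mem_top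
    exact this
  have hrange : LinearMap.range g = N := by
    refine (hNirr _ ?_ ?_).resolve_left fun hbot => hw0 ?_
    · rintro x _ ⟨v, rfl⟩
      rw [← hg]
      exact ⟨_, rfl⟩
    · rintro _ ⟨v, rfl⟩
      exact hmem v
    · have : w ∈ LinearMap.range g := ⟨_, hgw⟩
      exact (Submodule.mem_bot ℂ).1 (hbot ▸ this)
  exact ⟨(LinearEquiv.ofInjective g hinj).trans (LinearEquiv.ofEq _ _ hrange), hg⟩

end Fundamental

/-! ### The embedding on the elements `X ⊗ tᵐ` and `c` -/

section Loop

variable {ℓ : ℕ} [ℓ.AtLeastTwo]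

lemma c_affineEmbedding_affineLoop (X : LieAlgebra.SpecialLinear.sl (Fin ℓ) ℂ) (m : ℤ) :
    (affineEmbedding ℓ (affineLoop X m)).c = 0 := rfl

lemma matEntry_affineEmbedding_affineLoop (X : LieAlgebra.SpecialLinear.sl (Fin ℓ) ℂ)
    (m p q : ℤ) : matEntry (affineEmbedding ℓ (affineLoop X m)).mat p q =
      ∑ i : Fin ℓ, ∑ j : Fin ℓ, X.1 i j * loopEntry i j m p q := by
  have h1 : (LaurentPolynomial.C (X.1 (res ℓ p) (res ℓ q)) * LaurentPolynomial.T m).coeff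
      (lev ℓ q - lev ℓ p) = if lev ℓ q - lev ℓ p = m then X.1 (res ℓ p) (res ℓ q) else 0 := by
    rw [← LaurentPolynomial.single_eq_C_mul_T, AddMonoidAlgebra.coeff_single, Finsupp.single_apply]
    simp only [eq_comm]
  have h2 : ((affineLoop X m : affineSl ℓ) : AffineGl ℓ).d = 0 := rfl
  rw [affineEmbedding_apply, matEntry_affineToInfty, h2, mul_zero, neg_zero, ite_self, add_zero]
  change (LaurentPolynomial.C (X.1 (res ℓ p) (res ℓ q)) * LaurentPolynomial.T m).coeff _ = _
  rw [h1, Finset.sum_eq_single (res ℓ p), Finset.sum_eq_single (res ℓ q)]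
  · simp [loopEntry_eq]
  · intro j _ hj
    rw [loopEntry_eq, if_neg (fun h => hj h.2.1.symm), mul_zero]
  · simp
  · intro i _ hi
    refine Finset.sum_eq_zero fun j _ => ?_
    rw [loopEntry_eq, if_neg (fun h => hi h.1.symm), mul_zero]
  · simp

lemma affineEmbedding_affineC : affineEmbedding ℓ (affineC ℓ) = ⟨0, 1⟩ := by
  refine AInfty.ext (Subtype.ext (matEntry_ext fun p q => ?_)) rfl
  rw [affineEmbedding_apply, matEntry_affineToInfty]
  simp [affineC, matEntry]

lemma affineEmbedding_injective : Function.Injective (affineEmbedding ℓ) :=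
  (injective_iff_map_eq_zero (affineEmbedding ℓ)).2 fun x hx =>
    Subtype.ext (Subtype.ext (affineToInfty_eq_zero x.2 hx))

end Loop

end

theorem mainTheorem2 (ℓ : ℕ) [ℓ.AtLeastTwo] :
    ∃ (φ : affineSl' ℓ →ₗ⁅ℂ⁆ AInfty) (ρ : AInfty →ₗ⁅ℂ⁆ Module.End ℂ Fock),
      (∀ (X : LieAlgebra.SpecialLinear.sl (Fin ℓ) ℂ) (m : ℤ),
        (φ (affineLoop X m)).c = 0 ∧
        ∀ p q : ℤ, matEntry (φ (affineLoop X m)).mat p q =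
          ∑ i : Fin ℓ, ∑ j : Fin ℓ, X.1 i j * loopEntry i j m p q) ∧
      φ (affineC ℓ) = ⟨0, 1⟩ ∧
      Function.Injective φ ∧
      (∀ a : AInfty, ρ a = fockOp a) ∧
      ρ (φ (affineC ℓ)) = 1 ∧
      Function.Injective ρ ∧
      (∀ h : ℤ, IsSubrep (ρ.comp φ) (fockCharge h)) ∧
      (∀ h : ℤ, fockCharge h =
        sSup {N | IsIrreducibleSubrep (ρ.comp φ) N ∧ N ≤ fockCharge h}) ∧
      (∀ (h : ℤ) (N : Submodule ℂ Fock),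
        IsIrreducibleSubrep (ρ.comp φ) N → N ≤ fockCharge h →
        ∃ f : FundamentalModule ℓ (h : ZMod ℓ) ≃ₗ[ℂ] N,
          ∀ (x : affineSl' ℓ) (v : FundamentalModule ℓ (h : ZMod ℓ)),
            (f (toU (x : affineSl ℓ) • v) : Fock) = ρ (φ x) (f v)) := by
  refine ⟨affineEmbedding ℓ, fockRep, fun X m => ⟨c_affineEmbedding_affineLoop X m,
    matEntry_affineEmbedding_affineLoop X m⟩, affineEmbedding_affineC, affineEmbedding_injective,
    fockRep_apply, ?_, fockRep_injective, isSubrep_fockCharge, fockCharge_eq_sSup,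
    fun h N => exists_equiv_fundamentalModule⟩
  rw [affineEmbedding_affineC, fockRep_apply, fockOp_of_mat_eq_zero rfl, one_smul]
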